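/- Let $G$ be a compactly generated locally compact (Hausdorff) group and let $|\cdot|$ be the word length on $G$ associated with a compact generating subset $S$. Fix the scalar field to be $\mathbf{R}$ or $\mathbf{C}$. A Banach $G$-module is a Banach space $V$ with a representation $\pi$ of $G$ by bounded operators such that $g\mapsto \pi(g)v$ is continuous for all $v\in V$. It is weakly almost periodic (WAP) if every orbit $\pi(G)v$ is relatively compact in the weak topology. Let $V^G$ be the set of fixed vectors and $V^{G,\mathrm{ap}}$ the set of vectors whose orbit has compact closure in the norm topology. Let $Z^1(G,V)$ be the space of continuous maps $b:G\to V$ with $b(gh)=\pi(g)b(h)+b(g)$, with the topology of uniform convergence on compact subsets, let $B^1(G,V)$ be the subspace of maps $g\mapsto v-\pi(g)v$ with $v\in V$, and let $\overline{H^1}(G,V)=Z^1(G,V)/\overline{B^1(G,V)}$. The group $G$ has Property $\mathcal{WAP}_{\mathrm{t}}$ (respectively $\mathcal{WAP}_{\mathrm{ap}}$) if $\overline{H^1}(G,V)=0$ for every WAP Banach $G$-module $V$ with $V^G=\{0\}$ (respectively $V^{G,\mathrm{ap}}=\{0\}$). A measure-preserving action of $G$ on a probability space $(X,\mu)$ is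 a measurable map $G\times X\to X$, $(g,x)\mapsto gx$ ($G$ carrying the Lebesgue $\sigma$-algebra), such that each $x\mapsto gx$ preserves $\mu$ and, for all $g,h\in G$, $g(hx)=(gh)x$ for almost every $x$. It is ergodic if every measurable set that is invariant under each $g\in G$ up to null sets is null or conull. The group $G$ acts on $L^1(X)$ by $(\pi(g)f)(x)=f(g^{-1}x)$. We say that $G$ satisfies the mean ergodic theorem for cocycles in $L^1$ if for every ergodic measure-preserving action of $G$ on a probability space $(X,\mu)$ and every continuous cocycle $c\in Z^1(G,L^1(X))$, $$\lim_{|g|\to\infty}\frac{1}{|g|}\left(c(g)-\int_X c(g)\,d\mu\right)=0\quad\text{in } L^1(X).$$ Proposition. If $G$ has Property $\mathcal{WAP}_{\mathrm{ap}}$, then $G$ satisfies the mean ergodic theorem for cocycles in $L^1$ if and only if $G$ has Property $\mathcal{WAP}_{\mathrm{t}}$. -/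

import Mathlib

open MeasureTheory Filter Topology

universe u v

noncomputable section

namespace WAPErgodic

section Cohomology

variable {𝕜 : Type*} [RCLike 𝕜] {G : Type*} [Group G] [TopologicalSpace G]
  {V : Type*} [NormedAddCommGroup V] [NormedSpace 𝕜 V]

/-- Continuous 1-cocycles `b(gh) = π(g) b(h) + b(g)`, inside `C(G, V)` with the topology of
uniform convergence on compact subsets. -/
def cocycles (π : G → V →L[𝕜] V) : Submodule 𝕜 C(G, V) where
  carrier := {b | ∀ g h, b (g * h) = π g (b h) + b g}
  add_mem' := by
    intro a b ha hb g h
    simp only [ContinuousMap.add_apply, ha g h, hb g h, map_add]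
    abel
  zero_mem' := by
    intro g h
    simp
  smul_mem' := by
    intro r b hb g h
    simp only [ContinuousMap.smul_apply, hb g h, smul_add, map_smul]

/-- Coboundaries `b(g) = v - π(g) v`, inside the space of cocycles. -/
def coboundaries (π : G → V →L[𝕜] V) : Submodule 𝕜 (cocycles π) where
  carrier := {b | ∃ v : V, ∀ g, (b : C(G, V)) g = v - π g v}
  add_mem' := by
    rintro a b ⟨v, hv⟩ ⟨w, hw⟩
    refine ⟨v + w, fun g => ?_⟩
    simp only [Submodule.coe_add, ContinuousMap.add_apply, hv g, hw g, map_add]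
    abel
  zero_mem' := ⟨0, fun g => by simp⟩
  smul_mem' := by
    rintro r b ⟨v, hv⟩
    refine ⟨r • v, fun g => ?_⟩
    simp only [Submodule.coe_smul, ContinuousMap.smul_apply, hv g, map_smul, smul_sub]

/-- First reduced cohomology: cocycles modulo the closure of the coboundaries, for the topology of
uniform convergence on compact subsets. -/
abbrev ReducedH1 (π : G → V →L[𝕜] V) : Type _ :=
  cocycles π ⧸ (coboundaries π).topologicalClosure

end Cohomology

/-- The structure of a `G`-module on a normed space `V` (a Banach `G`-module if `V` is complete):
a representation by bounded operators with continuous orbit maps. -/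
structure GModule (𝕜 : Type*) [RCLike 𝕜] (G : Type*) [Group G] [TopologicalSpace G]
    (V : Type*) [NormedAddCommGroup V] [NormedSpace 𝕜 V] where
  ρ : G →* (V →L[𝕜] V)
  continuous_orbit : ∀ v : V, Continuous fun g => ρ g v

namespace GModule

variable {𝕜 : Type*} [RCLike 𝕜] {G : Type*} [Group G] [TopologicalSpace G]
  {V : Type*} [NormedAddCommGroup V] [NormedSpace 𝕜 V]

/-- Weakly almost periodic: all orbits are relatively compact in the weak topology. -/
def IsWAP (M : GModule 𝕜 G V) : Prop :=
  ∀ v : V, IsCompact (closure (Set.range fun g => toWeakSpace 𝕜 V (M.ρ g v)))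

/-- The set `V^G` of fixed vectors. -/
def fixedVectors (M : GModule 𝕜 G V) : Set V :=
  {v | ∀ g, M.ρ g v = v}

/-- The set `V^{G,ap}` of vectors whose orbit has compact closure in the norm topology. -/
def apVectors (M : GModule 𝕜 G V) : Set V :=
  {v | IsCompact (closure (Set.range fun g => M.ρ g v))}

end GModule

/-- Property `WAP_t` for Banach modules over `𝕜`. -/
def PropertyWAPt (𝕜 : Type) [RCLike 𝕜] (G : Type u) [Group G] [TopologicalSpace G] : Prop :=
  ∀ (V : Type v) [NormedAddCommGroup V] [NormedSpace 𝕜 V] [CompleteSpace V]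
    (M : GModule 𝕜 G V), M.IsWAP → M.fixedVectors = {0} → Subsingleton (ReducedH1 M.ρ)

/-- Property `WAP_ap` for Banach modules over `𝕜`. -/
def PropertyWAPap (𝕜 : Type) [RCLike 𝕜] (G : Type u) [Group G] [TopologicalSpace G] : Prop :=
  ∀ (V : Type v) [NormedAddCommGroup V] [NormedSpace 𝕜 V] [CompleteSpace V]
    (M : GModule 𝕜 G V), M.IsWAP → M.apVectors = {0} → Subsingleton (ReducedH1 M.ρ)

/-- The word length of `g` with respect to `S`: the least `n` such that `g` is a product of `n`
elements of `S ∪ S⁻¹` (meaningful when `S` generates `G`). -/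
def wordLength {G : Type*} [Group G] (S : Set G) (g : G) : ℕ :=
  sInf {n | ∃ l : List G, l.length = n ∧ (∀ s ∈ l, s ∈ S ∨ s⁻¹ ∈ S) ∧ l.prod = g}

/-- The Lebesgue σ-algebra of a locally compact group: the completion of the Borel σ-algebra with
respect to a Haar measure. -/
abbrev lebesgueSigmaAlgebra (G : Type*) [Group G] [TopologicalSpace G] [IsTopologicalGroup G]
    [LocallyCompactSpace G] : MeasurableSpace G :=
  letI : MeasurableSpace G := borel G
  haveI : BorelSpace G := ⟨rfl⟩
  (inferInstance : MeasurableSpace (NullMeasurableSpace G (Measure.haar : Measure G)))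

/-- A measure-preserving action of `G` on `(X, μ)`, where the action law holds almost everywhere
for each pair of group elements. -/
structure MPAction (G : Type*) [Group G] [TopologicalSpace G] [IsTopologicalGroup G]
    [LocallyCompactSpace G] {X : Type*} [MeasurableSpace X] (μ : Measure X) where
  act : G → X → X
  measurable_act :
    @Measurable (G × X) X (@Prod.instMeasurableSpace G X (lebesgueSigmaAlgebra G) inferInstance)
      inferInstance (fun p => act p.1 p.2)
  act_mul : ∀ g h, ∀ᵐ x ∂μ, act (g * h) x = act g (act h x)
  measurePreserving : ∀ g, MeasurePreserving (act g) μ μ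

namespace MPAction

variable {G : Type*} [Group G] [TopologicalSpace G] [IsTopologicalGroup G]
  [LocallyCompactSpace G] {X : Type*} [MeasurableSpace X] {μ : Measure X}

/-- Ergodicity: a measurable set that is invariant, up to null sets, under each group element is
null or conull. -/
def IsErgodic (A : MPAction G μ) : Prop :=
  ∀ E : Set X, MeasurableSet E → (∀ g, A.act g ⁻¹' E =ᵐ[μ] E) → μ E = 0 ∨ μ Eᶜ = 0

/-- The representation on `L¹(X, μ)`, `(π(g) f)(x) = f(g⁻¹ x)`. -/
def koopman (𝕜 : Type*) [RCLike 𝕜] (A : MPAction G μ) (g : G) :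
    Lp 𝕜 1 μ →L[𝕜] Lp 𝕜 1 μ :=
  haveI : Fact ((1 : ENNReal) ≤ 1) := ⟨le_rfl⟩
  (Lp.compMeasurePreservingₗᵢ 𝕜 (A.act g⁻¹) (A.measurePreserving g⁻¹)).toContinuousLinearMap

end MPAction

/-- The mean ergodic theorem for cocycles in `L¹`, with the word length given by `S`. -/
def MeanErgodicL1 (𝕜 : Type) [RCLike 𝕜] (G : Type u) [Group G] [TopologicalSpace G]
    [IsTopologicalGroup G] [LocallyCompactSpace G] (S : Set G) : Prop :=
  ∀ (X : Type v) [MeasurableSpace X] (μ : Measure X) [IsProbabilityMeasure μ]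
    (A : MPAction G μ), A.IsErgodic → ∀ c ∈ cocycles (A.koopman 𝕜),
      Tendsto
        (fun g => ((wordLength S g : 𝕜)⁻¹) • (c g - Lp.const 1 μ (∫ x, c g x ∂μ)))
        (comap (wordLength S) atTop) (𝓝 0)

end WAPErgodic

end

noncomputable section

namespace WAPErgodic

/-! ### Word length -/

section WordLength

variable {G : Type*} [Group G] {S : Set G}

/-! Assume `PropertyWAPt` and let c be a cocycle in L¹ over an ergodic action. Subtracting the
integrals gives a cocycle in the mean-zero functions with continuous orbits. That module is WAP,
because L² is dense in L¹ and Hilbert balls are weakly compact, and ergodicity leaves it no fixed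
vectors. Hence the cocycle is, uniformly on S ∪ S⁻¹, arbitrarily close to coboundaries. The error
cocycle then grows at an arbitrarily small linear rate while coboundaries are bounded, so c minus
its mean is sublinear.

Conversely, let b be a cocycle in a WAP module without fixed vectors. The closed span of b(G) is
separable, and `GModule.IsWAP.exists_projection` splits it equivariantly into its almost periodic
vectors W and a complement containing no nonzero ones. `PropertyWAPap` settles the complement. On W
the group acts through a dense homomorphism into a compact group K (`BohrGroup`). For a functional
φ, the functions y ↦ φ(y⁻¹ b(g)) form a mean-zero cocycle over the ergodic translation action on K.
The mean ergodic theorem makes it sublinear in L¹(K), and interpolation with the linear sup-norm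
bound makes it sublinear in L²(K) (`MeanErgodicL1.matrixCoeff_sublinear`).

It remains to return from coefficients to W. Projecting L²(K) to a finite-dimensional bi-invariant
subspace without invariant vectors turns the coefficients into sublinear cocycles in a
finite-dimensional isometric representation, which are coboundaries
(`exists_eq_coboundary_of_sublinear`). `exists_eq_coboundary_of_coefficients` assembles these
solutions, over all φ, into one vector of W. Applied to the projection of an approximate identity
minus 1, this shows that a small perturbation of b on a compact set is a coboundary
(`exists_near_coboundary_of_sublinear`). -/

theorem exists_list_wordLength (hgen : Subgroup.closure S = ⊤) (g : G) :
    ∃ l : List G, l.length = wordLength S g ∧ (∀ s ∈ l, s ∈ S ∨ s⁻¹ ∈ S) ∧ l.prod = g := by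
  have hne : {n | ∃ l : List G, l.length = n ∧ (∀ s ∈ l, s ∈ S ∨ s⁻¹ ∈ S) ∧ l.prod = g}.Nonempty := by
    have hg : g ∈ Subgroup.closure S := by simp [hgen]
    rw [← Subgroup.mem_toSubmonoid, Subgroup.closure_toSubmonoid] at hg
    obtain ⟨l, hl, hp⟩ := Submonoid.exists_list_of_mem_closure hg
    simp only [Set.mem_union, Set.mem_inv] at hl
    exact ⟨l.length, l, rfl, hl, hp⟩
  exact Nat.sInf_mem hne

theorem wordLength_prod_le (l : List G) (hl : ∀ s ∈ l, s ∈ S ∨ s⁻¹ ∈ S) :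
    wordLength S l.prod ≤ l.length :=
  Nat.sInf_le ⟨l, rfl, hl, rfl⟩

theorem wordLength_mul_le (hgen : Subgroup.closure S = ⊤) (g h : G) :
    wordLength S (g * h) ≤ wordLength S g + wordLength S h := by
  obtain ⟨l, hl, hls, rfl⟩ := exists_list_wordLength hgen g
  obtain ⟨m, hm, hms, rfl⟩ := exists_list_wordLength hgen h
  rw [← List.prod_append, ← hl, ← hm, ← List.length_append]
  refine wordLength_prod_le _ fun s hs => ?_
  rcases List.mem_append.1 hs with h | h
  exacts [hls s h, hms s h]

end WordLength

/-! ### Growth of cocycles and reduced cohomology -/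

section Cocycles

variable {𝕜 : Type*} [RCLike 𝕜] {G : Type*} [Group G]
  {V : Type*} [NormedAddCommGroup V] [NormedSpace 𝕜 V]

theorem cocycle_one {π : G →* (V →L[𝕜] V)} {b : G → V}
    (hb : ∀ g h, b (g * h) = π g (b h) + b g) : b 1 = 0 := by
  simpa using hb 1 1

/-- Removing the last letter, b(gs) = π(g)b(s) + b(g), costs at most C * M. -/
theorem norm_cocycle_le {S : Set G} (hgen : Subgroup.closure S = ⊤) {π : G →* (V →L[𝕜] V)}
    {C M : ℝ} (hC : ∀ g, ‖π g‖ ≤ C) {b : G → V} (hb : ∀ g h, b (g * h) = π g (b h) + b g)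
    (hM : ∀ s, s ∈ S ∨ s⁻¹ ∈ S → ‖b s‖ ≤ M) (g : G) :
    ‖b g‖ ≤ C * M * wordLength S g := by
  obtain ⟨l, hl, hls, rfl⟩ := exists_list_wordLength hgen g
  rw [← hl]
  clear hl
  induction l using List.reverseRecOn with
  | nil => simp [cocycle_one hb]
  | append_singleton l s ih =>
    have h1 := ih fun t ht => hls t (List.mem_append_left _ ht)
    have h2 := hM s (hls s (by simp))
    have h3 : ‖π l.prod (b s)‖ ≤ C * M :=
      ((π l.prod).le_opNorm _).trans
        (mul_le_mul (hC _) h2 (norm_nonneg _) ((norm_nonneg _).trans (hC 1)))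
    rw [List.prod_append, List.prod_singleton, hb, List.length_append, List.length_singleton]
    push_cast
    calc _ ≤ _ := norm_add_le _ _
      _ ≤ C * M + C * M * l.length := add_le_add h3 h1
      _ = _ := by ring

theorem exists_norm_le_on_generators [TopologicalSpace G] [IsTopologicalGroup G] {S : Set G}
    (hS : IsCompact S) {b : G → V} (hb : Continuous b) :
    ∃ M, 0 ≤ M ∧ ∀ s, s ∈ S ∨ s⁻¹ ∈ S → ‖b s‖ ≤ M := by
  obtain ⟨M, hM⟩ := (hS.union hS.inv).exists_bound_of_continuousOn hb.continuousOn
  exact ⟨max M 0, le_max_right _ _, fun s hs => (hM s (by simpa using hs)).trans (le_max_left _ _)⟩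

variable [TopologicalSpace G]

theorem mem_closure_coboundaries_iff (M : GModule 𝕜 G V) (c : cocycles (M.ρ : G → V →L[𝕜] V)) :
    c ∈ (coboundaries (M.ρ : G → V →L[𝕜] V)).topologicalClosure ↔
      ∀ Q : Set G, IsCompact Q → ∀ ε > 0, ∃ v : V, ∀ g ∈ Q,
        ‖(c : C(G, V)) g - (v - M.ρ g v)‖ < ε := by
  have hu := (Metric.uniformity_basis_dist (α := V)).compactConvergenceUniformity (α := G)
  have hbas := (nhds_basis_uniformity hu (x := (c : C(G, V)))).comap (Subtype.val : cocycles (M.ρ : G → V →L[𝕜] V) → C(G, V))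
  rw [← nhds_induced] at hbas
  rw [← SetLike.mem_coe, Submodule.topologicalClosure_coe, mem_closure_iff_nhds_basis hbas]
  constructor
  · intro h Q hQ ε hε
    obtain ⟨d, ⟨v, hv⟩, hd⟩ := h (Q, ε) ⟨hQ, hε⟩
    refine ⟨v, fun g hg => ?_⟩
    rw [← hv g, ← dist_eq_norm, dist_comm]
    exact hd g hg
  · rintro h ⟨Q, ε⟩ ⟨hQ, hε⟩
    obtain ⟨v, hv⟩ := h Q hQ ε hε
    let d : C(G, V) := ⟨fun g => v - M.ρ g v, continuous_const.sub (M.continuous_orbit v)⟩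
    have hd : d ∈ cocycles (M.ρ : G → V →L[𝕜] V) := by
      intro g h
      change v - M.ρ (g * h) v = M.ρ g (v - M.ρ h v) + (v - M.ρ g v)
      rw [map_mul, map_sub, mul_apply_eq_comp]
      abel
    refine ⟨⟨d, hd⟩, ⟨v, fun g => rfl⟩, fun g hg => ?_⟩
    change dist (v - M.ρ g v) ((c : C(G, V)) g) < ε
    rw [dist_comm, dist_eq_norm]
    exact hv g hg

theorem subsingleton_reducedH1_iff (M : GModule 𝕜 G V) :
    Subsingleton (ReducedH1 (M.ρ : G → V →L[𝕜] V)) ↔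
      ∀ b : C(G, V), (∀ g h, b (g * h) = M.ρ g (b h) + b g) →
        ∀ Q : Set G, IsCompact Q → ∀ ε > 0, ∃ v : V, ∀ g ∈ Q, ‖b g - (v - M.ρ g v)‖ < ε := by
  rw [Submodule.Quotient.subsingleton_iff, Submodule.eq_top_iff']
  constructor
  · intro h b hb
    exact (mem_closure_coboundaries_iff M ⟨b, hb⟩).1 (h _)
  · intro h c
    exact (mem_closure_coboundaries_iff M c).2 (h c.1 c.2)

/-- Only the compact set S ∪ S⁻¹ matters: if b is within η/(C+1) of a coboundary there, the
difference is a cocycle of growth rate at most η, and the coboundary is bounded by ‖v‖ + C‖v‖. -/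
theorem exists_norm_cocycle_le_of_almost_coboundary [IsTopologicalGroup G] {S : Set G}
    (hS : IsCompact S) (hgen : Subgroup.closure S = ⊤) (M : GModule 𝕜 G V) {C : ℝ}
    (hC : ∀ g, ‖M.ρ g‖ ≤ C) {b : G → V} (hb : ∀ g h, b (g * h) = M.ρ g (b h) + b g)
    (h : ∀ Q : Set G, IsCompact Q → ∀ ε > 0, ∃ v : V, ∀ g ∈ Q, ‖b g - (v - M.ρ g v)‖ < ε) :
    ∀ η > 0, ∃ B, ∀ g, ‖b g‖ ≤ η * wordLength S g + B := by
  intro η hη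
  have hC0 : 0 ≤ C := (norm_nonneg _).trans (hC 1)
  obtain ⟨v, hv⟩ := h _ (hS.union hS.inv) (η / (C + 1)) (by positivity)
  have hcoc : ∀ g h, b (g * h) - (v - M.ρ (g * h) v)
      = M.ρ g (b h - (v - M.ρ h v)) + (b g - (v - M.ρ g v)) := by
    intro g h
    simp only [hb, map_mul, map_sub, mul_apply_eq_comp]
    abel
  refine ⟨‖v‖ + C * ‖v‖, fun g => ?_⟩
  have h1 := norm_cocycle_le hgen hC (b := fun g => b g - (v - M.ρ g v)) hcoc
    (fun s hs => (hv s (by simpa using hs)).le) g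
  have h2 : C * (η / (C + 1)) ≤ η := by
    rw [mul_div_assoc', div_le_iff₀ (by positivity)]
    nlinarith
  have h3 : ‖v - M.ρ g v‖ ≤ ‖v‖ + C * ‖v‖ :=
    (norm_sub_le _ _).trans (add_le_add_right ((M.ρ g).le_of_opNorm_le (hC g) v) _)
  calc ‖b g‖ = ‖(b g - (v - M.ρ g v)) + (v - M.ρ g v)‖ := by rw [sub_add_cancel]
    _ ≤ _ := norm_add_le _ _
    _ ≤ η * wordLength S g + (‖v‖ + C * ‖v‖) :=
      add_le_add (h1.trans (mul_le_mul_of_nonneg_right h2 (Nat.cast_nonneg _))) h3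

end Cocycles

/-! ### Weak compactness -/

section WeakTopology

variable {𝕜 : Type*} [RCLike 𝕜] {V W : Type*} [NormedAddCommGroup V] [NormedSpace 𝕜 V]
  [NormedAddCommGroup W] [NormedSpace 𝕜 W]

theorem continuous_weakSpace_dual (φ : StrongDual 𝕜 V) :
    Continuous fun x : WeakSpace 𝕜 V => φ ((toWeakSpace 𝕜 V).symm x) :=
  WeakBilin.eval_continuous (topDualPairing 𝕜 V).flip φ

theorem continuous_to_weakSpace {X : Type*} [TopologicalSpace X] {f : X → WeakSpace 𝕜 V}
    (h : ∀ φ : StrongDual 𝕜 V, Continuous fun x => φ ((toWeakSpace 𝕜 V).symm (f x))) :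
    Continuous f :=
  WeakBilin.continuous_of_continuous_eval _ h

instance t2Space_weakSpace : T2Space (WeakSpace 𝕜 V) := by
  refine T2Space.of_injective_continuous
    (f := fun (x : WeakSpace 𝕜 V) (φ : StrongDual 𝕜 V) => φ ((toWeakSpace 𝕜 V).symm x)) ?_
    (continuous_pi continuous_weakSpace_dual)
  intro x y h
  by_contra hxy
  obtain ⟨φ, hφ⟩ := SeparatingDual.exists_separating_of_ne (R := 𝕜)
    (x := (toWeakSpace 𝕜 V).symm x) (y := (toWeakSpace 𝕜 V).symm y) (by simpa using hxy)
  exact hφ (congrFun h φ)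

theorem exists_dual_vanishing_on {p : Submodule 𝕜 V} (hp : IsClosed (p : Set V)) {x : V}
    (hx : x ∉ p) : ∃ φ : StrongDual 𝕜 V, φ x ≠ 0 ∧ ∀ y ∈ p, φ y = 0 := by
  have : IsClosed (p : Set V) := hp
  obtain ⟨φ, hφ⟩ := SeparatingDual.exists_ne_zero (R := 𝕜) (x := (p.mkQ x : V ⧸ p))
    (by simpa using hx)
  refine ⟨φ.comp p.mkQL, hφ, fun y hy => ?_⟩
  have : p.mkQL y = 0 := (Submodule.Quotient.mk_eq_zero p).2 hy
  simp [this]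

/-- Hahn–Banach twice: functionals on p extend, so the induced topology is the weak one; and p is
the common zero set of the functionals that vanish on it. -/
theorem isClosedEmbedding_weakSpace_subtype {p : Submodule 𝕜 V} (hp : IsClosed (p : Set V)) :
    IsClosedEmbedding (WeakSpace.map p.subtypeL) := by
  refine ⟨⟨⟨le_antisymm (WeakSpace.map p.subtypeL).continuous.le_induced ?_⟩, ?_⟩, ?_⟩
  · rw [← continuous_id_iff_le]
    refine @continuous_to_weakSpace 𝕜 _ p _ _ (WeakSpace 𝕜 p)
      (TopologicalSpace.induced (WeakSpace.map p.subtypeL) inferInstance) id fun ℓ => ?_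
    obtain ⟨ℓ', hℓ', -⟩ := exists_extension_norm_eq p ℓ
    let _ : TopologicalSpace (WeakSpace 𝕜 p) :=
      TopologicalSpace.induced (WeakSpace.map p.subtypeL) inferInstance
    have h : Continuous fun x : WeakSpace 𝕜 p =>
        ℓ' ((toWeakSpace 𝕜 V).symm (WeakSpace.map p.subtypeL x)) :=
      (continuous_weakSpace_dual ℓ').comp continuous_induced_dom
    exact h.congr fun x => hℓ' x
  · intro x y h
    exact Subtype.val_injective h
  · have : Set.range (WeakSpace.map p.subtypeL) =
        ⋂ (φ : StrongDual 𝕜 V) (_ : ∀ y ∈ p, φ y = 0),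
          {x | φ ((toWeakSpace 𝕜 V).symm x) = 0} := by
      ext x
      simp only [Set.mem_range, Set.mem_iInter, Set.mem_ofPred_eq]
      constructor
      · rintro ⟨y, rfl⟩ φ hφ
        exact hφ _ (y : p).2
      · intro h
        by_contra hx
        have hx' : (toWeakSpace 𝕜 V).symm x ∉ p := fun hm => hx ⟨⟨_, hm⟩, rfl⟩
        obtain ⟨φ, h1, h2⟩ := exists_dual_vanishing_on hp hx'
        exact h1 (h φ h2)
    rw [this]
    exact isClosed_iInter fun φ => isClosed_iInter fun _ =>
      isClosed_eq (continuous_weakSpace_dual φ) continuous_const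

theorem mem_range_of_forall_norm_sub_lt [CompleteSpace V] (J : V →ₗᵢ[𝕜] W) {y : W}
    (h : ∀ ε > 0, ∃ x, ‖y - J x‖ < ε) : y ∈ Set.range J := by
  rw [← J.isometry.isClosedEmbedding.isClosed_range.closure_eq, Metric.mem_closure_range_iff]
  intro ε hε
  obtain ⟨x, hx⟩ := h ε hε
  exact ⟨x, by rwa [dist_eq_norm]⟩

theorem mem_weakDual_closedBall_iff (β : WeakDual 𝕜 V) {r : ℝ} :
    β ∈ WeakDual.toStrongDual ⁻¹' Metric.closedBall (0 : StrongDual 𝕜 V) r ↔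
      ‖WeakDual.toStrongDual β‖ ≤ r := by
  simp

/-- Grothendieck's criterion. In the bidual, K plus a small ball is weak-* compact by
Banach–Alaoglu, hence closed, so every weak-* limit of A is at distance at most ε from V. As ε is
arbitrary and V is closed in its bidual, the limit lies in V. -/
theorem isCompact_weak_closure_of_approx [CompleteSpace V] {A : Set V}
    (hA : ∀ ε > 0, ∃ K : Set V, IsCompact (toWeakSpace 𝕜 V '' K) ∧
      ∀ x ∈ A, ∃ y ∈ K, ‖x - y‖ ≤ ε) :
    IsCompact (closure (toWeakSpace 𝕜 V '' A)) := by
  have hbdd : ∀ K : Set V, IsCompact (toWeakSpace 𝕜 V '' K) → Bornology.IsBounded K := by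
    intro K hK
    have hpt : ∀ φ : StrongDual 𝕜 V, ∃ C, ∀ x : K,
        ‖NormedSpace.inclusionInDoubleDual 𝕜 V x φ‖ ≤ C := by
      intro φ
      obtain ⟨C, hC⟩ := hK.exists_bound_of_continuousOn (continuous_weakSpace_dual φ).continuousOn
      exact ⟨C, fun x => hC _ ⟨x, x.2, rfl⟩⟩
    obtain ⟨C, hC⟩ := banach_steinhaus hpt
    refine isBounded_iff_forall_norm_le.2 ⟨C, fun x hx => ?_⟩
    rw [← (NormedSpace.inclusionInDoubleDualLi (E := V) 𝕜).norm_map x]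
    exact hC ⟨x, hx⟩
  refine NormedSpace.isCompact_closure_of_isBounded 𝕜 V _ ?_ ?_
  · rw [Set.preimage_image_eq _ (toWeakSpace 𝕜 V).injective]
    obtain ⟨K, hK, hAK⟩ := hA 1 one_pos
    obtain ⟨C, hC⟩ := isBounded_iff_forall_norm_le.1 (hbdd K hK)
    refine isBounded_iff_forall_norm_le.2 ⟨1 + C, fun x hx => ?_⟩
    obtain ⟨y, hy, hxy⟩ := hAK x hx
    calc ‖x‖ = ‖(x - y) + y‖ := by simp
      _ ≤ _ := norm_add_le _ _
      _ ≤ _ := add_le_add hxy (hC y hy)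
  · intro ξ hξ
    let J := NormedSpace.inclusionInDoubleDualLi (E := V) 𝕜
    let ξ' : StrongDual 𝕜 (StrongDual 𝕜 V) := WeakDual.toStrongDual ξ
    suffices h : ξ' ∈ Set.range J by
      obtain ⟨x, hx⟩ := h
      refine ⟨toWeakSpace 𝕜 V x, ?_⟩
      apply WeakDual.toStrongDual.injective
      exact hx
    refine mem_range_of_forall_norm_sub_lt (𝕜 := 𝕜) (V := V) (W := StrongDual 𝕜 (StrongDual 𝕜 V)) J fun ε hε => ?_
    obtain ⟨K, hK, hAK⟩ := hA (ε / 2) (by positivity)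
    let B : Set (WeakDual 𝕜 (StrongDual 𝕜 V)) :=
      WeakDual.toStrongDual ⁻¹' Metric.closedBall 0 (ε / 2)
    have hmem : ∀ β, β ∈ B ↔ ‖WeakDual.toStrongDual β‖ ≤ ε / 2 := 
      fun β => mem_weakDual_closedBall_iff β
    have hB : IsCompact B := WeakDual.isCompact_closedBall _ _
    have hcomp := ((hK.image (NormedSpace.inclusionInDoubleDualWeak 𝕜 V).continuous).prod hB).image
      continuous_add
    have hsub := closure_minimal ?_ hcomp.isClosed hξ
    · obtain ⟨⟨_, β⟩, ⟨⟨_, ⟨y, hy, rfl⟩, rfl⟩, hβ⟩, hsum⟩ := hsub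
      refine ⟨y, ?_⟩
      have hξ' : ξ' = J y + WeakDual.toStrongDual β := by
        change WeakDual.toStrongDual ξ = _
        rw [← hsum, map_add]
        rfl
      have hβ' := (hmem β).1 hβ
      have : ξ' - J y = WeakDual.toStrongDual β := by
        ext φ
        rw [hξ']
        simp
      rw [this]
      linarith
    · rintro _ ⟨_, ⟨x, hx, rfl⟩, rfl⟩
      obtain ⟨y, hy, hxy⟩ := hAK x hx
      refine ⟨⟨_, StrongDual.toWeakDual (J (x - y))⟩, ⟨⟨_, ⟨y, hy, rfl⟩, rfl⟩, ?_⟩, ?_⟩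
      · have : ‖J (x - y)‖ ≤ ε / 2 := by rw [J.norm_map]; exact hxy
        exact (hmem _).2 this
      · apply WeakDual.toStrongDual.injective
        change J y + J (x - y) = J x
        rw [← map_add, add_sub_cancel]

/-- Banach–Alaoglu transported by the Riesz isometry. This map is weak-* to weak continuous because
pairing with z becomes the conjugate of evaluation at z. -/
theorem isCompact_weak_closedBall {H : Type*} [NormedAddCommGroup H] [InnerProductSpace 𝕜 H]
    [CompleteSpace H] (r : ℝ) :
    IsCompact (toWeakSpace 𝕜 H '' Metric.closedBall (0 : H) r) := by
  let D : WeakDual 𝕜 H → WeakSpace 𝕜 H := fun f =>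
    toWeakSpace 𝕜 H ((InnerProductSpace.toDual 𝕜 H).symm (WeakDual.toStrongDual f))
  have hD : Continuous D := by
    refine continuous_to_weakSpace fun φ => ?_
    obtain ⟨z, rfl⟩ := (InnerProductSpace.toDual 𝕜 H).surjective φ
    have : ∀ f : WeakDual 𝕜 H, InnerProductSpace.toDual 𝕜 H z ((toWeakSpace 𝕜 H).symm (D f)) =
        (starRingEnd 𝕜) (f z) := by
      intro f
      change inner 𝕜 z ((InnerProductSpace.toDual 𝕜 H).symm (WeakDual.toStrongDual f)) = _
      rw [← inner_conj_symm, InnerProductSpace.toDual_symm_apply]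
      rfl
    simp_rw [this]
    exact RCLike.continuous_conj.comp (WeakDual.eval_continuous z)
  convert (WeakDual.isCompact_closedBall (0 : StrongDual 𝕜 H) r).image hD using 1
  ext x
  constructor
  · rintro ⟨y, hy, rfl⟩
    refine ⟨StrongDual.toWeakDual (InnerProductSpace.toDual 𝕜 H y), ?_, ?_⟩
    · simpa using hy
    · change toWeakSpace 𝕜 H ((InnerProductSpace.toDual 𝕜 H).symm
        (InnerProductSpace.toDual 𝕜 H y)) = _
      simp
  · rintro ⟨f, hf, rfl⟩
    refine ⟨_, ?_, rfl⟩
    simpa using hf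

end WeakTopology

/-! ### Submodules and uniform boundedness -/

section Restrict

variable {𝕜 : Type*} [RCLike 𝕜] {G : Type*} [Group G] [TopologicalSpace G]
  {V : Type*} [NormedAddCommGroup V] [NormedSpace 𝕜 V]

/-- The restriction of a module structure to an invariant subspace. -/
def GModule.restrict (M : GModule 𝕜 G V) (p : Submodule 𝕜 V) (hp : ∀ g, ∀ v ∈ p, M.ρ g v ∈ p) :
    GModule 𝕜 G p where
  ρ :=
    { toFun := fun g => ((M.ρ g).comp p.subtypeL).codRestrict p fun v => hp g v v.2
      map_one' := by ext v; simp
      map_mul' := fun g h => by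
        ext v
        change M.ρ (g * h) (v : V) = M.ρ g (M.ρ h v)
        rw [map_mul, mul_apply_eq_comp] }
  continuous_orbit v := (M.continuous_orbit (v : V)).subtype_mk _

theorem GModule.IsWAP.restrict {M : GModule 𝕜 G V} (hM : M.IsWAP) {p : Submodule 𝕜 V}
    (hp : ∀ g, ∀ v ∈ p, M.ρ g v ∈ p) (hcl : IsClosed (p : Set V)) : (M.restrict p hp).IsWAP := by
  intro v
  have he := isClosedEmbedding_weakSpace_subtype hcl
  refine (he.isCompact_preimage (hM v)).of_isClosed_subset isClosed_closure ?_
  refine closure_minimal ?_ (isClosed_closure.preimage he.continuous)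
  rintro _ ⟨g, rfl⟩
  exact subset_closure ⟨g, rfl⟩

/-- Uniform boundedness twice: weakly compact orbits are norm bounded, and then so is the family of
operators. -/
theorem GModule.IsWAP.exists_norm_le [CompleteSpace V] {M : GModule 𝕜 G V} (hM : M.IsWAP) :
    ∃ C, ∀ g, ‖M.ρ g‖ ≤ C := by
  refine banach_steinhaus fun v => ?_
  have hpt : ∀ φ : StrongDual 𝕜 V, ∃ C, ∀ g,
      ‖NormedSpace.inclusionInDoubleDual 𝕜 V (M.ρ g v) φ‖ ≤ C := by
    intro φ
    obtain ⟨C, hC⟩ := (hM v).exists_bound_of_continuousOn (continuous_weakSpace_dual φ).continuousOn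
    exact ⟨C, fun g => hC _ (subset_closure ⟨g, rfl⟩)⟩
  obtain ⟨C, hC⟩ := banach_steinhaus hpt
  refine ⟨C, fun g => ?_⟩
  rw [← (NormedSpace.inclusionInDoubleDualLi (E := V) 𝕜).norm_map]
  exact hC g

end Restrict

/-! ### Orbits in L¹ of a probability space -/

section LebesgueSpaces

variable {𝕜 : Type*} [RCLike 𝕜] {X : Type*} [MeasurableSpace X] (μ : Measure X)
  [IsProbabilityMeasure μ]

variable (𝕜) in
/-- The inclusion of `L²` in `L¹` for a probability measure. -/
def l2ToL1 : Lp 𝕜 2 μ →L[𝕜] Lp 𝕜 1 μ :=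
  LinearMap.mkContinuous
    { toFun := fun f => ⟨f.1, Lp.antitone one_le_two f.2⟩
      map_add' := fun _ _ => rfl
      map_smul' := fun _ _ => rfl } 1 (by
    intro f
    rw [one_mul]
    refine ENNReal.toReal_mono (Lp.eLpNorm_ne_top f) ?_
    exact eLpNorm_le_eLpNorm_of_exponent_le one_le_two (Lp.aestronglyMeasurable f))

theorem denseRange_l2ToL1 : DenseRange (l2ToL1 𝕜 μ) := by
  refine (Lp.simpleFunc.denseRange (E := 𝕜) (μ := μ) ENNReal.one_ne_top).mono ?_
  rintro _ ⟨f, rfl⟩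
  have hf := (Lp.simpleFunc.toSimpleFunc f).memLp_of_isFiniteMeasure 2 μ
  refine ⟨hf.toLp _, ?_⟩
  refine Lp.ext ?_
  exact hf.coeFn_toLp.trans (Lp.simpleFunc.toSimpleFunc_eq_toFun f)

/-- Approximate f in L¹ by g in L². The translates of g stay in one L² ball, whose image in L¹ is
weakly compact, and translation preserves the error. -/
theorem isCompact_weak_closure_range_comp {ι : Type*} {τ : ι → X → X}
    (hτ : ∀ i, MeasurePreserving (τ i) μ μ) (f : Lp 𝕜 1 μ) :
    IsCompact (closure (Set.range fun i =>
      toWeakSpace 𝕜 (Lp 𝕜 1 μ) (Lp.compMeasurePreserving (τ i) (hτ i) f))) := by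
  have : (Set.range fun i => toWeakSpace 𝕜 (Lp 𝕜 1 μ) (Lp.compMeasurePreserving (τ i) (hτ i) f)) =
      toWeakSpace 𝕜 (Lp 𝕜 1 μ) '' Set.range fun i => Lp.compMeasurePreserving (τ i) (hτ i) f := by
    rw [← Set.range_comp]; rfl
  rw [this]
  refine isCompact_weak_closure_of_approx fun ε hε => ?_
  obtain ⟨g, hg⟩ := (denseRange_l2ToL1 (𝕜 := 𝕜) μ).exists_dist_lt f hε
  refine ⟨l2ToL1 𝕜 μ '' Metric.closedBall 0 ‖g‖, ?_, ?_⟩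
  · convert (isCompact_weak_closedBall (𝕜 := 𝕜) (H := Lp 𝕜 2 μ) ‖g‖).image
      (WeakSpace.map (l2ToL1 𝕜 μ)).continuous using 1
    rw [Set.image_image, Set.image_image]
    rfl
  · rintro _ ⟨i, rfl⟩
    refine ⟨_, ⟨Lp.compMeasurePreserving (τ i) (hτ i) g, ?_, rfl⟩, ?_⟩
    · simp
    · have : l2ToL1 𝕜 μ (Lp.compMeasurePreserving (τ i) (hτ i) g) =
          Lp.compMeasurePreserving (τ i) (hτ i) (l2ToL1 𝕜 μ g) := rfl
      rw [this, ← map_sub, Lp.norm_compMeasurePreserving, ← dist_eq_norm]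
      exact hg.le

end LebesgueSpaces

/-! ### Two forms of sublinear growth -/

section Sublinear

variable {𝕜 : Type*} [RCLike 𝕜] {α E : Type*} [NormedAddCommGroup E] [NormedSpace 𝕜 E]

theorem tendsto_inv_smul_of_forall_norm_le (L : α → ℕ) {f : α → E}
    (h : ∀ η > 0, ∃ B : ℝ, ∀ a, ‖f a‖ ≤ η * L a + B) :
    Tendsto (fun a => ((L a : 𝕜)⁻¹) • f a) (comap L atTop) (𝓝 0) := by
  rw [Metric.tendsto_nhds]
  intro ε hε
  obtain ⟨B, hB⟩ := h (ε / 2) (by positivity)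
  obtain ⟨N, hN⟩ := exists_nat_gt (max B 0 / (ε / 2))
  filter_upwards [preimage_mem_comap (Ici_mem_atTop (N + 1))] with a ha
  have hL : (N : ℝ) + 1 ≤ L a := by exact_mod_cast ha
  have hL0 : (0 : ℝ) < L a := lt_of_lt_of_le (by positivity) hL
  rw [dist_zero_right, norm_smul, norm_inv, RCLike.norm_natCast, inv_mul_lt_iff₀ hL0]
  rw [div_lt_iff₀ (by positivity)] at hN
  have h1 : B ≤ max B 0 := le_max_left _ _
  have h2 : (N : ℝ) * (ε / 2) < L a * (ε / 2) := by
    apply mul_lt_mul_of_pos_right _ (by positivity)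
    linarith
  have := hB a
  linarith

theorem forall_norm_le_of_tendsto_inv_smul {L : α → ℕ} {f : α → E} {D : ℝ}
    (hD : ∀ a, ‖f a‖ ≤ D * L a)
    (h : Tendsto (fun a => ((L a : 𝕜)⁻¹) • f a) (comap L atTop) (𝓝 0)) :
    ∀ η > 0, ∃ B : ℝ, ∀ a, ‖f a‖ ≤ η * L a + B := by
  intro η hη
  rw [Metric.tendsto_nhds] at h
  obtain ⟨s, hs, hsub⟩ := h η hη
  obtain ⟨N, hN⟩ := mem_atTop_sets.1 hs
  refine ⟨|D| * N, fun a => ?_⟩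
  by_cases ha : N ≤ L a
  · have h1 : dist (((L a : 𝕜)⁻¹) • f a) 0 < η := hsub (hN _ ha)
    -- At L a = 0 the inverse is 0 and the limit carries no information; the linear bound forces f a
    -- = 0.
    rcases Nat.eq_zero_or_pos (L a) with h0 | hpos
    · have := hD a
      rw [h0] at this ⊢
      simp only [Nat.cast_zero, mul_zero, zero_add] at this ⊢
      exact this.trans (by positivity)
    · have hL0 : (0 : ℝ) < L a := by exact_mod_cast hpos
      rw [dist_zero_right, norm_smul, norm_inv, RCLike.norm_natCast, inv_mul_lt_iff₀ hL0] at h1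
      have : 0 ≤ |D| * N := by positivity
      linarith
  · have h1 : (L a : ℝ) ≤ N := by exact_mod_cast (not_le.1 ha).le
    calc ‖f a‖ ≤ D * L a := hD a
      _ ≤ |D| * L a := mul_le_mul_of_nonneg_right (le_abs_self D) (Nat.cast_nonneg _)
      _ ≤ |D| * N := mul_le_mul_of_nonneg_left h1 (abs_nonneg D)
      _ ≤ _ := le_add_of_nonneg_left (by positivity)

end Sublinear

/-! ### Vectors with continuous orbit -/

section ContinuousOrbits

variable {𝕜 : Type*} [RCLike 𝕜] {G : Type*} [TopologicalSpace G]
  {V : Type*} [NormedAddCommGroup V] [NormedSpace 𝕜 V]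

/-- The vectors with continuous orbit map for a family of operators. -/
def continuousVectors (T : G → V →L[𝕜] V) : Submodule 𝕜 V where
  carrier := {v | Continuous fun g => T g v}
  add_mem' {v w} hv hw := by
    simp only [Set.mem_ofPred_eq, map_add] at hv hw ⊢
    exact hv.add hw
  zero_mem' := by simpa using continuous_const
  smul_mem' r v hv := by
    simp only [Set.mem_ofPred_eq, map_smul] at hv ⊢
    exact hv.const_smul r

theorem isClosed_continuousVectors {T : G → V →L[𝕜] V} {C : ℝ} (hC : ∀ g v, ‖T g v‖ ≤ C * ‖v‖) :
    IsClosed (continuousVectors T : Set V) := by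
  refine isClosed_of_closure_subset fun v hv => ?_
  refine continuous_of_uniform_approx_of_continuous fun u hu => ?_
  obtain ⟨ε, hε, hsub⟩ := Metric.mem_uniformity_dist.1 hu
  obtain ⟨w, hw, hvw⟩ := Metric.mem_closure_iff.1 hv (ε / (|C| + 1)) (by positivity)
  refine ⟨fun g => T g w, hw, fun g => hsub ?_⟩
  rw [dist_eq_norm, ← map_sub]
  rw [dist_eq_norm, lt_div_iff₀ (by positivity)] at hvw
  have h1 := hC g (v - w)
  have h2 : C * ‖v - w‖ ≤ |C| * ‖v - w‖ :=
    mul_le_mul_of_nonneg_right (le_abs_self C) (norm_nonneg _)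
  have := norm_nonneg (v - w)
  nlinarith

end ContinuousOrbits

/-! ### The Koopman representation -/

section Koopman

variable {𝕜 : Type*} [RCLike 𝕜] {G : Type*} [Group G] [TopologicalSpace G]
  [IsTopologicalGroup G] [LocallyCompactSpace G] {X : Type*} [MeasurableSpace X] {μ : Measure X}

theorem MPAction.coeFn_koopman (A : MPAction G μ) (g : G) (f : Lp 𝕜 1 μ) :
    A.koopman 𝕜 g f =ᵐ[μ] f ∘ A.act g⁻¹ :=
  Lp.coeFn_compMeasurePreserving f (A.measurePreserving g⁻¹)

theorem MPAction.norm_koopman (A : MPAction G μ) (g : G) (f : Lp 𝕜 1 μ) :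
    ‖A.koopman 𝕜 g f‖ = ‖f‖ :=
  Lp.norm_compMeasurePreserving f (A.measurePreserving g⁻¹)

theorem MPAction.koopman_mul (A : MPAction G μ) (g h : G) (f : Lp 𝕜 1 μ) :
    A.koopman 𝕜 (g * h) f = A.koopman 𝕜 g (A.koopman 𝕜 h f) := by
  refine Lp.ext ?_
  filter_upwards [A.coeFn_koopman (g * h) f, A.coeFn_koopman g (A.koopman 𝕜 h f),
    (A.measurePreserving g⁻¹).quasiMeasurePreserving.ae (A.coeFn_koopman h f),
    A.act_mul h⁻¹ g⁻¹] with x h1 h2 h3 h4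
  rw [h1, h2, Function.comp_apply, Function.comp_apply, h3, Function.comp_apply, mul_inv_rev, h4]

/-- The action law does not postulate that 1 acts trivially. But π(1) is an idempotent isometry: it
sends π(1)f − f to 0, so this vector is 0. -/
theorem MPAction.koopman_one (A : MPAction G μ) (f : Lp 𝕜 1 μ) : A.koopman 𝕜 1 f = f := by
  have h : A.koopman 𝕜 1 (A.koopman 𝕜 1 f - f) = 0 := by
    rw [map_sub, ← A.koopman_mul, one_mul, sub_self]
  have h2 := A.norm_koopman (𝕜 := 𝕜) 1 (A.koopman 𝕜 1 f - f)
  rw [h, norm_zero] at h2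
  exact sub_eq_zero.1 (norm_eq_zero.1 h2.symm)

theorem MPAction.integral_koopman (A : MPAction G μ) (g : G) (f : Lp 𝕜 1 μ) :
    ∫ x, A.koopman 𝕜 g f x ∂μ = ∫ x, f x ∂μ := by
  rw [integral_congr_ae (A.coeFn_koopman g f)]
  have hm := A.measurePreserving g⁻¹
  have := integral_map (μ := μ) hm.measurable.aemeasurable
    (f := fun x => f x) (by rw [hm.map_eq]; exact Lp.aestronglyMeasurable f)
  rw [hm.map_eq] at this
  exact this.symm

theorem MPAction.koopman_const [IsFiniteMeasure μ] (A : MPAction G μ) (g : G) (a : 𝕜) :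
    A.koopman 𝕜 g (Lp.const 1 μ a) = Lp.const 1 μ a := by
  refine Lp.ext ?_
  filter_upwards [A.coeFn_koopman g (Lp.const 1 μ a), Lp.coeFn_const 1 μ a,
    (A.measurePreserving g⁻¹).quasiMeasurePreserving.ae (Lp.coeFn_const 1 μ a)] with x h1 h2 h3
  rw [h1, h2, Function.comp_apply, h3]
  rfl

/-- Preimages of measurable sets under an invariant function are invariant up to null sets, hence
null or conull. -/
theorem MPAction.IsErgodic.ae_eq_const_of_koopman_fixed {A : MPAction G μ} (hA : A.IsErgodic)
    {f : Lp 𝕜 1 μ} (hf : ∀ g, A.koopman 𝕜 g f = f) : ∃ a, f =ᵐ[μ] Function.const X a := by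
  refine exists_eventuallyEq_const_of_forall_separating MeasurableSet fun U hU => ?_
  have hm : Measurable f := (Lp.stronglyMeasurable f).measurable
  have hinv : ∀ g, A.act g ⁻¹' (f ⁻¹' U) =ᵐ[μ] f ⁻¹' U := by
    intro g
    have h1 := A.coeFn_koopman g⁻¹ f
    rw [hf, inv_inv] at h1
    filter_upwards [h1] with x hx
    exact congrArg (· ∈ U) hx.symm
  rcases hA (f ⁻¹' U) (hm hU) hinv with h | h
  · exact Or.inr (measure_eq_zero_iff_ae_notMem.1 h)
  · exact Or.inl h

end Koopman

/-! ### Property WAP_t implies the mean ergodic theorem -/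

section MeanErgodic

variable {𝕜 : Type} [RCLike 𝕜] {G : Type u} [Group G] [TopologicalSpace G]
  [IsTopologicalGroup G] [LocallyCompactSpace G]

section Module

variable {X : Type*} [MeasurableSpace X] {μ : Measure X}
  (A : MPAction G μ)

variable (𝕜) in
/-- The integrable functions of mean zero with continuous orbit map. -/
def koopmanSubspace : Submodule 𝕜 (Lp 𝕜 1 μ) :=
  continuousVectors (A.koopman 𝕜) ⊓ (L1.integralCLM' 𝕜 : (Lp 𝕜 1 μ) →L[𝕜] 𝕜).ker

theorem integralCLM_eq (f : Lp 𝕜 1 μ) : L1.integralCLM' 𝕜 f = ∫ x, f x ∂μ := by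
  rw [← L1.integral_eq_integral, L1.integral_eq' 𝕜]

theorem mem_koopmanSubspace {f : Lp 𝕜 1 μ} : f ∈ koopmanSubspace 𝕜 A ↔
    (Continuous fun g => A.koopman 𝕜 g f) ∧ ∫ x, f x ∂μ = 0 := by
  rw [← integralCLM_eq]
  rfl

theorem isClosed_koopmanSubspace : IsClosed (koopmanSubspace 𝕜 A : Set (Lp 𝕜 1 μ)) :=
  (isClosed_continuousVectors (C := 1) fun g v => by rw [A.norm_koopman, one_mul]).inter
    (L1.integralCLM' 𝕜 : (Lp 𝕜 1 μ) →L[𝕜] 𝕜).isClosed_ker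

theorem koopman_mem_koopmanSubspace (g : G) {f : Lp 𝕜 1 μ} (hf : f ∈ koopmanSubspace 𝕜 A) :
    A.koopman 𝕜 g f ∈ koopmanSubspace 𝕜 A := by
  rw [mem_koopmanSubspace] at hf ⊢
  refine ⟨?_, by rw [A.integral_koopman, hf.2]⟩
  simp_rw [← A.koopman_mul]
  exact hf.1.comp (continuous_mul_const g)

variable (𝕜) in
/-- The action on mean zero integrable functions with continuous orbit maps. -/
def koopmanModule : GModule 𝕜 G (koopmanSubspace 𝕜 A) where
  ρ :=
    { toFun := fun g => ((A.koopman 𝕜 g).comp (koopmanSubspace 𝕜 A).subtypeL).codRestrict _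
        fun f => koopman_mem_koopmanSubspace A g f.2
      map_one' := ContinuousLinearMap.ext fun f => Subtype.ext (A.koopman_one (f : Lp 𝕜 1 μ))
      map_mul' := fun g h =>
        ContinuousLinearMap.ext fun f => Subtype.ext (A.koopman_mul g h (f : Lp 𝕜 1 μ)) }
  continuous_orbit f := (((mem_koopmanSubspace A).1 f.2).1).subtype_mk _

theorem isWAP_koopmanModule [IsProbabilityMeasure μ] : (koopmanModule 𝕜 A).IsWAP := by
  intro f
  have he := isClosedEmbedding_weakSpace_subtype (isClosed_koopmanSubspace (𝕜 := 𝕜) A)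
  have hc := isCompact_weak_closure_range_comp μ
    (fun g : G => A.measurePreserving g⁻¹) (f : Lp 𝕜 1 μ)
  refine (he.isCompact_preimage hc).of_isClosed_subset isClosed_closure ?_
  refine closure_minimal ?_ (isClosed_closure.preimage he.continuous)
  rintro _ ⟨g, rfl⟩
  exact subset_closure ⟨g, rfl⟩

theorem fixedVectors_koopmanModule [IsProbabilityMeasure μ] (hA : A.IsErgodic) :
    (koopmanModule 𝕜 A).fixedVectors = {0} := by
  refine Set.eq_singleton_iff_unique_mem.2 ⟨fun g => map_zero _, fun f hf => ?_⟩
  obtain ⟨a, ha⟩ := hA.ae_eq_const_of_koopman_fixed (f := (f : Lp 𝕜 1 μ))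
    fun g => congrArg Subtype.val (hf g)
  have h0 := ((mem_koopmanSubspace A).1 f.2).2
  rw [integral_congr_ae ha] at h0
  have ha0 : a = 0 := by simpa using h0
  refine Subtype.ext (Lp.ext ?_)
  filter_upwards [ha, Lp.coeFn_zero 𝕜 1 μ] with x h1 h2
  rw [h1, ha0]
  exact h2.symm

end Module

theorem meanErgodicL1_of_propertyWAPt {S : Set G} (hS : IsCompact S)
    (hgen : Subgroup.closure S = ⊤) (h : PropertyWAPt.{u, v} 𝕜 G) :
    MeanErgodicL1.{u, v} 𝕜 G S := by
  intro X _ μ _ A hA c hc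
  have : CompleteSpace (koopmanSubspace 𝕜 A) :=
    (isClosed_koopmanSubspace (𝕜 := 𝕜) A).completeSpace_coe
  let I : Lp 𝕜 1 μ →L[𝕜] 𝕜 := L1.integralCLM' 𝕜
  have hcg : ∀ g h, c (g * h) = A.koopman 𝕜 g (c h) + c g := hc
  have hI : ∀ g f, I (A.koopman 𝕜 g f) = I f := fun g f => by
    rw [integralCLM_eq, integralCLM_eq, A.integral_koopman]
  have hIc : ∀ a : 𝕜, I (Lp.constL 1 μ 𝕜 a) = a := fun a => by
    have h1 : ∫ x, (Lp.constL 1 μ 𝕜 a : Lp 𝕜 1 μ) x ∂μ = ∫ _, a ∂μ :=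
      integral_congr_ae (Lp.coeFn_const 1 μ a)
    rw [integralCLM_eq, h1]
    simp
  have hKc : ∀ g (a : 𝕜), A.koopman 𝕜 g (Lp.constL 1 μ 𝕜 a) = Lp.constL 1 μ 𝕜 a :=
    fun g a => A.koopman_const g a
  have hmem : ∀ g, c g - Lp.constL 1 μ 𝕜 (I (c g)) ∈ koopmanSubspace 𝕜 A := by
    intro g
    rw [mem_koopmanSubspace]
    constructor
    · simp_rw [map_sub, hKc]
      refine Continuous.sub ?_ continuous_const
      -- The cocycle identity makes the orbits of the values of c continuous; no continuity of the
      -- action is available.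
      have : (fun k => A.koopman 𝕜 k (c g)) = fun k => c (k * g) - c k := by
        ext1 k
        rw [hcg, add_sub_cancel_right]
      rw [this]
      exact (c.continuous.comp (continuous_mul_const g)).sub c.continuous
    · rw [← integralCLM_eq]
      change I _ = 0
      rw [map_sub, hIc, sub_self]
  let b : C(G, koopmanSubspace 𝕜 A) :=
    ⟨fun g => ⟨_, hmem g⟩, Continuous.subtype_mk
      (c.continuous.sub ((Lp.constL 1 μ 𝕜).continuous.comp (I.continuous.comp c.continuous))) _⟩
  have hb : ∀ g h, b (g * h) = (koopmanModule 𝕜 A).ρ g (b h) + b g := by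
    intro g h
    refine Subtype.ext ?_
    change c (g * h) - Lp.constL 1 μ 𝕜 (I (c (g * h))) =
      A.koopman 𝕜 g (c h - Lp.constL 1 μ 𝕜 (I (c h))) + (c g - Lp.constL 1 μ 𝕜 (I (c g)))
    rw [hcg, map_add, hI, map_sub, hKc, map_add]
    abel
  have hH := (subsingleton_reducedH1_iff _).1
    (h _ (koopmanModule 𝕜 A) (isWAP_koopmanModule A) (fixedVectors_koopmanModule A hA)) b hb
  have hnorm : ∀ g, ‖(koopmanModule 𝕜 A).ρ g‖ ≤ 1 := fun g =>
    ContinuousLinearMap.opNorm_le_bound _ zero_le_one fun f => by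
      rw [one_mul]
      exact (A.norm_koopman g (f : Lp 𝕜 1 μ)).le
  have hfin := exists_norm_cocycle_le_of_almost_coboundary hS hgen _ hnorm hb hH
  refine tendsto_inv_smul_of_forall_norm_le (wordLength S) fun η hη => ?_
  obtain ⟨B, hB⟩ := hfin η hη
  refine ⟨B, fun g => ?_⟩
  rw [← integralCLM_eq]
  exact hB g

end MeanErgodic

/-! ### Minimal sets and total boundedness -/

section Minimal

variable {X Γ : Type*} [TopologicalSpace X] [CompactSpace X]

/-- Zorn's lemma gives a minimal invariant closed set; it is the closure of each of its orbits, so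
every orbit meets every open set that meets it. -/
theorem exists_minimal_closed_invariant [Nonempty X] {τ : Γ → X → X} (hτ : ∀ γ, Continuous (τ γ))
    (hmul : ∀ γ γ', ∃ γ'', ∀ x, τ γ (τ γ' x) = τ γ'' x) (hΓ : Nonempty Γ) :
    ∃ Y : Set X, IsClosed Y ∧ Y.Nonempty ∧ (∀ γ, ∀ y ∈ Y, τ γ y ∈ Y) ∧
      ∀ U : Set X, IsOpen U → (Y ∩ U).Nonempty → ∀ y ∈ Y, ∃ γ, τ γ y ∈ U := by
  let 𝒮 : Set (Set X) := {Y | IsClosed Y ∧ Y.Nonempty ∧ ∀ γ, ∀ y ∈ Y, τ γ y ∈ Y}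
  obtain ⟨Y, hY⟩ : ∃ Y, Minimal (· ∈ 𝒮) Y := by
    refine zorn_superset _ fun c hc hchain => ?_
    refine ⟨⋂₀ c, ⟨isClosed_sInter fun t ht => (hc ht).1, ?_, fun γ y hy t ht =>
      (hc ht).2.2 γ y (hy t ht)⟩, fun s hs => Set.sInter_subset_of_mem hs⟩
    rcases c.eq_empty_or_nonempty with rfl | hne
    · simp
    · have : Nonempty c := hne.to_subtype
      rw [Set.sInter_eq_iInter]
      refine IsCompact.nonempty_iInter_of_directed_nonempty_isCompact_isClosed
        (fun t : c => (t : Set X)) ?_ (fun t => (hc t.2).2.1) (fun t => (hc t.2).1.isCompact)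
        fun t => (hc t.2).1
      exact DirectedOn.directed_val (IsChain.directedOn hchain.symm)
  refine ⟨Y, hY.prop.1, hY.prop.2.1, hY.prop.2.2, fun U hU hYU y hy => ?_⟩
  by_contra! hno
  have horb : closure (Set.range fun γ => τ γ y) ∈ 𝒮 := by
    refine ⟨isClosed_closure, ?_, fun γ z hz => ?_⟩
    · obtain ⟨γ⟩ := hΓ
      exact ⟨_, subset_closure ⟨γ, rfl⟩⟩
    · refine map_mem_closure (hτ γ) hz ?_
      rintro _ ⟨γ', rfl⟩
      obtain ⟨γ'', h⟩ := hmul γ γ'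
      exact ⟨γ'', (h y).symm⟩
  have hsub : closure (Set.range fun γ => τ γ y) ⊆ Y :=
    closure_minimal (by rintro _ ⟨γ, rfl⟩; exact hY.prop.2.2 γ y hy) hY.prop.1
  have heq := hY.eq_of_subset horb hsub
  obtain ⟨z, hzY, hzU⟩ := hYU
  rw [← heq] at hzY
  obtain ⟨_, hw, ⟨γ, rfl⟩⟩ := mem_closure_iff.1 hzY U hU hzU
  exact hno γ hw

/-- Baire: countably many closed sets of small j-diameter cover Y, so one contains a nonempty
relatively open piece U. By minimality and compactness finitely many pullbacks of U cover Y, and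
each pullback expands j-diameters at most by C. -/
theorem totallyBounded_image_of_minimal [T2Space X] {τ : Γ → X → X} (hτ : ∀ γ, Continuous (τ γ))
    {Y : Set X} (hYc : IsClosed Y) (hYne : Y.Nonempty)
    (hmin : ∀ U : Set X, IsOpen U → (Y ∩ U).Nonempty → ∀ y ∈ Y, ∃ γ, τ γ y ∈ U)
    (hinv : ∀ γ, ∀ y ∈ Y, τ γ y ∈ Y)
    {Z : Type*} [PseudoMetricSpace Z] [SecondCountableTopology Z] (j : X → Z)
    (hcl : ∀ z r, IsClosed {x | dist (j x) z ≤ r}) {C : ℝ}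
    (hC : ∀ γ x y, dist (j x) (j y) ≤ C * dist (j (τ γ x)) (j (τ γ y))) :
    TotallyBounded (j '' Y) := by
  rw [Metric.totallyBounded_iff]
  intro ε hε
  have : Nonempty Y := hYne.to_subtype
  have : Nonempty Z := ⟨j hYne.some⟩
  have : CompactSpace Y := isCompact_iff_compactSpace.1 hYc.isCompact
  let δ := ε / (4 * (|C| + 1))
  have hδ : 0 < δ := by positivity
  obtain ⟨i, hi⟩ := nonempty_interior_of_iUnion_of_closed
    (f := fun i => {y : Y | dist (j y) (TopologicalSpace.denseSeq Z i) ≤ δ})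
    (fun i => (hcl _ _).preimage continuous_subtype_val) (by
      refine Set.eq_univ_of_forall fun y => ?_
      obtain ⟨i, hi⟩ := (TopologicalSpace.denseRange_denseSeq Z).exists_dist_lt (j y) hδ
      exact Set.mem_iUnion.2 ⟨i, hi.le⟩)
  obtain ⟨U, hU, hUi⟩ := isOpen_induced_iff.1 (isOpen_interior (s :=
    {y : Y | dist (j y) (TopologicalSpace.denseSeq Z i) ≤ δ}))
  have hYU : (Y ∩ U).Nonempty := by
    obtain ⟨y, hy⟩ := hi
    rw [← hUi] at hy
    exact ⟨y, y.2, hy⟩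
  have hUd : ∀ y ∈ Y, y ∈ U → dist (j y) (TopologicalSpace.denseSeq Z i) ≤ δ := by
    intro y hy hyU
    have : (⟨y, hy⟩ : Y) ∈ interior
        {y : Y | dist (j y) (TopologicalSpace.denseSeq Z i) ≤ δ} := by
      rw [← hUi]; exact hyU
    have h := interior_subset this
    exact h
  obtain ⟨t, ht⟩ := hYc.isCompact.elim_finite_subcover (fun γ => τ γ ⁻¹' U)
    (fun γ => hU.preimage (hτ γ)) fun y hy => Set.mem_iUnion.2 (hmin U hU hYU y hy)
  have hz : ∀ γ, ∃ z, ∀ y ∈ Y, τ γ y ∈ U → dist (j y) z < ε := by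
    intro γ
    by_cases h : ∃ y0 ∈ Y, τ γ y0 ∈ U
    · obtain ⟨y0, h1, h2⟩ := h
      refine ⟨j y0, fun y hy hyU => ?_⟩
      have h3 : dist (j (τ γ y)) (j (τ γ y0)) ≤ 2 * δ := by
        have := dist_triangle_right (j (τ γ y)) (j (τ γ y0)) (TopologicalSpace.denseSeq Z i)
        have := hUd _ (hinv γ y hy) hyU
        have := hUd _ (hinv γ y0 h1) h2
        linarith
      calc _ ≤ C * dist (j (τ γ y)) (j (τ γ y0)) := hC γ y y0
        _ ≤ |C| * (2 * δ) := mul_le_mul (le_abs_self C) h3 dist_nonneg (abs_nonneg C)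
        _ ≤ (|C| + 1) * (2 * δ) := by nlinarith
        _ = ε / 2 := by simp only [δ]; field_simp; ring
        _ < ε := by linarith
    · exact ⟨Classical.arbitrary Z, fun y hy hyU => (h ⟨y, hy, hyU⟩).elim⟩
  choose z hz using hz
  refine ⟨z '' t, t.finite_toSet.image z, ?_⟩
  rintro _ ⟨y, hy, rfl⟩
  obtain ⟨γ, hγ, hyU⟩ := Set.mem_iUnion₂.1 (ht hy)
  exact Set.mem_iUnion₂.2 ⟨z γ, ⟨γ, hγ, rfl⟩, hz γ y hy hyU⟩

end Minimal

/-! ### A separating sequence of functionals -/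

section NormingSequence

variable {𝕜 : Type*} [RCLike 𝕜] {V : Type*} [NormedAddCommGroup V] [NormedSpace 𝕜 V]

-- Norming functionals of a dense sequence suffice: if all vanish at v, a dense point x near v
-- satisfies ‖x‖ ≤ ‖x − v‖ < ‖v‖/2, which is absurd unless v = 0.
variable (𝕜 V) in
theorem exists_separating_dual_seq [TopologicalSpace.SeparableSpace V] :
    ∃ φ : ℕ → StrongDual 𝕜 V, ∀ v, (∀ n, φ n v = 0) → v = 0 := by
  have h : ∀ n, ∃ φ : StrongDual 𝕜 V, ‖φ‖ ≤ 1 ∧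
      φ (TopologicalSpace.denseSeq V n) = ‖TopologicalSpace.denseSeq V n‖ := fun n =>
    exists_dual_vector'' 𝕜 _
  choose φ hφ1 hφ2 using h
  refine ⟨φ, fun v hv => ?_⟩
  by_contra hne
  have hpos : 0 < ‖v‖ := norm_pos_iff.2 hne
  obtain ⟨n, hn⟩ := (TopologicalSpace.denseRange_denseSeq V).exists_dist_lt v
    (half_pos hpos)
  set x := TopologicalSpace.denseSeq V n
  have h1 : ‖x‖ ≤ ‖x - v‖ := by
    have : ‖φ n (x - v)‖ ≤ 1 * ‖x - v‖ := (φ n).le_of_opNorm_le (hφ1 n) _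
    rw [map_sub, hv n, sub_zero, hφ2 n, one_mul] at this
    simpa using this
  rw [dist_comm, dist_eq_norm] at hn
  have h2 : ‖v‖ ≤ ‖x‖ + ‖x - v‖ := by
    have := norm_sub_le x (x - v)
    simpa using this
  linarith

end NormingSequence

/-! ### The weak operator closure of the group -/

section Enveloping

variable {𝕜 : Type*} [RCLike 𝕜] {G : Type*} [Group G] [TopologicalSpace G]
  {V : Type*} [NormedAddCommGroup V] [NormedSpace 𝕜 V]

/-- An operator as a map to the weak topology. -/
def weakFun (T : V →L[𝕜] V) : V → WeakSpace 𝕜 V := fun v => toWeakSpace 𝕜 V (T v)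

theorem weakFun_injective : Function.Injective (weakFun : (V →L[𝕜] V) → V → WeakSpace 𝕜 V) :=
  fun _ _ h => ContinuousLinearMap.ext fun v => (toWeakSpace 𝕜 V).injective (congrFun h v)

/-- The operators in the closure of the group for the weak operator topology. -/
def GModule.envelope (M : GModule 𝕜 G V) : Submonoid (V →L[𝕜] V) where
  carrier := {T | weakFun T ∈ closure (Set.range fun g => weakFun (M.ρ g))}
  one_mem' := subset_closure ⟨1, by simp⟩
  mul_mem' := by
    intro S T hS hT
    -- Multiplication is only separately continuous, so closure is passed in one factor at a time.
    have h1 : ∀ g, weakFun (M.ρ g * T) ∈ closure (Set.range fun g => weakFun (M.ρ g)) := by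
      intro g
      have hc : Continuous fun (f : V → WeakSpace 𝕜 V) (v : V) =>
          WeakSpace.map (M.ρ g) (f v) :=
        continuous_pi fun v => (WeakSpace.map (M.ρ g)).continuous.comp (continuous_apply v)
      have hmaps : Set.MapsTo (fun (f : V → WeakSpace 𝕜 V) (v : V) => WeakSpace.map (M.ρ g) (f v))
          (Set.range fun g => weakFun (M.ρ g)) (Set.range fun g => weakFun (M.ρ g)) := by
        rintro _ ⟨h, rfl⟩
        refine ⟨g * h, ?_⟩
        simp only [map_mul]
        rfl
      have h := map_mem_closure hc hT hmaps
      exact h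
    have hc : Continuous fun (f : V → WeakSpace 𝕜 V) (v : V) => f (T v) :=
      continuous_pi fun v => continuous_apply (T v)
    have := map_mem_closure hc hS
      (t := closure (Set.range fun g => weakFun (M.ρ g))) (by rintro _ ⟨g, rfl⟩; exact h1 g)
    rwa [closure_closure] at this

/-- The closure of the group for the weak operator topology, as a topological space. -/
def GModule.Envelope (M : GModule 𝕜 G V) : Type _ := M.envelope

namespace GModule.Envelope

variable {M : GModule 𝕜 G V}

instance : Monoid M.Envelope := inferInstanceAs (Monoid M.envelope)

/-- The underlying operator. -/
def op (s : M.Envelope) : V →L[𝕜] V := s.1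

instance : TopologicalSpace M.Envelope := TopologicalSpace.induced (fun s => weakFun s.op) inferInstance

theorem op_injective : Function.Injective (op : M.Envelope → V →L[𝕜] V) := Subtype.val_injective

@[simp]
theorem op_mul (s t : M.Envelope) (v : V) : (s * t).op v = s.op (t.op v) := rfl

variable (M) in
/-- The group elements in the envelope. -/
def of (g : G) : M.Envelope := ⟨M.ρ g, subset_closure ⟨g, rfl⟩⟩

theorem of_mul (g h : G) : of M (g * h) = of M g * of M h := op_injective (map_mul M.ρ g h)

theorem of_one : of M 1 = 1 := op_injective (map_one M.ρ)

theorem isEmbedding : IsEmbedding fun s : M.Envelope => weakFun s.op :=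
  ⟨⟨rfl⟩, weakFun_injective.comp op_injective⟩

theorem continuous_dual_op (φ : StrongDual 𝕜 V) (v : V) :
    Continuous fun s : M.Envelope => φ (s.op v) :=
  (continuous_weakSpace_dual φ).comp ((continuous_apply v).comp isEmbedding.continuous)

theorem continuous_iff {X : Type*} [TopologicalSpace X] {f : X → M.Envelope}
    (h : ∀ (φ : StrongDual 𝕜 V) v, Continuous fun x => φ ((f x).op v)) : Continuous f :=
  isEmbedding.continuous_iff.2 (continuous_pi fun v => continuous_to_weakSpace fun φ => h φ v)

instance : T2Space M.Envelope := isEmbedding.t2Space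

theorem continuous_mul_right (t : M.Envelope) : Continuous fun s => s * t :=
  continuous_iff fun φ v => continuous_dual_op φ (t.op v)

theorem continuous_mul_left (t : M.Envelope) : Continuous fun s => t * s :=
  continuous_iff fun φ v => continuous_dual_op (φ.comp t.op) v

theorem denseRange_of : DenseRange (of M) := by
  intro s
  rw [isEmbedding.closure_eq_preimage_closure_image]
  have h : (fun s : M.Envelope => weakFun s.op) '' Set.range (of M) =
      Set.range fun g => weakFun (M.ρ g) := by
    rw [← Set.range_comp]
    rfl
  rw [Set.mem_preimage, h]
  exact s.2

theorem isClosed_norm_le (v w : V) (r : ℝ) : IsClosed {s : M.Envelope | ‖s.op v - w‖ ≤ r} := by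
  rcases lt_or_ge r 0 with hr | hr
  · convert isClosed_empty
    ext s
    simpa using hr.trans_le (norm_nonneg _)
  have : {s : M.Envelope | ‖s.op v - w‖ ≤ r} =
      ⋂ φ : StrongDual 𝕜 V, {s | ‖φ (s.op v) - φ w‖ ≤ r * ‖φ‖} := by
    ext s
    simp only [Set.mem_iInter, Set.mem_ofPred_eq, ← map_sub]
    exact ⟨fun h φ => by rw [mul_comm]; exact φ.le_opNorm_of_le h,
      fun h => NormedSpace.norm_le_dual_bound 𝕜 _ hr h⟩
  rw [this]
  exact isClosed_iInter fun φ =>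
    isClosed_le ((continuous_dual_op φ v).sub continuous_const).norm continuous_const

theorem norm_op_le {C : ℝ} (hC : ∀ g, ‖M.ρ g‖ ≤ C) (s : M.Envelope) (v : V) :
    ‖s.op v‖ ≤ C * ‖v‖ := by
  have := denseRange_of.induction_on (p := fun s : M.Envelope => ‖s.op v - 0‖ ≤ C * ‖v‖) s
    (isClosed_norm_le v 0 _) fun g => by
      rw [sub_zero]; exact (M.ρ g).le_of_opNorm_le (hC g) v
  simpa using this

/-- Tychonoff on the product of the weakly compact orbit closures. Linearity and the norm bound
survive pointwise weak limits, so each limit is a bounded operator. -/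
theorem compactSpace [CompleteSpace V] (hM : M.IsWAP) : CompactSpace M.Envelope := by
  obtain ⟨C, hC⟩ := hM.exists_norm_le
  rw [← isCompact_univ_iff, isEmbedding.isCompact_iff, Set.image_univ]
  have hcomp : IsCompact (closure (Set.range fun g => weakFun (M.ρ g))) := by
    refine (isCompact_univ_pi hM).of_isClosed_subset isClosed_closure ?_
    refine closure_minimal ?_ (isClosed_set_pi fun _ _ => isClosed_closure)
    rintro _ ⟨g, rfl⟩ v -
    exact subset_closure ⟨g, rfl⟩
  convert hcomp
  refine Set.Subset.antisymm (by rintro _ ⟨s, rfl⟩; exact s.2) fun f hf => ?_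
  have hadd : ∀ v w, f (v + w) = f v + f w := by
    intro v w
    have hcl : IsClosed {f : V → WeakSpace 𝕜 V | f (v + w) = f v + f w} :=
      isClosed_eq (continuous_apply _) ((continuous_apply v).add (continuous_apply w))
    refine closure_minimal ?_ hcl hf
    rintro _ ⟨g, rfl⟩
    simp [weakFun]
  have hsmul : ∀ (r : 𝕜) v, f (r • v) = r • f v := by
    intro r v
    have hcl : IsClosed {f : V → WeakSpace 𝕜 V | f (r • v) = r • f v} :=
      isClosed_eq (continuous_apply _) ((continuous_apply v).const_smul r)
    refine closure_minimal ?_ hcl hf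
    rintro _ ⟨g, rfl⟩
    simp [weakFun]
  have hnorm : ∀ v, ‖(toWeakSpace 𝕜 V).symm (f v)‖ ≤ C * ‖v‖ := by
    intro v
    have hC0 : 0 ≤ C := (norm_nonneg _).trans (hC 1)
    refine NormedSpace.norm_le_dual_bound 𝕜 _ (by positivity) fun φ => ?_
    have hcl : IsClosed {f : V → WeakSpace 𝕜 V |
        ‖φ ((toWeakSpace 𝕜 V).symm (f v))‖ ≤ C * ‖v‖ * ‖φ‖} :=
      isClosed_le ((continuous_weakSpace_dual φ).comp (continuous_apply v)).norm continuous_const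
    refine closure_minimal ?_ hcl hf
    rintro _ ⟨g, rfl⟩
    rw [mul_comm]
    exact φ.le_opNorm_of_le ((M.ρ g).le_of_opNorm_le (hC g) v)
  let T : V →L[𝕜] V := LinearMap.mkContinuous
    { toFun := fun v => (toWeakSpace 𝕜 V).symm (f v)
      map_add' := fun v w => by rw [hadd, map_add]
      map_smul' := fun r v => by rw [hsmul, map_smul]; rfl } C hnorm
  exact ⟨⟨T, hf⟩, rfl⟩

/-- Countably many coefficients separate the operators, so this compact space embeds in a countable
power of the scalars. -/
theorem secondCountableTopology [CompleteSpace V] [TopologicalSpace.SeparableSpace V]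
    (hM : M.IsWAP) : SecondCountableTopology M.Envelope := by
  have := compactSpace hM
  obtain ⟨φ, hφ⟩ := exists_separating_dual_seq 𝕜 V
  let F : M.Envelope → ℕ × ℕ → 𝕜 := fun s n => φ n.1 (s.op (TopologicalSpace.denseSeq V n.2))
  have hF : Continuous F := continuous_pi fun n => continuous_dual_op _ _
  have hinj : Function.Injective F := by
    intro s t h
    refine op_injective (ContinuousLinearMap.coeFn_injective ?_)
    refine (TopologicalSpace.denseRange_denseSeq V).equalizer s.op.continuous t.op.continuous ?_
    ext1 n
    refine sub_eq_zero.1 (hφ _ fun m => ?_)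
    rw [map_sub, sub_eq_zero]
    exact congrFun h (m, n)
  exact (hF.isClosedEmbedding hinj).isEmbedding.secondCountableTopology

end GModule.Envelope

end Enveloping

/-! ### The equivariant projection onto almost periodic vectors -/

section Splitting

variable {𝕜 : Type*} [RCLike 𝕜] {G : Type*} [Group G] [TopologicalSpace G]
  {V : Type*} [NormedAddCommGroup V] [NormedSpace 𝕜 V] {M : GModule 𝕜 G V}

namespace GModule

theorem isCompact_of_subset_isCompact {X : Type*} [TopologicalSpace X] [T2Space X] {s K : Set X}
    (hK : IsCompact K) (h : s ⊆ K) : IsCompact (closure s) :=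
  hK.of_isClosed_subset isClosed_closure (closure_minimal h hK.isClosed)

theorem sub_mem_apVectors {v w : V} (hv : v ∈ M.apVectors) (hw : w ∈ M.apVectors) :
    v - w ∈ M.apVectors := by
  refine isCompact_of_subset_isCompact ((IsCompact.prod hv hw).image continuous_sub) ?_
  rintro _ ⟨g, rfl⟩
  exact ⟨(M.ρ g v, M.ρ g w), ⟨subset_closure ⟨g, rfl⟩, subset_closure ⟨g, rfl⟩⟩,
    (map_sub (M.ρ g) v w).symm⟩

/-- A norm-compact orbit closure is weakly compact, hence weakly closed, so weak limits of the orbit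
stay in it. -/
theorem Envelope.op_mem_closure_orbit {v : V} (hv : v ∈ M.apVectors) (s : M.Envelope) :
    s.op v ∈ closure (Set.range fun g => M.ρ g v) := by
  have hK : IsCompact (closure (Set.range fun g => M.ρ g v)) := hv
  have hcl : IsClosed {s : M.Envelope | s.op v ∈ closure (Set.range fun g => M.ρ g v)} := by
    have h1 : IsClosed (toWeakSpace 𝕜 V '' closure (Set.range fun g => M.ρ g v)) :=
      (hK.image (toWeakSpaceCLM 𝕜 V).continuous).isClosed
    have h2 : Continuous fun s : M.Envelope => toWeakSpace 𝕜 V (s.op v) :=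
      (continuous_apply v).comp Envelope.isEmbedding.continuous
    convert h1.preimage h2 using 1
    ext s
    simp
  exact Envelope.denseRange_of.induction_on
    (p := fun s : M.Envelope => s.op v ∈ closure (Set.range fun g => M.ρ g v)) s hcl
    fun g => subset_closure ⟨g, rfl⟩

theorem Envelope.op_mem_apVectors {v : V} (hv : v ∈ M.apVectors) (s : M.Envelope) :
    s.op v ∈ M.apVectors := by
  refine isCompact_of_subset_isCompact hv ?_
  rintro _ ⟨g, rfl⟩
  exact Envelope.op_mem_closure_orbit hv (Envelope.of M g * s)

theorem Envelope.norm_le_norm_op {C : ℝ} (hC : ∀ g, ‖M.ρ g‖ ≤ C) {v : V} (hv : v ∈ M.apVectors)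
    (s : M.Envelope) : ‖v‖ ≤ C * ‖s.op v‖ := by
  have hcl : IsClosed {w : V | ‖v‖ ≤ C * ‖w‖} :=
    isClosed_le continuous_const (continuous_const.mul continuous_norm)
  refine closure_minimal ?_ hcl (Envelope.op_mem_closure_orbit hv s)
  rintro _ ⟨g, rfl⟩
  have h : M.ρ g⁻¹ (M.ρ g v) = v := by
    rw [← mul_apply_eq_comp, ← map_mul, inv_mul_cancel, map_one]
    rfl
  calc ‖v‖ = ‖M.ρ g⁻¹ (M.ρ g v)‖ := by rw [h]
    _ ≤ _ := (M.ρ g⁻¹).le_of_opNorm_le (hC _) _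

/-- Elements of the envelope are bounded below on almost periodic vectors, and p annihilates v − p
v. -/
theorem Envelope.idempotent_apply {C : ℝ} (hC : ∀ g, ‖M.ρ g‖ ≤ C) {p : M.Envelope}
    (hp : p * p = p) {v : V} (hv : v ∈ M.apVectors) : p.op v = v := by
  have h := Envelope.norm_le_norm_op hC (sub_mem_apVectors hv (Envelope.op_mem_apVectors hv p)) p
  rw [map_sub, ← Envelope.op_mul, hp, sub_self, norm_zero, mul_zero] at h
  exact (sub_eq_zero.1 (norm_eq_zero.1 (le_antisymm h (norm_nonneg _)))).symm

/-- The coefficient `u ↦ φ (s (u v))` on the envelope. -/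
def Envelope.coeff (φ : StrongDual 𝕜 V) (v : V) (s : M.Envelope) : C(M.Envelope, 𝕜) :=
  ⟨fun u => φ (s.op (u.op v)), Envelope.continuous_dual_op (φ.comp s.op) v⟩

/-- Since g is invertible, u ↦ gu permutes the envelope and leaves the supremum unchanged. -/
theorem Envelope.coeff_mul_of [CompactSpace M.Envelope] (φ : StrongDual 𝕜 V) (v : V)
    (s t : M.Envelope) (g : G) :
    ‖coeff φ v (s * of M g) - coeff φ v (t * of M g)‖ = ‖coeff φ v s - coeff φ v t‖ := by
  refine le_antisymm ?_ ?_
  · refine (ContinuousMap.norm_le _ (norm_nonneg _)).2 fun u => ?_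
    exact ContinuousMap.norm_coe_le_norm (coeff φ v s - coeff φ v t) (of M g * u)
  · refine (ContinuousMap.norm_le _ (norm_nonneg _)).2 fun u => ?_
    have h := ContinuousMap.norm_coe_le_norm
      (coeff φ v (s * of M g) - coeff φ v (t * of M g)) (of M g⁻¹ * u)
    have hu : of M g * (of M g⁻¹ * u) = u := by
      rw [← mul_assoc, ← of_mul, mul_inv_cancel, of_one, one_mul]
    have h1 : ∀ s, coeff φ v (s * of M g) (of M g⁻¹ * u) = coeff φ v s u := by
      intro s
      change φ (s.op ((of M g * (of M g⁻¹ * u)).op v)) = φ (s.op (u.op v))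
      rw [hu]
    rwa [ContinuousMap.sub_apply, h1, h1] at h

/-- For a group element t, the coefficients of st and spt have a sup distance independent of t.
These differences lie in a norm-compact set, which is closed for pointwise convergence, so the
distance persists for every t in the envelope. At t = p it is 0, since pp = p. -/
theorem Envelope.coeff_idempotent [CompactSpace M.Envelope] (φ : StrongDual 𝕜 V) (v : V)
    {R : Set M.Envelope} (hR : ∀ r ∈ R, ∀ s, r * s ∈ R) (htb : TotallyBounded (coeff φ v '' R))
    {p s : M.Envelope} (hp : p * p = p) (hs : s ∈ R) : φ (s.op (p.op v)) = φ (s.op v) := by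
  let K := closure (coeff φ v '' R)
  have hK : IsCompact K := htb.closure.isCompact_of_isClosed isClosed_closure
  have hD : IsCompact ((fun x : C(M.Envelope, 𝕜) × C(M.Envelope, 𝕜) => x.1 - x.2) '' (K ×ˢ K) ∩
      {f | ‖f‖ = ‖coeff φ v s - coeff φ v (s * p)‖}) :=
    ((hK.prod hK).image continuous_sub).inter_right (isClosed_eq continuous_norm continuous_const)
  have hev : Continuous fun (f : C(M.Envelope, 𝕜)) (u : M.Envelope) => f u :=
    continuous_pi fun u => continuous_eval_const u
  have hcl := (hD.image hev).isClosed
  have hc : Continuous fun (t : M.Envelope) (u : M.Envelope) =>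
      φ (s.op (t.op (u.op v))) - φ ((s * p).op (t.op (u.op v))) :=
    continuous_pi fun u => (continuous_dual_op (φ.comp s.op) _).sub
      (continuous_dual_op (φ.comp (s * p).op) _)
  obtain ⟨f, ⟨-, hf⟩, hfp⟩ := denseRange_of.induction_on
    (p := fun t : M.Envelope => (fun (u : M.Envelope) =>
      φ (s.op (t.op (u.op v))) - φ ((s * p).op (t.op (u.op v)))) ∈ _) p
    (hcl.preimage hc) fun g => by
      refine ⟨coeff φ v (s * of M g) - coeff φ v (s * p * of M g), ⟨⟨(_, _),
        ⟨subset_closure ⟨_, hR s hs _, rfl⟩, subset_closure ⟨_, hR _ (hR s hs p) _, rfl⟩⟩, rfl⟩,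
        coeff_mul_of φ v s (s * p) g⟩, rfl⟩
  have hf0 : f = 0 := by
    ext u
    have h := congrFun hfp u
    simp only [← op_mul, mul_assoc] at h
    rw [← mul_assoc p p u, hp, sub_self] at h
    exact h
  rw [hf0] at hf
  simp only [Set.mem_ofPred_eq, norm_zero] at hf
  have h1 := congrArg (fun f : C(M.Envelope, 𝕜) => f 1)
    (sub_eq_zero.1 (norm_eq_zero.1 hf.symm))
  exact h1.symm

/-- The projection is an idempotent lying in a minimal left ideal L and a minimal right ideal R.
Minimality of L makes its values almost periodic; minimality of R makes it commute with the group.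
-/
theorem IsWAP.exists_projection [CompleteSpace V] [TopologicalSpace.SeparableSpace V]
    (hM : M.IsWAP) : ∃ p : V →L[𝕜] V, (∀ g v, p (M.ρ g v) = M.ρ g (p v)) ∧
      (∀ v, p v ∈ M.apVectors) ∧ ∀ v ∈ M.apVectors, p v = v := by
  have := Envelope.compactSpace hM
  have := Envelope.secondCountableTopology hM
  have : SecondCountableTopology V := UniformSpace.secondCountable_of_separable V
  obtain ⟨C, hC⟩ := hM.exists_norm_le
  have : Nonempty M.Envelope := ⟨1⟩
  obtain ⟨L, hLc, hLne, hLinv, hLmin⟩ := exists_minimal_closed_invariant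
    (τ := fun (g : G) (s : M.Envelope) => Envelope.of M g * s)
    (fun g => Envelope.continuous_mul_left _)
    (fun g h => ⟨g * h, fun s => by rw [Envelope.of_mul, mul_assoc]⟩) ⟨1⟩
  obtain ⟨R, hRc, hRne, hRinv, hRmin⟩ := exists_minimal_closed_invariant
    (τ := fun (g : G) (s : M.Envelope) => s * Envelope.of M g)
    (fun g => Envelope.continuous_mul_right _)
    (fun g h => ⟨h * g, fun s => by rw [Envelope.of_mul, mul_assoc]⟩) ⟨1⟩
  have hL : ∀ l ∈ L, ∀ s, s * l ∈ L := fun l hl s =>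
    Envelope.denseRange_of.induction_on (p := fun s => s * l ∈ L) s
      (hLc.preimage (Envelope.continuous_mul_right l)) fun g => hLinv g l hl
  have hR : ∀ r ∈ R, ∀ s, r * s ∈ R := fun r hr s =>
    Envelope.denseRange_of.induction_on (p := fun s => r * s ∈ R) s
      (hRc.preimage (Envelope.continuous_mul_left r)) fun g => hRinv g r hr
  -- The Ellis–Numakura lemma; L ∩ R contains the product of any r in R with any l in L.
  obtain ⟨p, ⟨hpL, hpR⟩, hp⟩ := exists_idempotent_in_compact_subsemigroup
    (Envelope.continuous_mul_right (M := M)) (L ∩ R)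
    (by
      obtain ⟨l, hl⟩ := hLne
      obtain ⟨r, hr⟩ := hRne
      exact ⟨r * l, hL l hl r, hR r hr l⟩)
    (hLc.inter hRc).isCompact fun x hx y hy => ⟨hL y hy.1 x, hR x hx.2 y⟩
  have hLap : ∀ l ∈ L, ∀ v, l.op v ∈ M.apVectors := by
    intro l hl v
    have htb := totallyBounded_image_of_minimal (C := C)
      (fun g => Envelope.continuous_mul_left _) hLc hLne hLmin hLinv
      (fun s : M.Envelope => s.op v) (fun z r => by
        simp only [dist_eq_norm]
        exact Envelope.isClosed_norm_le v z r) (fun g s t => by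
        have h := Envelope.norm_op_le hC (Envelope.of M g⁻¹)
          ((Envelope.of M g * s).op v - (Envelope.of M g * t).op v)
        rw [map_sub, ← Envelope.op_mul, ← Envelope.op_mul, ← mul_assoc, ← mul_assoc,
          ← Envelope.of_mul, inv_mul_cancel, Envelope.of_one, one_mul, one_mul] at h
        rwa [dist_eq_norm, dist_eq_norm])
    refine isCompact_of_subset_isCompact
      (htb.closure.isCompact_of_isClosed isClosed_closure) ?_
    rintro _ ⟨g, rfl⟩
    exact subset_closure ⟨_, hLinv g l hl, rfl⟩
  have hRtb : ∀ φ v, TotallyBounded (Envelope.coeff (M := M) φ v '' R) := by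
    intro φ v
    refine totallyBounded_image_of_minimal (C := 1)
      (fun g => Envelope.continuous_mul_right _) hRc hRne hRmin hRinv _ (fun z r => ?_)
      (fun g s t => ?_)
    · rcases lt_or_ge r 0 with hr | hr
      · convert isClosed_empty
        ext s
        simpa using hr.trans_le dist_nonneg
      · have : {s : M.Envelope | dist (Envelope.coeff φ v s) z ≤ r} =
            ⋂ u : M.Envelope, {s | ‖φ (s.op (u.op v)) - z u‖ ≤ r} := by
          ext s
          rw [Set.mem_ofPred_eq, dist_eq_norm, ContinuousMap.norm_le _ hr]
          simp only [Set.mem_iInter, Set.mem_ofPred_eq]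
          rfl
        rw [this]
        exact isClosed_iInter fun u => isClosed_le
          ((Envelope.continuous_dual_op φ _).sub continuous_const).norm continuous_const
    · rw [one_mul, dist_eq_norm, dist_eq_norm, Envelope.coeff_mul_of]
  refine ⟨p.op, fun g v => ?_, hLap p hpL, fun v hv => Envelope.idempotent_apply hC hp hv⟩
  -- The operator pρ(g)p is computed in two ways: it equals ρ(g)p because p fixes almost periodic
  -- vectors, and pρ(g) by the identity for coefficients on R.
  have h1 : p.op (M.ρ g (p.op v)) = M.ρ g (p.op v) :=
    Envelope.idempotent_apply hC hp (hLap _ (hLinv g p hpL) v)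
  rw [← h1]
  refine (SeparatingDual.eq_iff_forall_dual_eq (R := 𝕜)).2 fun φ => ?_
  exact (Envelope.coeff_idempotent φ v hR (hRtb φ v) hp (hRinv g p hpR)).symm

end GModule

end Splitting

/-! ### Sublinear cocycles in finite dimension -/

section FiniteDimensional

variable {G : Type*} [Group G] {E : Type*} [NormedAddCommGroup E] [InnerProductSpace ℝ E]
  [FiniteDimensional ℝ E] {ρ : G →* (E →L[ℝ] E)}

theorem rep_inv_apply {𝕜 : Type*} [RCLike 𝕜] {V : Type*} [NormedAddCommGroup V] [NormedSpace 𝕜 V]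
    (π : G →* (V →L[𝕜] V)) (g : G) (v : V) : π g (π g⁻¹ v) = v := by
  rw [← mul_apply_eq_comp, ← map_mul, mul_inv_cancel, map_one]
  rfl

theorem inner_rep_apply {𝕜 : Type*} [RCLike 𝕜] {H : Type*} [NormedAddCommGroup H]
    [InnerProductSpace 𝕜 H] {U : G →* (H →L[𝕜] H)} (hU : ∀ g v, ‖U g v‖ = ‖v‖) (g : G) (x y : H) :
    inner 𝕜 x (U g y) = inner 𝕜 (U g⁻¹ x) y := by
  let Ug : H →ₗᵢ[𝕜] H := ⟨(U g).toLinearMap, hU g⟩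
  have h := Ug.inner_map_map (U g⁻¹ x) y
  rw [← h]
  change _ = inner 𝕜 (U g (U g⁻¹ x)) (U g y)
  rw [rep_inv_apply]

omit [FiniteDimensional ℝ E] in
theorem rep_mul_mem_convexHull (g : G) {T : E →L[ℝ] E} (hT : T ∈ convexHull ℝ (Set.range ρ)) :
    ρ g * T ∈ convexHull ℝ (Set.range ρ) := by
  have hconv : Convex ℝ {T : E →L[ℝ] E | ρ g * T ∈ convexHull ℝ (Set.range ρ)} := by
    intro T hT T' hT' a b ha hb hab
    simp only [Set.mem_ofPred_eq, mul_add, mul_smul_comm] at hT hT' ⊢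
    exact convex_convexHull ℝ _ hT hT' ha hb hab
  refine convexHull_min ?_ hconv hT
  rintro _ ⟨h, rfl⟩
  exact subset_convexHull ℝ _ ⟨g * h, map_mul ρ g h⟩

/-- The point of least Hilbert–Schmidt norm in the closed convex hull of ρ(G) is invariant under
left multiplication, by the parallelogram law. Its range thus consists of fixed vectors, so it is 0.
-/
theorem exists_mem_convexHull_norm_lt (hρ : ∀ g v, ‖ρ g v‖ = ‖v‖)
    (hfix : ∀ v, (∀ g, ρ g v = v) → v = 0) {ε : ℝ} (hε : 0 < ε) :
    ∃ T ∈ convexHull ℝ (Set.range ρ), ‖T‖ < ε := by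
  have : ProperSpace (E →L[ℝ] E) := FiniteDimensional.proper_real _
  let H := closure (convexHull ℝ (Set.range ρ))
  have hHc : IsCompact H := by
    refine GModule.isCompact_of_subset_isCompact (isCompact_closedBall (0 : E →L[ℝ] E) 1)
      (convexHull_min ?_ (convex_closedBall _ _))
    rintro _ ⟨g, rfl⟩
    rw [mem_closedBall_zero_iff]
    exact ContinuousLinearMap.opNorm_le_bound _ zero_le_one fun v => by rw [hρ, one_mul]
  have hHconv : Convex ℝ H := (convex_convexHull ℝ _).closure
  have hne : H.Nonempty := ⟨ρ 1, subset_closure (subset_convexHull ℝ _ ⟨1, rfl⟩)⟩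
  let e := stdOrthonormalBasis ℝ E
  let f : (E →L[ℝ] E) → ℝ := fun T => ∑ i, ‖T (e i)‖ ^ 2
  have hf : Continuous f := by fun_prop
  obtain ⟨T, hT, hmin⟩ := hHc.exists_isMinOn hne hf.continuousOn
  have hfixT : ∀ g, ρ g * T = T := by
    intro g
    have h1 : ρ g * T ∈ H := map_mem_closure (continuous_const_mul (ρ g)) hT
      fun T hT => rep_mul_mem_convexHull g hT
    have h2 : (1 / 2 : ℝ) • T + (1 / 2 : ℝ) • (ρ g * T) ∈ H :=
      hHconv hT h1 (by norm_num) (by norm_num) (by norm_num)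
    have h3 : f T ≤ f ((1 / 2 : ℝ) • T + (1 / 2 : ℝ) • (ρ g * T)) := hmin h2
    have h4 : ∀ i, ‖((1 / 2 : ℝ) • T + (1 / 2 : ℝ) • (ρ g * T)) (e i)‖ ^ 2 =
        ‖T (e i)‖ ^ 2 - (1 / 4) * ‖T (e i) - ρ g (T (e i))‖ ^ 2 := by
      intro i
      have h5 : ((1 / 2 : ℝ) • T + (1 / 2 : ℝ) • (ρ g * T)) (e i) =
          (1 / 2 : ℝ) • (T (e i) + ρ g (T (e i))) := by
        simp [mul_apply_eq_comp]
      have h6 := parallelogram_law_with_norm ℝ (T (e i)) (ρ g (T (e i)))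
      rw [hρ] at h6
      rw [h5, norm_smul]
      norm_num
      nlinarith
    have h5 : ∑ i, ‖T (e i) - ρ g (T (e i))‖ ^ 2 ≤ 0 := by
      simp only [f, h4, Finset.sum_sub_distrib, ← Finset.mul_sum] at h3
      linarith
    have h6 := (Finset.sum_eq_zero_iff_of_nonneg fun i _ => sq_nonneg _).1
      (le_antisymm h5 (Finset.sum_nonneg fun i _ => sq_nonneg _))
    refine ContinuousLinearMap.coe_injective (e.toBasis.ext fun i => ?_)
    have h7 := h6 i (Finset.mem_univ i)
    rw [sq_eq_zero_iff, norm_eq_zero, sub_eq_zero] at h7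
    simpa [mul_apply_eq_comp] using h7.symm
  have hT0 : T = 0 := ContinuousLinearMap.ext fun v =>
    hfix (T v) fun g => congrArg (fun T : E →L[ℝ] E => T v) (hfixT g)
  obtain ⟨T', hT', hd⟩ := Metric.mem_closure_iff.1 hT ε hε
  exact ⟨T', hT', by simpa [hT0] using hd⟩

/-- Finitely many values of z form a basis of the span of all of them. -/
theorem exists_finset_determining {W : Type*} [AddCommGroup W] [Module ℝ W] [FiniteDimensional ℝ W]
    (z : G → W) : ∃ F : Finset G, ∀ ℓ : W →ₗ[ℝ] ℝ, (∀ g ∈ F, ℓ (z g) = 0) → ∀ g, ℓ (z g) = 0 := by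
  obtain ⟨b, hb, hspan, hli⟩ := exists_linearIndependent ℝ (Set.range z)
  have hfin : b.Finite := hli.setFinite
  choose! r hr using fun x (hx : x ∈ b) => hb hx
  classical
  refine ⟨hfin.toFinset.image r, fun ℓ hℓ g => ?_⟩
  have hle : Submodule.span ℝ b ≤ LinearMap.ker ℓ := by
    refine Submodule.span_le.2 fun x hx => ?_
    have := hℓ (r x) (Finset.mem_image_of_mem r (hfin.mem_toFinset.2 hx))
    rwa [hr x hx] at this
  exact hle (hspan ▸ Submodule.subset_span ⟨g, rfl⟩)

/-- A cocycle that takes positive values in all directions of its span grows linearly. -/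
theorem cocycle_eq_zero_of_positive (hρ : ∀ g v, ‖ρ g v‖ = ‖v‖) {β : G → E}
    (hβ : ∀ g h, β (g * h) = ρ g (β h) + β g) {L : G → ℕ} (hL : ∀ g h, L (g * h) ≤ L g + L h)
    (hsub : ∀ η > 0, ∃ B : ℝ, ∀ g, ‖β g‖ ≤ η * L g + B)
    (hpos : ∀ x ∈ Submodule.span ℝ (Set.range β), x ≠ 0 → ∃ g, 0 < inner ℝ x (β g)) :
    ∀ g, β g = 0 := by
  by_contra! hne
  obtain ⟨g0, hg0⟩ := hne
  set E' := Submodule.span ℝ (Set.range β)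
  have hinv : ∀ g, ∀ x ∈ E', ρ g x ∈ E' := by
    intro g x hx
    have hle : E' ≤ E'.comap (ρ g).toLinearMap := by
      refine Submodule.span_le.2 ?_
      rintro _ ⟨h, rfl⟩
      change ρ g (β h) ∈ E'
      rw [← add_sub_cancel_right (ρ g (β h)) (β g), ← hβ]
      exact E'.sub_mem (Submodule.subset_span ⟨_, rfl⟩) (Submodule.subset_span ⟨_, rfl⟩)
    exact hle hx
  have hcomp : IsCompact ((E' : Set E) ∩ Metric.sphere 0 1) := by
    have : ProperSpace E := FiniteDimensional.proper_real E
    exact (isCompact_sphere (0 : E) 1).inter_left E'.closed_of_finiteDimensional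
  -- Compactness of the unit sphere of the span: finitely many group elements give a uniform gain δ
  -- in every direction.
  obtain ⟨t, ht⟩ := hcomp.elim_finite_subcover
    (fun p : G × ℕ => {x : E | 1 / ((p.2 : ℝ) + 1) < inner ℝ x (β p.1)})
    (fun p => isOpen_lt continuous_const (by fun_prop)) (by
      rintro x ⟨hx, hx1⟩
      have hx0 : x ≠ 0 := by
        rintro rfl
        simp at hx1
      obtain ⟨g, hg⟩ := hpos x hx hx0
      obtain ⟨n, hn⟩ := exists_nat_one_div_lt hg
      exact Set.mem_iUnion.2 ⟨(g, n), hn⟩)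
  let N := t.sup Prod.snd
  let K := t.sup fun p => L p.1
  let δ : ℝ := 1 / ((N : ℝ) + 1)
  have hδ : 0 < δ := by positivity
  have hstep : ∀ x ∈ E', ‖x‖ = 1 → ∃ w, δ ≤ inner ℝ x (β w) ∧ L w ≤ K := by
    intro x hx hx1
    obtain ⟨p, hp, hxp⟩ := Set.mem_iUnion₂.1 (ht ⟨hx, by simpa using hx1⟩)
    refine ⟨p.1, le_trans ?_ (le_of_lt hxp), Finset.le_sup (f := fun p : G × ℕ => L p.1) hp⟩
    have : (p.2 : ℝ) ≤ N := by exact_mod_cast Finset.le_sup (f := Prod.snd) hp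
    exact one_div_le_one_div_of_le (by positivity) (by linarith)
  let x0 : E := ‖β g0‖⁻¹ • β g0
  have hx0 : x0 ∈ E' := E'.smul_mem _ (Submodule.subset_span ⟨g0, rfl⟩)
  have hx01 : ‖x0‖ = 1 := by
    rw [norm_smul, norm_inv, norm_norm, inv_mul_cancel₀ (norm_ne_zero_iff.2 hg0)]
  -- A greedy walk: ⟨x0, β(gw)⟩ = ⟨x0, β g⟩ + ⟨ρ(g)⁻¹x0, β w⟩, with w chosen for the direction
  -- ρ(g)⁻¹x0. Each step gains δ and adds at most K to the length.
  have hgrow : ∀ k : ℕ, ∃ g, k * δ ≤ inner ℝ x0 (β g) ∧ L g ≤ L 1 + k * K := by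
    intro k
    induction k with
    | zero =>
      have h1 : β 1 = 0 := cocycle_one hβ
      exact ⟨1, by simp [h1], by simp⟩
    | succ k ih =>
      obtain ⟨g, hg1, hg2⟩ := ih
      obtain ⟨w, hw1, hw2⟩ := hstep (ρ g⁻¹ x0) (hinv _ _ hx0) (by rw [hρ, hx01])
      refine ⟨g * w, ?_, ?_⟩
      · rw [hβ, inner_add_right, inner_rep_apply hρ]
        push_cast
        linarith
      · have := hL g w
        rw [add_mul, one_mul]
        omega
  -- At this rate k steps allow growth of only kδ/2 plus a constant, against the gain kδ.
  obtain ⟨B, hB⟩ := hsub (δ / (2 * (K + 1))) (by positivity)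
  obtain ⟨k, hk⟩ := exists_nat_gt ((δ / (2 * (K + 1)) * L 1 + B) / (δ / 2))
  rw [div_lt_iff₀ (by positivity)] at hk
  obtain ⟨g, hg1, hg2⟩ := hgrow k
  have h1 : inner ℝ x0 (β g) ≤ ‖β g‖ := by
    have := real_inner_le_norm x0 (β g)
    rwa [hx01, one_mul] at this
  have h2 : (L g : ℝ) ≤ L 1 + k * K := by exact_mod_cast hg2
  have h3 : δ / (2 * (K + 1)) * L g ≤ δ / (2 * (K + 1)) * (L 1 + k * K) :=
    mul_le_mul_of_nonneg_left h2 (by positivity)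
  have h4 : δ / (2 * (K + 1)) * (k * K) ≤ δ / 2 * k := by
    have hK : (0 : ℝ) ≤ K := Nat.cast_nonneg _
    have hk0 : (0 : ℝ) ≤ k := Nat.cast_nonneg _
    rw [div_mul_eq_mul_div, div_le_iff₀ (by positivity)]
    have : 0 ≤ δ * k := by positivity
    nlinarith
  have := hB g
  nlinarith

-- Average the affine action x ↦ ρ(g)x + β(g) so that the linear part becomes a strict contraction,
-- and let u be the fixed point of the average. The displacements of u form a cocycle with a
-- vanishing convex combination, so no nonzero direction in their span pairs nonpositively with all
-- of them. By `cocycle_eq_zero_of_positive` this cocycle is 0.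
set_option maxHeartbeats 1000000 in
theorem exists_eq_coboundary_of_sublinear (hρ : ∀ g v, ‖ρ g v‖ = ‖v‖)
    (hfix : ∀ v, (∀ g, ρ g v = v) → v = 0) {β : G → E}
    (hβ : ∀ g h, β (g * h) = ρ g (β h) + β g) {L : G → ℕ} (hL : ∀ g h, L (g * h) ≤ L g + L h)
    (hsub : ∀ η > 0, ∃ B : ℝ, ∀ g, ‖β g‖ ≤ η * L g + B) : ∃ u, ∀ g, β g = u - ρ g u := by
  obtain ⟨T, hT, hT1⟩ := exists_mem_convexHull_norm_lt hρ hfix one_pos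
  let z : G → E × (E →L[ℝ] E) := fun g => (β g, ρ g)
  obtain ⟨y, hy⟩ : ∃ y, (y, T) ∈ convexHull ℝ (Set.range z) := by
    have h := (LinearMap.snd ℝ E (E →L[ℝ] E)).image_convexHull (Set.range z)
    rw [← Set.range_comp] at h
    have hT' : T ∈ LinearMap.snd ℝ E (E →L[ℝ] E) '' convexHull ℝ (Set.range z) := by
      rw [h]; exact hT
    obtain ⟨⟨y, T'⟩, h1, rfl⟩ := hT'
    exact ⟨y, h1⟩
  -- F must be chosen before u, which depends on it. The displacement ⟨x, β g − (u − ρ g u)⟩ is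
  -- linear in (1, β g, ρ g) whatever x and u are, so one F serves all of them.
  obtain ⟨F, hF⟩ := exists_finset_determining fun g => ((1 : ℝ), z g)
  -- Every element of F gets positive weight c while (y, T) keeps a positive share, so the average
  -- remains a strict contraction.
  let c : ℝ := 1 / (2 * (F.card + 1))
  have hc : 0 < c := by positivity
  have hc1 : c * F.card < 1 := by
    simp only [c]
    rw [one_div_mul_eq_div, div_lt_one (by positivity)]
    have : (0 : ℝ) ≤ F.card := Nat.cast_nonneg _
    linarith
  let T' : E →L[ℝ] E := (1 - c * F.card) • T + c • ∑ g ∈ F, ρ g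
  let y' : E := (1 - c * F.card) • y + c • ∑ g ∈ F, β g
  have hT'1 : ‖T'‖ < 1 := by
    have h1 : ‖∑ g ∈ F, ρ g‖ ≤ F.card := by
      refine (norm_sum_le _ _).trans ?_
      have : ∀ g ∈ F, ‖ρ g‖ ≤ 1 := fun g _ =>
        ContinuousLinearMap.opNorm_le_bound _ zero_le_one fun v => by rw [hρ, one_mul]
      calc ∑ g ∈ F, ‖ρ g‖ ≤ ∑ g ∈ F, (1 : ℝ) := Finset.sum_le_sum this
        _ = F.card := by rw [Finset.sum_const, nsmul_eq_mul, mul_one]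
    calc ‖T'‖ ≤ ‖(1 - c * F.card) • T‖ + ‖c • ∑ g ∈ F, ρ g‖ := norm_add_le _ _
      _ = (1 - c * F.card) * ‖T‖ + c * ‖∑ g ∈ F, ρ g‖ := by
        rw [norm_smul, norm_smul, Real.norm_of_nonneg hc.le, Real.norm_of_nonneg (by linarith)]
      _ < (1 - c * F.card) * 1 + c * F.card :=
        add_lt_add_of_lt_of_le (mul_lt_mul_of_pos_left hT1 (by linarith))
          (mul_le_mul_of_nonneg_left h1 hc.le)
      _ = 1 := by ring
  obtain ⟨u, hu⟩ : ∃ u, u - T' u = y' := by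
    obtain ⟨N, hN⟩ := isUnit_one_sub_of_norm_lt_one hT'1
    refine ⟨N.inv y', ?_⟩
    have h := congrArg (fun T : E →L[ℝ] E => T y') N.val_inv
    rw [hN] at h
    simpa [mul_apply_eq_comp] using h
  refine ⟨u, fun g => ?_⟩
  rw [← sub_eq_zero]
  revert g
  have hcoc : ∀ g h, β (g * h) - (u - ρ (g * h) u) =
      ρ g (β h - (u - ρ h u)) + (β g - (u - ρ g u)) := by
    intro g h
    simp only [hβ, map_mul, map_sub, mul_apply_eq_comp]
    abel
  refine cocycle_eq_zero_of_positive hρ hcoc hL (fun η hη => ?_) fun x hx hx0 => ?_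
  · obtain ⟨B, hB⟩ := hsub η hη
    refine ⟨B + (‖u‖ + ‖u‖), fun g => ?_⟩
    have h1 : ‖u - ρ g u‖ ≤ ‖u‖ + ‖u‖ := by
      have := norm_sub_le u (ρ g u)
      rwa [hρ] at this
    have := norm_sub_le (β g) (u - ρ g u)
    have := hB g
    linarith
  · by_contra! hle
    let ℓ : ℝ × E × (E →L[ℝ] E) →ₗ[ℝ] ℝ := (innerₛₗ ℝ x).comp
      ((LinearMap.fst ℝ E _).comp (LinearMap.snd ℝ ℝ _) -
        ((LinearMap.fst ℝ ℝ _).smulRight u -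
          ((ContinuousLinearMap.apply ℝ E u).toLinearMap.comp
            ((LinearMap.snd ℝ E _).comp (LinearMap.snd ℝ ℝ _)))))
    have hℓ : ∀ a y T, ℓ (a, y, T) = inner ℝ x (y - (a • u - T u)) := fun a y T => rfl
    have hℓz : ∀ g, ℓ (1, z g) = inner ℝ x (β g - (u - ρ g u)) := fun g => by
      rw [hℓ, one_smul]
    have hyT : inner ℝ x (y - (u - T u)) ≤ 0 := by
      have hconv : Convex ℝ {p : E × (E →L[ℝ] E) | inner ℝ x (p.1 - (u - p.2 u)) ≤ 0} := by
        intro p hp q hq a b ha hb hab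
        simp only [Set.mem_ofPred_eq] at hp hq ⊢
        have : (a • p + b • q).1 - (u - (a • p + b • q).2 u) =
            a • (p.1 - (u - p.2 u)) + b • (q.1 - (u - q.2 u)) := by
          obtain rfl : a = 1 - b := by linarith
          simp only [Prod.fst_add, Prod.snd_add, Prod.smul_fst, Prod.smul_snd, add_apply,
            FunLike.coe_smul, Pi.smul_apply]
          module
        rw [this, inner_add_right, inner_smul_right, inner_smul_right]
        nlinarith
      refine convexHull_min ?_ hconv hy
      rintro _ ⟨g, rfl⟩
      exact hle g
    have hzero : (1 - c * F.card) * inner ℝ x (y - (u - T u)) +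
        c * ∑ g ∈ F, inner ℝ x (β g - (u - ρ g u)) = 0 := by
      have h1 : y' - (u - T' u) = 0 := by rw [hu, sub_self]
      have h2 : (1 - c * F.card) • (y - (u - T u)) + c • ∑ g ∈ F, (β g - (u - ρ g u)) = 0 := by
        rw [← h1]
        simp only [y', T', Finset.sum_sub_distrib, add_apply, FunLike.coe_smul,
          Pi.smul_apply, sum_apply, Finset.sum_const, ← Nat.cast_smul_eq_nsmul ℝ]
        module
      have h3 := congrArg (inner ℝ x) h2
      rwa [inner_add_right, inner_smul_right, inner_smul_right, inner_sum, inner_zero_right] at h3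
    have hsum : ∑ g ∈ F, inner ℝ x (β g - (u - ρ g u)) = 0 := by
      have h1 : ∑ g ∈ F, inner ℝ x (β g - (u - ρ g u)) ≤ 0 := Finset.sum_nonpos fun g _ => hle g
      nlinarith
    have hFz := (Finset.sum_eq_zero_iff_of_nonpos fun g _ => hle g).1 hsum
    have hall := hF ℓ fun g hg => by rw [hℓz]; exact hFz g hg
    have hperp : Submodule.span ℝ (Set.range fun g => β g - (u - ρ g u)) ≤
        LinearMap.ker (innerₛₗ ℝ x) := by
      refine Submodule.span_le.2 ?_
      rintro _ ⟨g, rfl⟩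
      have := hall g
      rw [hℓz] at this
      exact this
    exact hx0 (inner_self_eq_zero.1 (hperp hx))

end FiniteDimensional

/-! ### From coefficient coboundaries to a vector coboundary -/

section Coefficients

variable {𝕜 : Type*} [RCLike 𝕜] {G : Type*} [Group G]

theorem exists_eq_coboundary_of_sublinear_rclike {E : Type*} [NormedAddCommGroup E]
    [InnerProductSpace 𝕜 E] [FiniteDimensional 𝕜 E] {ρ : G →* (E →L[𝕜] E)}
    (hρ : ∀ g v, ‖ρ g v‖ = ‖v‖) (hfix : ∀ v, (∀ g, ρ g v = v) → v = 0) {β : G → E}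
    (hβ : ∀ g h, β (g * h) = ρ g (β h) + β g) {L : G → ℕ} (hL : ∀ g h, L (g * h) ≤ L g + L h)
    (hsub : ∀ η > 0, ∃ B : ℝ, ∀ g, ‖β g‖ ≤ η * L g + B) : ∃ u, ∀ g, β g = u - ρ g u := by
  let _ : InnerProductSpace ℝ E := InnerProductSpace.rclikeToReal 𝕜 E
  have _ : IsScalarTower ℝ 𝕜 E := RestrictScalars.isScalarTower ℝ 𝕜 E
  have _ : FiniteDimensional ℝ E := FiniteDimensional.trans ℝ 𝕜 E
  let ρ' : G →* (E →L[ℝ] E) :=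
    { toFun := fun g => (ρ g).restrictScalars ℝ
      map_one' := by rw [map_one]; rfl
      map_mul' := fun g h => by rw [map_mul]; rfl }
  exact exists_eq_coboundary_of_sublinear (ρ := ρ') hρ hfix hβ hL hsub

variable {H : Type*} [NormedAddCommGroup H] [InnerProductSpace 𝕜 H]

theorem starProjection_rep_apply {U : G →* (H →L[𝕜] H)} (hU : ∀ g v, ‖U g v‖ = ‖v‖)
    (E : Submodule 𝕜 H) [E.HasOrthogonalProjection] (hE : ∀ g, ∀ e ∈ E, U g e ∈ E) (g : G) (h : H) :
    E.starProjection (U g h) = U g (E.starProjection h) := by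
  refine Submodule.eq_starProjection_of_mem_of_inner_eq_zero
    (hE g _ (Submodule.starProjection_apply_mem E h)) fun w hw => ?_
  rw [← map_sub, ← inner_conj_symm, inner_rep_apply hU, inner_conj_symm]
  exact Submodule.starProjection_inner_eq_zero h _ (hE g⁻¹ w hw)

variable {W : Type*} [NormedAddCommGroup W] [NormedSpace 𝕜 W]

/-- `Φ φ v` plays the role of the matrix coefficient `y ↦ φ (y⁻¹ v)`, `A h v` that of
`∫ conj (h y) y⁻¹ v dy`, and `U`, `R` those of the left and right regular representations. -/
theorem exists_eq_coboundary_of_coefficients {π : G →* (W →L[𝕜] W)}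
    {U R : G →* (H →L[𝕜] H)} (hU : ∀ g v, ‖U g v‖ = ‖v‖) (hR : ∀ g v, ‖R g v‖ = ‖v‖)
    (hUR : ∀ g h v, U g (R h v) = R h (U g v))
    {Φ : StrongDual 𝕜 W → W →ₗ[𝕜] H} {A : H → W → W}
    (hA : ∀ φ h v, φ (A h v) = inner 𝕜 h (Φ φ v))
    (hΦU : ∀ φ g v, Φ φ (π g v) = U g (Φ φ v))
    (hΦR : ∀ (φ : StrongDual 𝕜 W) g v, Φ (φ.comp (π g)) v = R g⁻¹ (Φ φ v))
    (E : Submodule 𝕜 H) [FiniteDimensional 𝕜 E] (hEU : ∀ g, ∀ e ∈ E, U g e ∈ E)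
    (hER : ∀ g, ∀ e ∈ E, R g e ∈ E) (hEfix : ∀ e ∈ E, (∀ g, U g e = e) → e = 0)
    {f : H} (hf : ∀ g h, inner 𝕜 f (U g h) = inner 𝕜 f (R g⁻¹ h))
    {b : G → W} (hb : ∀ g h, b (g * h) = π g (b h) + b g)
    {L : G → ℕ} (hL : ∀ g h, L (g * h) ≤ L g + L h)
    (hsub : ∀ φ, ∀ η > 0, ∃ B : ℝ, ∀ g, ‖Φ φ (b g)‖ ≤ η * L g + B) :
    ∃ u, ∀ g, A (E.starProjection f) (b g) = u - π g u := by
  let P := E.starProjection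
  have hPmem : ∀ h, P h ∈ E := fun h => Submodule.starProjection_apply_mem E h
  have hPE : ∀ e ∈ E, ∀ h, inner 𝕜 e (P h) = inner 𝕜 e h := fun e he h => by
    have := Submodule.inner_starProjection_left_eq_right E e h
    rw [← this, Submodule.starProjection_eq_self_iff.2 he]
  let UE : G →* (E →L[𝕜] E) :=
    { toFun := fun g => ((U g).comp E.subtypeL).codRestrict E fun e => hEU g e e.2
      map_one' := by
        ext e
        simp
      map_mul' := fun g h => by
        ext e
        exact congrArg (fun T : H →L[𝕜] H => T e) (map_mul U g h) }
  have hUE : ∀ g e, (UE g e : H) = U g e := fun g e => rfl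
  -- The orthogonal projection commutes with U, so the projected coefficients are a sublinear
  -- cocycle in E.
  have hex : ∀ φ, ∃ u ∈ E, ∀ g, P (Φ φ (b g)) = u - U g u := by
    intro φ
    obtain ⟨u, hu⟩ := exists_eq_coboundary_of_sublinear_rclike (ρ := UE)
      (β := fun g => ⟨P (Φ φ (b g)), hPmem _⟩) (fun g v => hU g v)
      (fun v hv => Subtype.ext (hEfix v v.2 fun g => congrArg Subtype.val (hv g)))
      (fun g h => Subtype.ext (by
        rw [Submodule.coe_add, hUE]
        simp only [hb, map_add, hΦU]
        rw [starProjection_rep_apply hU E hEU]))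
      hL (fun η hη => by
        obtain ⟨B, hB⟩ := hsub φ η hη
        exact ⟨B, fun g => (Submodule.norm_starProjection_apply_le E _).trans (hB g)⟩)
    exact ⟨u, u.2, fun g => congrArg Subtype.val (hu g)⟩
  choose ψ hψE hψ using hex
  -- The solutions are unique, E having no U-fixed vectors, so they inherit the equivariance of Φ.
  have hψR : ∀ φ g, ψ (φ.comp (π g)) = R g⁻¹ (ψ φ) := by
    intro φ g
    rw [← sub_eq_zero]
    refine hEfix _ (E.sub_mem (hψE _) (hER _ _ (hψE _))) fun h => ?_
    have h1 := hψ (φ.comp (π g)) h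
    rw [hΦR, starProjection_rep_apply hR E hER, hψ φ h, map_sub, ← hUR] at h1
    rw [map_sub, ← sub_eq_zero]
    rw [eq_comm, ← sub_eq_zero] at h1
    rw [← neg_eq_zero, ← h1]
    abel
  -- The vectors h for which φ ↦ ⟨h, ψ φ⟩ is evaluation at a point of W, and not merely of some
  -- larger dual.
  let Ψ : Submodule 𝕜 H :=
    { carrier := {h | ∃ u, ∀ φ, inner 𝕜 h (ψ φ) = φ u}
      zero_mem' := ⟨0, fun φ => by simp⟩
      add_mem' := by
        rintro h h' ⟨u, hu⟩ ⟨u', hu'⟩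
        exact ⟨u + u', fun φ => by rw [inner_add_left, hu, hu', map_add]⟩
      smul_mem' := by
        rintro c h ⟨u, hu⟩
        exact ⟨(starRingEnd 𝕜) c • u, fun φ => by rw [inner_smul_left, hu, map_smul, smul_eq_mul]⟩ }
  have hΨ : ∀ e ∈ E, ∀ g, e - U g⁻¹ e ∈ Ψ := fun e he g => ⟨A e (b g), fun φ => by
    rw [hA, inner_sub_left, ← inner_rep_apply hU, ← inner_sub_right, ← hψ, hPE e he]⟩
  -- The vectors e − U(g)⁻¹e span E, since a vector of E orthogonal to them all is fixed by U.
  have hEΨ : E ≤ Ψ := by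
    intro e he
    let Ψ' : Submodule 𝕜 E := Ψ.comap E.subtype
    have htop : Ψ' = ⊤ := by
      rw [← Submodule.orthogonal_eq_bot_iff, Submodule.eq_bot_iff]
      intro x hx
      refine Subtype.ext (hEfix x x.2 fun g => ?_)
      have h1 : ∀ y : E, inner 𝕜 (y : H) ((x : H) - U g x) = 0 := fun y => by
        rw [inner_sub_right, inner_rep_apply hU, ← inner_sub_left]
        exact hx ⟨_, E.sub_mem y.2 (hEU g⁻¹ y y.2)⟩ (hΨ y y.2 g)
      have h2 := h1 ⟨_, E.sub_mem x.2 (hEU g x x.2)⟩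
      rw [inner_self_eq_zero, sub_eq_zero] at h2
      exact h2.symm
    have : (⟨e, he⟩ : E) ∈ Ψ' := htop ▸ Submodule.mem_top
    exact this
  obtain ⟨u, hu⟩ := hEΨ (hPmem f)
  have hfE : ∀ e ∈ E, inner 𝕜 (P f) e = inner 𝕜 f e := fun e he => by
    rw [← inner_conj_symm, hPE e he, inner_conj_symm]
  refine ⟨u, fun g => (SeparatingDual.eq_iff_forall_dual_eq (R := 𝕜)).2 fun φ => ?_⟩
  -- Applying φ ∘ π(g) to u gives a right translate of ψ φ; the class property of f exchanges it for
  -- a left translate.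
  have h1 : φ (π g u) = inner 𝕜 (P f) (U g (ψ φ)) := by
    rw [hfE _ (hEU g _ (hψE φ)), hf, ← hψR, ← hfE _ (hψE _), hu]
    rfl
  rw [hA, map_sub, h1, ← hu, ← inner_sub_right, ← hψ, hPE _ (hPmem f)]

end Coefficients

/-! ### The compact group generated by an almost periodic representation -/

section Bohr

variable {𝕜 : Type*} [RCLike 𝕜] {G : Type*} [Group G] {W : Type*} [NormedAddCommGroup W]
  [NormedSpace 𝕜 W]

/-- The closure of `{(π g, π g⁻¹)}` for pointwise convergence, for a uniformly bounded `π`. -/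
def BohrGroup (π : G →* (W →L[𝕜] W)) {C : ℝ} (_hC : ∀ g, ‖π g‖ ≤ C) : Type _ :=
  closure (Set.range fun g : G => ((π g : W → W), (π g⁻¹ : W → W)))

namespace BohrGroup

variable {π : G →* (W →L[𝕜] W)} {C : ℝ} {hC : ∀ g, ‖π g‖ ≤ C}

instance : TopologicalSpace (BohrGroup π hC) := instTopologicalSpaceSubtype

instance : T2Space (BohrGroup π hC) := inferInstanceAs (T2Space (closure _))

/-- The function by which an element of the Bohr group acts. -/
def toFun (k : BohrGroup π hC) : W → W := k.1.1

/-- The function by which the inverse of an element of the Bohr group acts. -/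
def invFun (k : BohrGroup π hC) : W → W := k.1.2

theorem ext {k l : BohrGroup π hC} (h1 : k.toFun = l.toFun) (h2 : k.invFun = l.invFun) : k = l :=
  Subtype.ext (Prod.ext h1 h2)

/-- The elements of the group `G` in its Bohr group. -/
def of (g : G) : BohrGroup π hC := ⟨_, subset_closure ⟨g, rfl⟩⟩

theorem denseRange_of : DenseRange (of : G → BohrGroup π hC) := by
  intro k
  have h : Set.range (of : G → BohrGroup π hC) =
      Subtype.val ⁻¹' (Set.range fun g : G => ((π g : W → W), (π g⁻¹ : W → W))) := by
    ext k
    exact ⟨by rintro ⟨g, rfl⟩; exact ⟨g, rfl⟩, by rintro ⟨g, hg⟩; exact ⟨g, Subtype.ext hg⟩⟩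
  refine closure_subtype.2 ?_
  rw [h, Subtype.image_preimage_coe, Set.inter_eq_right.2 subset_closure]
  exact k.2

theorem continuous_toFun_apply (v : W) : Continuous fun k : BohrGroup π hC => k.toFun v :=
  (continuous_apply v).comp (continuous_fst.comp continuous_subtype_val)

theorem continuous_invFun_apply (v : W) : Continuous fun k : BohrGroup π hC => k.invFun v :=
  (continuous_apply v).comp (continuous_snd.comp continuous_subtype_val)

theorem continuous_iff {X : Type*} [TopologicalSpace X] {f : X → BohrGroup π hC} :
    Continuous f ↔ (∀ v, Continuous fun x => (f x).toFun v) ∧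
      ∀ v, Continuous fun x => (f x).invFun v :=
  ⟨fun h => ⟨fun v => (continuous_toFun_apply v).comp h,
    fun v => (continuous_invFun_apply v).comp h⟩,
    fun h => Continuous.subtype_mk ((continuous_pi h.1).prodMk (continuous_pi h.2)) _⟩

theorem toFun_add (k : BohrGroup π hC) (v w : W) : k.toFun (v + w) = k.toFun v + k.toFun w := by
  refine denseRange_of.induction_on k ?_ fun g => map_add (π g) v w
  exact isClosed_eq (continuous_toFun_apply _)
    ((continuous_toFun_apply _).add (continuous_toFun_apply _))

theorem toFun_smul (k : BohrGroup π hC) (c : 𝕜) (v : W) : k.toFun (c • v) = c • k.toFun v := by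
  refine denseRange_of.induction_on k ?_ fun g => map_smul (π g) c v
  exact isClosed_eq (continuous_toFun_apply _) ((continuous_toFun_apply _).const_smul c)

theorem norm_toFun_le (k : BohrGroup π hC) (v : W) : ‖k.toFun v‖ ≤ C * ‖v‖ := by
  refine denseRange_of.induction_on k ?_ fun g => (π g).le_of_opNorm_le (hC g) v
  exact isClosed_le (continuous_toFun_apply _).norm continuous_const

theorem dist_toFun_le (k : BohrGroup π hC) (v w : W) :
    dist (k.toFun v) (k.toFun w) ≤ C * dist v w := by
  refine denseRange_of.induction_on k ?_ fun g => ?_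
  · exact isClosed_le ((continuous_toFun_apply _).dist (continuous_toFun_apply _)) continuous_const
  · rw [dist_eq_norm, dist_eq_norm]
    change ‖π g v - π g w‖ ≤ _
    rw [← map_sub]
    exact (π g).le_of_opNorm_le (hC g) _

theorem dist_invFun_le (k : BohrGroup π hC) (v w : W) :
    dist (k.invFun v) (k.invFun w) ≤ C * dist v w := by
  refine denseRange_of.induction_on k ?_ fun g => ?_
  · exact isClosed_le ((continuous_invFun_apply _).dist (continuous_invFun_apply _))
      continuous_const
  · rw [dist_eq_norm, dist_eq_norm]
    change ‖π g⁻¹ v - π g⁻¹ w‖ ≤ _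
    rw [← map_sub]
    exact (π g⁻¹).le_of_opNorm_le (hC g⁻¹) _

theorem continuous_toFun (k : BohrGroup π hC) : Continuous k.toFun :=
  (LipschitzWith.of_dist_le' (dist_toFun_le k)).continuous

theorem continuous_invFun (k : BohrGroup π hC) : Continuous k.invFun :=
  (LipschitzWith.of_dist_le' (dist_invFun_le k)).continuous

/-- The maps are uniformly C-Lipschitz, which upgrades separate to joint continuity; the group
operations rely on it. -/
theorem continuous_uncurry_toFun :
    Continuous fun p : W × BohrGroup π hC => p.2.toFun p.1 :=
  continuous_prod_of_continuous_lipschitzWith _ C.toNNReal (fun v => continuous_toFun_apply v)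
    fun k => LipschitzWith.of_dist_le' (dist_toFun_le k)

theorem continuous_uncurry_invFun :
    Continuous fun p : W × BohrGroup π hC => p.2.invFun p.1 :=
  continuous_prod_of_continuous_lipschitzWith _ C.toNNReal (fun v => continuous_invFun_apply v)
    fun k => LipschitzWith.of_dist_le' (dist_invFun_le k)

theorem toFun_invFun (k : BohrGroup π hC) (v : W) : k.toFun (k.invFun v) = v := by
  refine denseRange_of.induction_on k ?_ fun g => rep_inv_apply π g v
  exact isClosed_eq (continuous_uncurry_toFun.comp
    ((continuous_invFun_apply v).prodMk continuous_id)) continuous_const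

theorem invFun_toFun (k : BohrGroup π hC) (v : W) : k.invFun (k.toFun v) = v := by
  refine denseRange_of.induction_on k ?_ fun g => ?_
  · exact isClosed_eq (continuous_uncurry_invFun.comp
      ((continuous_toFun_apply v).prodMk continuous_id)) continuous_const
  · have h := rep_inv_apply π g⁻¹ v
    rw [inv_inv] at h
    exact h

theorem mul_mem (k l : BohrGroup π hC) : (k.toFun ∘ l.toFun, l.invFun ∘ k.invFun) ∈
    closure (Set.range fun g : G => ((π g : W → W), (π g⁻¹ : W → W))) := by
  have h1 : ∀ g : G, ∀ l : BohrGroup π hC, (π g ∘ l.toFun, l.invFun ∘ π g⁻¹) ∈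
      closure (Set.range fun g : G => ((π g : W → W), (π g⁻¹ : W → W))) := by
    intro g l
    have hc : Continuous fun p : (W → W) × (W → W) => (π g ∘ p.1, p.2 ∘ π g⁻¹) := by
      refine Continuous.prodMk (continuous_pi fun v => ?_) (continuous_pi fun v => ?_)
      · exact (π g).continuous.comp ((continuous_apply v).comp continuous_fst)
      · exact (continuous_apply (π g⁻¹ v)).comp continuous_snd
    have h := map_mem_closure (t := Set.range fun g : G => ((π g : W → W), (π g⁻¹ : W → W)))
      hc l.2 (by
        rintro _ ⟨h, rfl⟩
        refine ⟨g * h, ?_⟩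
        simp only [mul_inv_rev, map_mul]
        rfl)
    exact h
  have hc : Continuous fun p : (W → W) × (W → W) => (p.1 ∘ l.toFun, l.invFun ∘ p.2) := by
    refine Continuous.prodMk (continuous_pi fun v => ?_) (continuous_pi fun v => ?_)
    · exact (continuous_apply (l.toFun v)).comp continuous_fst
    · exact l.continuous_invFun.comp ((continuous_apply v).comp continuous_snd)
  have h := map_mem_closure
    (t := closure (Set.range fun g : G => ((π g : W → W), (π g⁻¹ : W → W)))) hc k.2 (by
      rintro _ ⟨g, rfl⟩
      exact h1 g l)
  rw [closure_closure] at h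
  exact h

theorem inv_mem (k : BohrGroup π hC) : (k.invFun, k.toFun) ∈
    closure (Set.range fun g : G => ((π g : W → W), (π g⁻¹ : W → W))) := by
  have h := map_mem_closure (t := Set.range fun g : G => ((π g : W → W), (π g⁻¹ : W → W)))
    continuous_swap k.2 (by
      rintro _ ⟨g, rfl⟩
      exact ⟨g⁻¹, by simp⟩)
  exact h

instance : Group (BohrGroup π hC) where
  mul k l := ⟨_, mul_mem k l⟩
  one := of 1
  inv k := ⟨_, inv_mem k⟩
  mul_assoc k l m := rfl
  one_mul k := ext (by change π 1 ∘ k.toFun = _; rw [map_one]; rfl)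
    (by change k.invFun ∘ π 1⁻¹ = _; rw [inv_one, map_one]; rfl)
  mul_one k := ext (by change k.toFun ∘ π 1 = _; rw [map_one]; rfl)
    (by change π 1⁻¹ ∘ k.invFun = _; rw [inv_one, map_one]; rfl)
  inv_mul_cancel k := ext
    (by change k.invFun ∘ k.toFun = π 1; rw [map_one]; exact funext (invFun_toFun k))
    (by change k.invFun ∘ k.toFun = π 1⁻¹; rw [inv_one, map_one]; exact funext (invFun_toFun k))

instance : IsTopologicalGroup (BohrGroup π hC) where
  continuous_mul := continuous_iff.2
    ⟨fun v => continuous_uncurry_toFun.comp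
      (((continuous_toFun_apply v).comp continuous_snd).prodMk continuous_fst),
    fun v => continuous_uncurry_invFun.comp
      (((continuous_invFun_apply v).comp continuous_fst).prodMk continuous_snd)⟩
  continuous_inv := continuous_iff.2 ⟨continuous_invFun_apply, continuous_toFun_apply⟩

variable (π hC) in
/-- The canonical homomorphism to the Bohr group. -/
def ofHom : G →* BohrGroup π hC where
  toFun := of
  map_one' := rfl
  map_mul' g h := ext (by change ⇑(π (g * h)) = _; rw [map_mul]; rfl)
    (by change ⇑(π (g * h)⁻¹) = _; rw [mul_inv_rev, map_mul]; rfl)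

theorem continuous_ofHom [TopologicalSpace G] [ContinuousInv G]
    (h : ∀ v, Continuous fun g => π g v) : Continuous (ofHom π hC) :=
  continuous_iff.2 ⟨h, fun v => (h v).comp continuous_inv⟩

variable (π hC) in
/-- The representation of the Bohr group. -/
def rep : BohrGroup π hC →* (W →L[𝕜] W) where
  toFun k := LinearMap.mkContinuous
    { toFun := k.toFun
      map_add' := toFun_add k
      map_smul' := toFun_smul k } C (norm_toFun_le k)
  map_one' := by
    ext v
    change π 1 v = v
    rw [map_one]
    rfl
  map_mul' k l := rfl

theorem compactSpace (h : ∀ v, IsCompact (closure (Set.range fun g => π g v))) :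
    CompactSpace (BohrGroup π hC) := by
  refine isCompact_iff_compactSpace.1 (GModule.isCompact_of_subset_isCompact
    ((isCompact_univ_pi h).prod (isCompact_univ_pi h)) ?_)
  rintro _ ⟨g, rfl⟩
  exact ⟨fun v _ => subset_closure ⟨g, rfl⟩, fun v _ => subset_closure ⟨g⁻¹, rfl⟩⟩

theorem secondCountableTopology [CompactSpace (BohrGroup π hC)]
    [TopologicalSpace.SeparableSpace W] : SecondCountableTopology (BohrGroup π hC) := by
  have : SecondCountableTopology W := UniformSpace.secondCountable_of_separable W
  obtain ⟨d, hd⟩ := TopologicalSpace.exists_dense_seq W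
  let f : BohrGroup π hC → ℕ → W := fun k n => k.toFun (d n)
  have hf : Continuous f := continuous_pi fun n => continuous_toFun_apply (d n)
  have hinj : Function.Injective f := by
    intro k l hkl
    have h1 : k.toFun = l.toFun := hd.equalizer (continuous_toFun k) (continuous_toFun l) hkl
    refine ext h1 (funext fun v => ?_)
    rw [← invFun_toFun k (l.invFun v), h1, toFun_invFun]
  exact (hf.isClosedEmbedding hinj).isEmbedding.secondCountableTopology

end BohrGroup

end Bohr

/-! ### Compact self-adjoint operators -/

section Spectral

variable {𝕜 : Type*} [RCLike 𝕜] {H : Type*} [NormedAddCommGroup H] [InnerProductSpace 𝕜 H]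
  [CompleteSpace H]

/-- A vector orthogonal to the kernel of a compact self-adjoint operator is nearly contained in a
finite sum of eigenspaces. -/
theorem exists_finiteDimensional_invariant_near {T : H →L[𝕜] H} (hT : IsCompactOperator T)
    (hT' : T.toLinearMap.IsSymmetric) {f : H} (hf : ∀ h, T h = 0 → inner 𝕜 f h = 0) {ε : ℝ}
    (hε : 0 < ε) :
    ∃ E : Submodule 𝕜 H, ∃ _ : FiniteDimensional 𝕜 E,
      (∀ e ∈ E, ∃ h, T h = e) ∧
      (∀ A : H →L[𝕜] H, (∀ h, A (T h) = T (A h)) → ∀ e ∈ E, A e ∈ E) ∧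
      ‖f - E.starProjection f‖ < ε := by
  let eig : {c : 𝕜 // c ≠ 0} → Submodule 𝕜 H := fun c => Module.End.eigenspace T.toLinearMap c.1
  have heig : ∀ c e, e ∈ eig c ↔ T e = c.1 • e := fun c e => Module.End.mem_eigenspace_iff
  have hfd : ∀ c, FiniteDimensional 𝕜 (eig c) := fun c =>
    ContinuousLinearMap.finite_dimensional_eigenspace hT c.1 c.2
  -- If h is orthogonal to all nonzero eigenspaces, then T h is orthogonal to every eigenspace, so T
  -- h = 0 by the spectral theorem and f is orthogonal to h.
  have hmem : f ∈ (⨆ c, eig c).topologicalClosure := by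
    rw [← Submodule.orthogonal_orthogonal_eq_closure, Submodule.mem_orthogonal']
    intro h hh
    refine hf h ?_
    have h0 := ContinuousLinearMap.orthogonalComplement_iSup_eigenspaces_eq_bot hT hT'
    rw [← Submodule.mem_bot 𝕜, ← h0, ← Submodule.iInf_orthogonal, Submodule.mem_iInf]
    intro c e he
    rw [Module.End.mem_eigenspace_iff] at he
    change T e = c • e at he
    have h1 : inner 𝕜 e (T h) = inner 𝕜 (T e) h := (hT' e h).symm
    rw [h1, he, inner_smul_left]
    by_cases hc : c = 0
    · rw [hc, map_zero, zero_mul]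
    · have h2 : inner 𝕜 e h = 0 :=
        hh e (Submodule.mem_iSup_of_mem (⟨c, hc⟩ : {c : 𝕜 // c ≠ 0}) ((heig _ e).2 he))
      rw [h2, mul_zero]
  obtain ⟨e, he, hfe⟩ := Metric.mem_closure_iff.1 hmem ε hε
  obtain ⟨s, hs⟩ := Submodule.mem_iSup_iff_exists_finset.1 he
  let E : Submodule 𝕜 H := ⨆ c ∈ s, eig c
  have hE : FiniteDimensional 𝕜 E := Submodule.finiteDimensional_finset_sup s eig |> fun h => by
    rwa [Finset.sup_eq_iSup] at h
  refine ⟨E, hE, fun x hx => ?_, fun A hA x hx => ?_, ?_⟩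
  · have hle : E ≤ LinearMap.range T.toLinearMap := by
      refine iSup₂_le fun c _ x hx => ⟨c.1⁻¹ • x, ?_⟩
      change T (c.1⁻¹ • x) = x
      rw [map_smul, (heig c x).1 hx, smul_smul, inv_mul_cancel₀ c.2, one_smul]
    exact hle hx
  · have hle : E ≤ E.comap A.toLinearMap := by
      refine iSup₂_le fun c hc x hx => ?_
      refine Submodule.mem_iSup_of_mem c (Submodule.mem_iSup_of_mem hc ((heig c _).2 ?_))
      change T (A x) = c.1 • A x
      rw [← hA, (heig c x).1 hx, map_smul]
    exact hle hx
  · rw [dist_eq_norm] at hfe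
    have h1 := Submodule.starProjection_minimal (U := E) f
    rw [h1]
    exact lt_of_le_of_lt (ciInf_le ⟨0, by rintro _ ⟨x, rfl⟩; exact norm_nonneg _⟩ ⟨e, hs⟩) hfe

end Spectral

/-! ### Regular representations and convolution on a compact group -/

section CompactGroup

set_option linter.unusedSectionVars false

variable {K : Type*} [Group K] [TopologicalSpace K] [IsTopologicalGroup K] [CompactSpace K]
  [MeasurableSpace K] [BorelSpace K]

/-- Right translation by g is left translation by g after conjugation, and a continuous surjective
endomorphism preserves the finite Haar measure. -/
theorem isMulRightInvariant_of_compactSpace [T2Space K] [SecondCountableTopology K]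
    (μ : Measure K) [μ.IsHaarMeasure] : μ.IsMulRightInvariant := by
  refine ⟨fun g => ?_⟩
  have h1 : MeasurePreserving (MulAut.conj g⁻¹ : K → K) μ μ :=
    MonoidHom.measurePreserving (f := (MulAut.conj g⁻¹).toMonoidHom)
      (by change Continuous fun x => g⁻¹ * x * g⁻¹⁻¹; fun_prop) (MulAut.conj g⁻¹).surjective rfl
  have h2 := (measurePreserving_mul_left μ g).comp h1
  have h3 : ((g * ·) ∘ (MulAut.conj g⁻¹ : K → K)) = (· * g) := by
    funext x
    simp [mul_assoc]
  rw [h3] at h2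
  exact h2.map_eq

variable [SecondCountableTopology K] (𝕜 : Type*) [RCLike 𝕜] (μ : Measure K)

/-- The left regular representation on `L²`. -/
def leftRegular [μ.IsMulLeftInvariant] : K →* (Lp 𝕜 2 μ →L[𝕜] Lp 𝕜 2 μ) where
  toFun k := (Lp.compMeasurePreservingₗᵢ 𝕜 (k⁻¹ * ·)
    (measurePreserving_mul_left μ k⁻¹)).toContinuousLinearMap
  map_one' := by
    ext1 h
    refine Lp.ext ?_
    filter_upwards [Lp.coeFn_compMeasurePreserving h (measurePreserving_mul_left μ (1 : K)⁻¹)]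
      with x hx
    refine hx.trans ?_
    simp
  map_mul' k l := by
    ext1 h
    have h1 := Lp.compMeasurePreserving_comp_apply h (measurePreserving_mul_left μ l⁻¹)
      (measurePreserving_mul_left μ k⁻¹)
    refine Eq.trans ?_ h1
    refine Lp.ext ?_
    filter_upwards [Lp.coeFn_compMeasurePreserving h (measurePreserving_mul_left μ (k * l)⁻¹),
      Lp.coeFn_compMeasurePreserving h ((measurePreserving_mul_left μ l⁻¹).comp
        (measurePreserving_mul_left μ k⁻¹))] with x hx hx'
    refine hx.trans (Eq.trans ?_ hx'.symm)
    simp [mul_assoc]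

/-- The right regular representation on `L²`. -/
def rightRegular [μ.IsMulRightInvariant] : K →* (Lp 𝕜 2 μ →L[𝕜] Lp 𝕜 2 μ) where
  toFun k := (Lp.compMeasurePreservingₗᵢ 𝕜 (· * k)
    (measurePreserving_mul_right μ k)).toContinuousLinearMap
  map_one' := by
    ext1 h
    refine Lp.ext ?_
    filter_upwards [Lp.coeFn_compMeasurePreserving h (measurePreserving_mul_right μ (1 : K))]
      with x hx
    refine hx.trans ?_
    simp
  map_mul' k l := by
    ext1 h
    have h1 := Lp.compMeasurePreserving_comp_apply h (measurePreserving_mul_right μ l)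
      (measurePreserving_mul_right μ k)
    refine Eq.trans ?_ h1
    refine Lp.ext ?_
    filter_upwards [Lp.coeFn_compMeasurePreserving h (measurePreserving_mul_right μ (k * l)),
      Lp.coeFn_compMeasurePreserving h ((measurePreserving_mul_right μ l).comp
        (measurePreserving_mul_right μ k))] with x hx hx'
    refine hx.trans (Eq.trans ?_ hx'.symm)
    simp

variable {𝕜 μ}

theorem norm_leftRegular [μ.IsMulLeftInvariant] (k : K) (h : Lp 𝕜 2 μ) :
    ‖leftRegular 𝕜 μ k h‖ = ‖h‖ :=
  Lp.norm_compMeasurePreserving h (measurePreserving_mul_left μ k⁻¹)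

theorem norm_rightRegular [μ.IsMulRightInvariant] (k : K) (h : Lp 𝕜 2 μ) :
    ‖rightRegular 𝕜 μ k h‖ = ‖h‖ :=
  Lp.norm_compMeasurePreserving h (measurePreserving_mul_right μ k)

theorem leftRegular_toLp [IsFiniteMeasure μ] [μ.IsMulLeftInvariant] (k : K) (f : C(K, 𝕜)) :
    leftRegular 𝕜 μ k (ContinuousMap.toLp 2 μ 𝕜 f) =
      ContinuousMap.toLp 2 μ 𝕜 (f.comp ⟨fun x => k⁻¹ * x, continuous_const_mul k⁻¹⟩) := by
  rfl

theorem rightRegular_toLp [IsFiniteMeasure μ] [μ.IsMulRightInvariant] (k : K) (f : C(K, 𝕜)) :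
    rightRegular 𝕜 μ k (ContinuousMap.toLp 2 μ 𝕜 f) =
      ContinuousMap.toLp 2 μ 𝕜 (f.comp ⟨fun x => x * k, continuous_mul_const k⟩) := by
  rfl

theorem leftRegular_rightRegular [μ.IsMulLeftInvariant] [μ.IsMulRightInvariant] (k l : K)
    (h : Lp 𝕜 2 μ) : leftRegular 𝕜 μ k (rightRegular 𝕜 μ l h) =
      rightRegular 𝕜 μ l (leftRegular 𝕜 μ k h) := by
  have h1 := Lp.compMeasurePreserving_comp_apply h (measurePreserving_mul_right μ l)
    (measurePreserving_mul_left μ k⁻¹)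
  have h2 := Lp.compMeasurePreserving_comp_apply h (measurePreserving_mul_left μ k⁻¹)
    (measurePreserving_mul_right μ l)
  refine Eq.trans h1.symm (Eq.trans ?_ h2)
  refine Lp.ext ?_
  filter_upwards [Lp.coeFn_compMeasurePreserving h ((measurePreserving_mul_right μ l).comp
        (measurePreserving_mul_left μ k⁻¹)),
    Lp.coeFn_compMeasurePreserving h ((measurePreserving_mul_left μ k⁻¹).comp
        (measurePreserving_mul_right μ l))] with x hx hx'
  refine hx.trans (Eq.trans ?_ hx'.symm)
  simp [mul_assoc]

theorem continuous_leftRegular [T2Space K] [IsFiniteMeasure μ] [μ.IsMulLeftInvariant] (h : Lp 𝕜 2 μ) :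
    Continuous fun k => leftRegular 𝕜 μ k h := by
  let g : C(K, C(K, K)) := ContinuousMap.curry ⟨fun p : K × K => p.1⁻¹ * p.2, by fun_prop⟩
  exact Continuous.compMeasurePreservingLp (f := fun _ : K => h) (g := g) continuous_const
    g.continuous (fun k => measurePreserving_mul_left μ k⁻¹) (by simp)

/-- Convolution: `(f * h)(x) = ⟨U x f, h⟩`. -/
def convolve [T2Space K] [IsFiniteMeasure μ] [μ.IsMulLeftInvariant] (f : Lp 𝕜 2 μ) :
    Lp 𝕜 2 μ →L[𝕜] C(K, 𝕜) :=
  LinearMap.mkContinuous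
    { toFun := fun h => ⟨fun x => inner 𝕜 (leftRegular 𝕜 μ x f) h,
        (continuous_leftRegular f).inner continuous_const⟩
      map_add' := fun h h' => ContinuousMap.ext fun x => by
        simp [inner_add_right]
      map_smul' := fun c h => ContinuousMap.ext fun x => by
        simp [inner_smul_right] } ‖f‖ fun h => by
    refine (ContinuousMap.norm_le _ (by positivity)).2 fun x => ?_
    have h1 := norm_inner_le_norm (𝕜 := 𝕜) (leftRegular 𝕜 μ x f) h
    rwa [norm_leftRegular] at h1

theorem convolve_apply [T2Space K] [IsFiniteMeasure μ] [μ.IsMulLeftInvariant] (f h : Lp 𝕜 2 μ) (x : K) :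
    convolve f h x = inner 𝕜 (leftRegular 𝕜 μ x f) h := by
  rfl

/-- Arzelà–Ascoli: continuity of x ↦ U(x)f in L² gives equicontinuity on the unit ball. -/
theorem isCompactOperator_toLp_comp_convolve [T2Space K] [IsFiniteMeasure μ] [μ.IsMulLeftInvariant]
    (f : Lp 𝕜 2 μ) :
    IsCompactOperator ((ContinuousMap.toLp 2 μ 𝕜).comp (convolve f)) := by
  let A : Set (BoundedContinuousFunction K 𝕜) :=
    (fun h => BoundedContinuousFunction.mkOfCompact (convolve f h)) '' Metric.closedBall 0 1
  have hA : IsCompact (closure A) := by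
    refine BoundedContinuousFunction.arzela_ascoli (Metric.closedBall 0 ‖f‖)
      (isCompact_closedBall _ _) A ?_ ?_
    · rintro _ x ⟨h, hh, rfl⟩
      rw [mem_closedBall_zero_iff] at hh ⊢
      have h1 := norm_inner_le_norm (𝕜 := 𝕜) (leftRegular 𝕜 μ x f) h
      rw [norm_leftRegular] at h1
      exact h1.trans (mul_le_of_le_one_right (norm_nonneg _) hh)
    · intro x
      rw [Metric.equicontinuousAt_iff_right]
      intro ε hε
      filter_upwards [Metric.continuous_iff'.1 (continuous_leftRegular f) x ε hε] with y hy
      rintro ⟨_, h, hh, rfl⟩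
      rw [mem_closedBall_zero_iff] at hh
      rw [dist_comm, dist_eq_norm] at hy
      rw [dist_eq_norm]
      change ‖convolve f h x - convolve f h y‖ < ε
      rw [convolve_apply, convolve_apply, ← inner_sub_left]
      exact (norm_inner_le_norm _ _).trans_lt
        ((mul_le_of_le_one_right (norm_nonneg _) hh).trans_lt hy)
  refine (isCompactOperator_iff_image_closedBall_subset_compact _ one_pos).2
    ⟨_, hA.image (BoundedContinuousFunction.toLp 2 μ 𝕜).continuous, ?_⟩
  rintro _ ⟨h, hh, rfl⟩
  exact ⟨_, subset_closure ⟨h, hh, rfl⟩, rfl⟩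

end CompactGroup

section CompactGroup

set_option linter.unusedSectionVars false

variable {K : Type*} [Group K] [TopologicalSpace K] [IsTopologicalGroup K] [CompactSpace K]
  [T2Space K] [SecondCountableTopology K] [MeasurableSpace K] [BorelSpace K]
  {𝕜 : Type*} [RCLike 𝕜] {μ : Measure K} [IsFiniteMeasure μ] [μ.IsMulLeftInvariant]

theorem inner_leftRegular (k : K) (x y : Lp 𝕜 2 μ) :
    inner 𝕜 x (leftRegular 𝕜 μ k y) = inner 𝕜 (leftRegular 𝕜 μ k⁻¹ x) y :=
  inner_rep_apply (U := leftRegular 𝕜 μ) (fun k h => norm_leftRegular k h) k x y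

theorem inner_rightRegular [μ.IsMulRightInvariant] (k : K) (x y : Lp 𝕜 2 μ) :
    inner 𝕜 x (rightRegular 𝕜 μ k y) = inner 𝕜 (rightRegular 𝕜 μ k⁻¹ x) y :=
  inner_rep_apply (U := rightRegular 𝕜 μ) (fun k h => norm_rightRegular k h) k x y

theorem toLp_convolve_leftRegular (f h : Lp 𝕜 2 μ) (k : K) :
    leftRegular 𝕜 μ k (ContinuousMap.toLp 2 μ 𝕜 (convolve f h)) =
      ContinuousMap.toLp 2 μ 𝕜 (convolve f (leftRegular 𝕜 μ k h)) := by
  rw [leftRegular_toLp]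
  congr 1
  ext x
  rw [convolve_apply, inner_leftRegular, ← mul_apply_eq_comp, ← map_mul]
  rfl

theorem toLp_convolve_rightRegular [μ.IsMulRightInvariant] {f : Lp 𝕜 2 μ}
    (hf : ∀ k, leftRegular 𝕜 μ k f = rightRegular 𝕜 μ k⁻¹ f) (h : Lp 𝕜 2 μ) (k : K) :
    rightRegular 𝕜 μ k (ContinuousMap.toLp 2 μ 𝕜 (convolve f h)) =
      ContinuousMap.toLp 2 μ 𝕜 (convolve f (rightRegular 𝕜 μ k h)) := by
  rw [rightRegular_toLp]
  congr 1
  ext x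
  rw [convolve_apply, inner_rightRegular, ← leftRegular_rightRegular, ← hf,
    ← mul_apply_eq_comp, ← map_mul]
  rfl

theorem inner_toLp_convolve (f : C(K, 𝕜)) (h h' : Lp 𝕜 2 μ) :
    inner 𝕜 h' (ContinuousMap.toLp 2 μ 𝕜 (convolve (ContinuousMap.toLp 2 μ 𝕜 f) h)) =
      ∫ x, ∫ y, starRingEnd 𝕜 (h' x) * h y * starRingEnd 𝕜 (f (x⁻¹ * y)) ∂μ ∂μ := by
  rw [L2.inner_def]
  refine integral_congr_ae ?_
  filter_upwards [ContinuousMap.coeFn_toLp (p := 2) (𝕜 := 𝕜) μ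
    (convolve (ContinuousMap.toLp 2 μ 𝕜 f) h)] with x hx
  rw [hx, convolve_apply, L2.inner_def, RCLike.inner_apply', ← integral_const_mul]
  refine integral_congr_ae ?_
  rw [leftRegular_toLp]
  filter_upwards [ContinuousMap.coeFn_toLp (p := 2) (𝕜 := 𝕜) μ
    (f.comp ⟨fun y => x⁻¹ * y, continuous_const_mul x⁻¹⟩)] with y hy
  rw [hy, RCLike.inner_apply']
  change starRingEnd 𝕜 (h' x) * (starRingEnd 𝕜 (f (x⁻¹ * y)) * h y) = _
  ring

theorem isSymmetric_toLp_comp_convolve {f : C(K, 𝕜)} (hf : ∀ k, f k⁻¹ = f k)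
    (hconj : ∀ k, starRingEnd 𝕜 (f k) = f k) :
    ((ContinuousMap.toLp 2 μ 𝕜).comp
      (convolve (ContinuousMap.toLp 2 μ 𝕜 f))).toLinearMap.IsSymmetric := by
  intro h h'
  change inner 𝕜 (ContinuousMap.toLp 2 μ 𝕜 (convolve (ContinuousMap.toLp 2 μ 𝕜 f) h)) h' =
    inner 𝕜 h (ContinuousMap.toLp 2 μ 𝕜 (convolve (ContinuousMap.toLp 2 μ 𝕜 f) h'))
  rw [← inner_conj_symm, inner_toLp_convolve, inner_toLp_convolve, ← integral_conj]
  have hint : Integrable (Function.uncurry fun x y =>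
      h' x * starRingEnd 𝕜 (h y) * f (x⁻¹ * y)) (μ.prod μ) := by
    have h1 : Integrable (fun p : K × K => h' p.1 * starRingEnd 𝕜 (h p.2)) (μ.prod μ) := by
      have h2 : Integrable (fun y => starRingEnd 𝕜 (h y)) μ :=
        ((RCLike.conjCLE (K := 𝕜)).toContinuousLinearMap).integrable_comp
          ((Lp.memLp h).integrable (by norm_num))
      exact Integrable.mul_prod ((Lp.memLp h').integrable (by norm_num)) h2
    refine h1.mul_bdd (c := ‖f‖) ?_ ?_
    · exact (f.continuous.comp (by fun_prop)).aestronglyMeasurable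
    · exact Eventually.of_forall fun p => f.norm_coe_le_norm _
  calc ∫ x, starRingEnd 𝕜 (∫ y, starRingEnd 𝕜 (h' x) * h y * starRingEnd 𝕜 (f (x⁻¹ * y)) ∂μ) ∂μ
      = ∫ x, ∫ y, h' x * starRingEnd 𝕜 (h y) * f (x⁻¹ * y) ∂μ ∂μ := by
        refine integral_congr_ae (Eventually.of_forall fun x => ?_)
        simp only [← integral_conj, map_mul, RCLike.conj_conj]
    _ = ∫ y, ∫ x, h' x * starRingEnd 𝕜 (h y) * f (x⁻¹ * y) ∂μ ∂μ := integral_integral_swap hint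
    _ = _ := by
        refine integral_congr_ae (Eventually.of_forall fun x => ?_)
        refine integral_congr_ae (Eventually.of_forall fun y => ?_)
        have h1 : f (y⁻¹ * x) = f (x⁻¹ * y) := by rw [← hf]; congr 1; group
        simp only [hconj, h1]
        ring

/-- Convolution by f is compact, self-adjoint and commutes with both translations; f is orthogonal
to its kernel because (f * h)(1) = ⟨f, h⟩. A left-invariant e in E has constant convolution; as f
has mean 0 constants are annihilated, which forces T e = 0 and, E lying in the range of T, e = 0. -/
theorem exists_invariant_subspace_near [μ.IsMulRightInvariant] [μ.IsOpenPosMeasure]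
    {f : C(K, 𝕜)} (hf : ∀ k, f k⁻¹ = f k) (hconj : ∀ k, starRingEnd 𝕜 (f k) = f k)
    (hcl : ∀ k, leftRegular 𝕜 μ k (ContinuousMap.toLp 2 μ 𝕜 f) =
      rightRegular 𝕜 μ k⁻¹ (ContinuousMap.toLp 2 μ 𝕜 f))
    (hint : ∫ k, f k ∂μ = 0) {ε : ℝ} (hε : 0 < ε) :
    ∃ E : Submodule 𝕜 (Lp 𝕜 2 μ), ∃ _ : FiniteDimensional 𝕜 E,
      (∀ k, ∀ e ∈ E, leftRegular 𝕜 μ k e ∈ E) ∧ (∀ k, ∀ e ∈ E, rightRegular 𝕜 μ k e ∈ E) ∧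
      (∀ s : Set K, Dense s → ∀ e ∈ E, (∀ k ∈ s, leftRegular 𝕜 μ k e = e) → e = 0) ∧
      ‖ContinuousMap.toLp 2 μ 𝕜 f - E.starProjection (ContinuousMap.toLp 2 μ 𝕜 f)‖ < ε := by
  set f' := ContinuousMap.toLp 2 μ 𝕜 f
  let T := (ContinuousMap.toLp 2 μ 𝕜).comp (convolve f')
  have hTs : T.toLinearMap.IsSymmetric := isSymmetric_toLp_comp_convolve hf hconj
  have hker : ∀ h, T h = 0 → convolve f' h = 0 := fun h hh =>
    ContinuousMap.toLp_injective (𝕜 := 𝕜) (p := 2) μ (hh.trans (map_zero _).symm)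
  obtain ⟨E, hE, hrange, hcomm, hnear⟩ := exists_finiteDimensional_invariant_near
    (isCompactOperator_toLp_comp_convolve f') hTs (f := f') (fun h hh => by
      have h1 := congrArg (fun c : C(K, 𝕜) => c 1) (hker h hh)
      change inner 𝕜 (leftRegular 𝕜 μ 1 f') h = 0 at h1
      rwa [map_one] at h1) hε
  refine ⟨E, hE, fun k => hcomm _ fun h => toLp_convolve_leftRegular f' h k,
    fun k => hcomm _ fun h => toLp_convolve_rightRegular hcl h k, fun s hs e he hfix => ?_, hnear⟩
  have h1 : ∀ x, convolve f' e x = convolve f' e 1 := by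
    have h2 : (fun x => convolve f' e x) = fun _ => convolve f' e 1 := by
      have h3 : Dense (s⁻¹) := hs.preimage (isOpenMap_inv K)
      refine (convolve f' e).continuous.ext_on h3 continuous_const fun x hx => ?_
      rw [convolve_apply, convolve_apply, map_one]
      have h4 := inner_leftRegular x⁻¹ f' e
      rw [inv_inv, hfix _ hx] at h4
      exact h4.symm
    exact fun x => congrFun h2 x
  let one : Lp 𝕜 2 μ := ContinuousMap.toLp 2 μ 𝕜 1
  have hone : T one = 0 := by
    have h2 : convolve f' one = 0 := by
      ext x
      rw [convolve_apply, ← inv_inv x, ← inner_leftRegular, leftRegular_toLp,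
        ContinuousMap.inner_toLp]
      simpa [hconj] using hint
    change ContinuousMap.toLp 2 μ 𝕜 (convolve f' one) = 0
    rw [h2, map_zero]
  have hTe : T e = convolve f' e 1 • one := by
    change ContinuousMap.toLp 2 μ 𝕜 (convolve f' e) = _
    rw [← map_smul]
    congr 1
    ext x
    simp [h1 x]
  have h0 : T e = 0 := by
    rw [← inner_self_eq_zero (𝕜 := 𝕜)]
    nth_rewrite 1 [hTe]
    have h2 : inner 𝕜 one (T e) = inner 𝕜 (T one) e := (hTs one e).symm
    rw [inner_smul_left, h2, hone, inner_zero_left, mul_zero]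
  obtain ⟨h, hh⟩ := hrange e he
  rw [← inner_self_eq_zero (𝕜 := 𝕜)]
  nth_rewrite 1 [← hh]
  have h2 : inner 𝕜 (T h) e = inner 𝕜 h (T e) := hTs h e
  exact h2.trans (by rw [h0, inner_zero_right])

variable [μ.IsOpenPosMeasure] {W : Type*} [NormedAddCommGroup W] [NormedSpace 𝕜 W]

/-- The supremum over x in K and v in Q of ‖ρ(xkx⁻¹)v − v‖ is continuous and conjugation invariant
in k. Cut it off at ε, multiply by the value at k⁻¹ for symmetry, and normalise. -/
theorem exists_bump_class_function {ρ : K →* (W →L[𝕜] W)} {C : ℝ} (hC : ∀ k, ‖ρ k‖ ≤ C)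
    (hρ : ∀ v, Continuous fun k => ρ k v) {Q : Set W} (hQ : IsCompact Q) {ε : ℝ} (hε : 0 < ε) :
    ∃ F : C(K, ℝ), (∀ k, 0 ≤ F k) ∧ (∀ k, F k⁻¹ = F k) ∧ (∀ k l, F (k * l) = F (l * k)) ∧
      ∫ k, F k ∂μ = 1 ∧ ∀ k, F k ≠ 0 → ∀ v ∈ Q, ‖ρ k⁻¹ v - v‖ ≤ ε := by
  have : CompactSpace Q := isCompact_iff_compactSpace.1 hQ
  have hjoint : Continuous fun p : W × K => ρ p.2 p.1 :=
    continuous_prod_of_continuous_lipschitzWith _ C.toNNReal hρ fun k =>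
      LipschitzWith.of_dist_le' fun v w => by
        rw [dist_eq_norm, dist_eq_norm, ← map_sub]
        exact (ρ k).le_of_opNorm_le (hC k) _
  let Ψ : C(K, C(K × Q, W)) := ContinuousMap.curry
    ⟨fun p : K × (K × Q) => ρ (p.2.1 * p.1 * p.2.1⁻¹) p.2.2 - p.2.2,
      (hjoint.comp (f := fun p : K × (K × Q) => ((p.2.2 : W), p.2.1 * p.1 * p.2.1⁻¹))
        (by fun_prop)).sub (by fun_prop)⟩
  have hΨ : ∀ k x v, Ψ k (x, v) = ρ (x * k * x⁻¹) v - v := fun k x v => rfl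
  have hle : ∀ k l, ‖Ψ (l * k * l⁻¹)‖ ≤ ‖Ψ k‖ := by
    intro k l
    refine (ContinuousMap.norm_le _ (norm_nonneg _)).2 fun ⟨x, v⟩ => ?_
    have h1 : Ψ (l * k * l⁻¹) (x, v) = Ψ k (x * l, v) := by
      rw [hΨ, hΨ]
      congr 3
      group
    rw [h1]
    exact (Ψ k).norm_coe_le_norm _
  have heq : ∀ k l, ‖Ψ (k * l)‖ = ‖Ψ (l * k)‖ := by
    intro k l
    have h1 := hle (k * l) l
    have h2 := hle (l * k) k
    rw [show l * (k * l) * l⁻¹ = l * k by group] at h1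
    rw [show k * (l * k) * k⁻¹ = k * l by group] at h2
    exact le_antisymm h2 h1
  let b : K → ℝ := fun k => max 0 (1 - ‖Ψ k‖ / ε)
  have hb : Continuous b := by fun_prop
  let F₀ : C(K, ℝ) := ⟨fun k => b k * b k⁻¹, hb.mul (hb.comp continuous_inv)⟩
  have hF₀ : ∀ k, 0 ≤ F₀ k := fun k => mul_nonneg (le_max_left _ _) (le_max_left _ _)
  have hcl : ∀ k l, b (k * l) = b (l * k) := fun k l => by simp only [b, heq k l]
  have hF₀1 : F₀ 1 ≠ 0 := by
    have h1 : Ψ 1 = 0 := by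
      ext ⟨x, v⟩
      rw [hΨ, mul_one, mul_inv_cancel, map_one]
      exact sub_self _
    have h2 : b 1 = 1 := by simp [b, h1]
    change b 1 * b 1⁻¹ ≠ 0
    rw [inv_one, h2]
    norm_num
  have hpos : 0 < ∫ k, F₀ k ∂μ :=
    F₀.continuous.integral_pos_of_hasCompactSupport_nonneg_nonzero
      (HasCompactSupport.of_compactSpace _) hF₀ hF₀1
  refine ⟨(∫ k, F₀ k ∂μ)⁻¹ • F₀, fun k => ?_, fun k => ?_, fun k l => ?_, ?_, fun k hk v hv => ?_⟩
  · exact mul_nonneg (inv_nonneg.2 hpos.le) (hF₀ k)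
  · change _ * (b k⁻¹ * b k⁻¹⁻¹) = _ * (b k * b k⁻¹)
    rw [inv_inv, mul_comm (b k)]
  · change _ * (b (k * l) * b (k * l)⁻¹) = _ * (b (l * k) * b (l * k)⁻¹)
    rw [mul_inv_rev, mul_inv_rev, hcl k l, hcl l⁻¹ k⁻¹]
  · change ∫ k, (∫ k, F₀ k ∂μ)⁻¹ * F₀ k ∂μ = 1
    rw [integral_const_mul, inv_mul_cancel₀ hpos.ne']
  · have h1 : b k⁻¹ ≠ 0 := by
      intro h
      apply hk
      change _ * (b k * b k⁻¹) = 0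
      rw [h, mul_zero, mul_zero]
    have h2 : ‖Ψ k⁻¹‖ ≤ ε := by
      by_contra! h
      apply h1
      refine max_eq_left ?_
      rw [sub_nonpos, one_le_div hε]
      exact h.le
    have h3 := ((Ψ k⁻¹).norm_coe_le_norm (1, ⟨v, hv⟩)).trans h2
    rwa [hΨ, one_mul, inv_one, mul_one] at h3

end CompactGroup

/-! ### Matrix coefficients and approximation of cocycles -/

section CompactGroup

set_option linter.unusedSectionVars false

variable {K : Type*} [Group K] [TopologicalSpace K] [IsTopologicalGroup K] [CompactSpace K]
  {𝕜 : Type*} [RCLike 𝕜] {W : Type*} [NormedAddCommGroup W] [NormedSpace 𝕜 W]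
  {ρ : K →* (W →L[𝕜] W)} (hρ : ∀ v, Continuous fun k => ρ k v)

/-- The matrix coefficient `y ↦ φ (y⁻¹ v)`. -/
def matrixCoeff (φ : StrongDual 𝕜 W) : W →ₗ[𝕜] C(K, 𝕜) where
  toFun v := ⟨fun y => φ (ρ y⁻¹ v), φ.continuous.comp ((hρ v).comp continuous_inv)⟩
  map_add' v w := ContinuousMap.ext fun y => by simp
  map_smul' c v := ContinuousMap.ext fun y => by simp

theorem matrixCoeff_apply (φ : StrongDual 𝕜 W) (v : W) (y : K) :
    matrixCoeff hρ φ v y = φ (ρ y⁻¹ v) := rfl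

theorem norm_matrixCoeff_le {C : ℝ} (hC : ∀ k, ‖ρ k‖ ≤ C) (φ : StrongDual 𝕜 W) (v : W) :
    ‖matrixCoeff hρ φ v‖ ≤ ‖φ‖ * (C * ‖v‖) := by
  have hC0 : 0 ≤ C := (norm_nonneg _).trans (hC 1)
  refine (ContinuousMap.norm_le _ (by positivity)).2 fun y => ?_
  exact φ.le_opNorm_of_le ((ρ y⁻¹).le_of_opNorm_le (hC _) v)

variable [T2Space K] [SecondCountableTopology K] [MeasurableSpace K] [BorelSpace K]
  {μ : Measure K} [IsProbabilityMeasure μ] [μ.IsMulLeftInvariant] [μ.IsMulRightInvariant]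

theorem toLp_matrixCoeff_rep (φ : StrongDual 𝕜 W) (k : K) (v : W) :
    ContinuousMap.toLp 2 μ 𝕜 (matrixCoeff hρ φ (ρ k v)) =
      leftRegular 𝕜 μ k (ContinuousMap.toLp 2 μ 𝕜 (matrixCoeff hρ φ v)) := by
  rw [leftRegular_toLp]
  congr 1
  ext y
  rw [matrixCoeff_apply, ← mul_apply_eq_comp, ← map_mul]
  change _ = φ (ρ (k⁻¹ * y)⁻¹ v)
  rw [mul_inv_rev, inv_inv]

theorem toLp_matrixCoeff_comp (φ : StrongDual 𝕜 W) (k : K) (v : W) :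
    ContinuousMap.toLp 2 μ 𝕜 (matrixCoeff hρ (φ.comp (ρ k)) v) =
      rightRegular 𝕜 μ k⁻¹ (ContinuousMap.toLp 2 μ 𝕜 (matrixCoeff hρ φ v)) := by
  rw [rightRegular_toLp]
  congr 1
  ext y
  rw [matrixCoeff_apply, ContinuousLinearMap.comp_apply, ← mul_apply_eq_comp, ← map_mul]
  change _ = φ (ρ (y * k⁻¹)⁻¹ v)
  rw [mul_inv_rev, inv_inv]

theorem norm_toLp_le_norm (p : ENNReal) [Fact (1 ≤ p)] (f : C(K, 𝕜)) :
    ‖ContinuousMap.toLp p μ 𝕜 f‖ ≤ ‖f‖ := by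
  have h1 : ‖(ContinuousMap.toLp p μ 𝕜 : C(K, 𝕜) →L[𝕜] Lp 𝕜 p μ)‖ ≤ 1 := by
    refine (ContinuousMap.toLp_norm_le μ).trans ?_
    have h2 : measureUnivNNReal μ = 1 := by
      ext
      simp [measureUnivNNReal]
    rw [h2, NNReal.coe_one, Real.one_rpow]
  have h2 := (ContinuousMap.toLp p μ 𝕜 : C(K, 𝕜) →L[𝕜] Lp 𝕜 p μ).le_of_opNorm_le h1 f
  rwa [one_mul] at h2

theorem exists_vector_integral [CompleteSpace W] (h : Lp 𝕜 2 μ) (v : W) :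
    ∃ w, ∀ φ, φ w = inner 𝕜 h (ContinuousMap.toLp 2 μ 𝕜 (matrixCoeff hρ φ v)) := by
  let _ : NormedSpace ℝ W := NormedSpace.restrictScalars ℝ 𝕜 W
  have hcont : Continuous fun y => ρ y⁻¹ v := (hρ v).comp continuous_inv
  have hint : Integrable (fun y => starRingEnd 𝕜 (h y) • ρ y⁻¹ v) μ := by
    have h2 : Integrable (fun y => starRingEnd 𝕜 (h y)) μ :=
      ((RCLike.conjCLE (K := 𝕜)).toContinuousLinearMap).integrable_comp
        ((Lp.memLp h).integrable (by norm_num))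
    obtain ⟨c, hc⟩ := isCompact_univ.exists_bound_of_continuousOn hcont.continuousOn
    exact h2.smul_bdd c hcont.aestronglyMeasurable (Eventually.of_forall fun y => hc y trivial)
  refine ⟨∫ y, starRingEnd 𝕜 (h y) • ρ y⁻¹ v ∂μ, fun φ => ?_⟩
  rw [← ContinuousLinearMap.integral_comp_comm φ hint, L2.inner_def]
  refine integral_congr_ae ?_
  filter_upwards [ContinuousMap.coeFn_toLp (p := 2) (𝕜 := 𝕜) μ (matrixCoeff hρ φ v)] with y hy
  rw [hy, RCLike.inner_apply', map_smul]
  rfl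

/-- The average of y⁻¹v over K is a fixed vector, hence 0. -/
theorem integral_matrixCoeff_eq_zero [CompleteSpace W] (hfix : ∀ v, (∀ k, ρ k v = v) → v = 0)
    (φ : StrongDual 𝕜 W) (v : W) : ∫ y, matrixCoeff hρ φ v y ∂μ = 0 := by
  let one : Lp 𝕜 2 μ := ContinuousMap.toLp 2 μ 𝕜 1
  obtain ⟨w, hw⟩ := exists_vector_integral hρ (μ := μ) one v
  have hw0 : w = 0 := by
    refine hfix w fun k => (SeparatingDual.eq_iff_forall_dual_eq (R := 𝕜)).2 fun φ => ?_
    have h1 : φ (ρ k w) = (φ.comp (ρ k)) w := rfl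
    rw [h1, hw, toLp_matrixCoeff_comp, inner_rightRegular, rightRegular_toLp, hw]
    rfl
  have h1 := hw φ
  rw [hw0, map_zero, ContinuousMap.inner_toLp] at h1
  simpa using h1.symm

variable [μ.IsOpenPosMeasure]

theorem exists_near_coboundary_of_sublinear [CompleteSpace W] {C : ℝ} (hC : ∀ k, ‖ρ k‖ ≤ C)
    (hfix : ∀ v, (∀ k, ρ k v = v) → v = 0) {G : Type*} [Group G] {ι : G →* K} (hι : DenseRange ι)
    {b : G → W} (hb : ∀ g h, b (g * h) = ρ (ι g) (b h) + b g)
    {L : G → ℕ} (hL : ∀ g h, L (g * h) ≤ L g + L h)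
    (hsub : ∀ φ, ∀ η > 0, ∃ B : ℝ, ∀ g,
      ‖ContinuousMap.toLp 2 μ 𝕜 (matrixCoeff hρ φ (b g))‖ ≤ η * L g + B)
    {Q : Set W} (hQ : IsCompact Q) {ε : ℝ} (hε : 0 < ε) :
    ∃ u, ∀ g, b g ∈ Q → ‖b g - (u - ρ (ι g) u)‖ < ε := by
  have hC0 : 0 ≤ C := (norm_nonneg _).trans (hC 1)
  obtain ⟨M, hM⟩ := hQ.isBounded.exists_norm_le
  have hM' : ∀ v ∈ Q, ‖v‖ ≤ |M| := fun v hv => (hM v hv).trans (le_abs_self M)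
  obtain ⟨F, hF0, hFinv, hFcl, hFint, hFQ⟩ :=
    exists_bump_class_function (μ := μ) hC hρ hQ (ε := ε / 3) (by positivity)
  -- Subtracting 1 gives f mean 0 and does not change the averaging operator, since the average of
  -- y⁻¹v vanishes.
  let f : C(K, 𝕜) := ⟨fun k => (F k : 𝕜) - 1, by fun_prop⟩
  have hf : ∀ k, f k = (F k : 𝕜) - 1 := fun k => rfl
  have hFi : Integrable (fun k => (F k : 𝕜)) μ :=
    (Continuous.integrable_of_hasCompactSupport (by fun_prop) (HasCompactSupport.of_compactSpace _))
  have hconj : ∀ k, starRingEnd 𝕜 (f k) = f k := fun k => by simp [hf]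
  have hcl : ∀ k, leftRegular 𝕜 μ k (ContinuousMap.toLp 2 μ 𝕜 f) =
      rightRegular 𝕜 μ k⁻¹ (ContinuousMap.toLp 2 μ 𝕜 f) := by
    intro k
    rw [leftRegular_toLp, rightRegular_toLp]
    congr 1
    ext y
    change ((F (k⁻¹ * y) : ℝ) : 𝕜) - 1 = ((F (y * k⁻¹) : ℝ) : 𝕜) - 1
    rw [hFcl]
  have hint : ∫ k, f k ∂μ = 0 := by
    simp only [hf]
    rw [integral_sub hFi (integrable_const _), integral_ofReal, hFint]
    simp
  -- Coefficients of vectors in Q have L² norm at most ‖φ‖ C |M|, so replacing f by its projection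
  -- costs at most ε/3.
  obtain ⟨E, _, hEU, hER, hEfix, hnear⟩ := exists_invariant_subspace_near (μ := μ) (f := f)
    (fun k => by rw [hf, hf, hFinv]) hconj hcl hint (ε := ε / (3 * (C * |M| + 1))) (by positivity)
  choose A hA using fun (h : Lp 𝕜 2 μ) (v : W) => exists_vector_integral hρ h v
  set f' := ContinuousMap.toLp 2 μ 𝕜 f
  obtain ⟨u, hu⟩ := exists_eq_coboundary_of_coefficients (𝕜 := 𝕜) (π := ρ.comp ι)
    (U := (leftRegular 𝕜 μ).comp ι) (R := (rightRegular 𝕜 μ).comp ι)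
    (fun g h => norm_leftRegular _ h) (fun g h => norm_rightRegular _ h)
    (fun g g' h => leftRegular_rightRegular _ _ h)
    (Φ := fun φ => (ContinuousMap.toLp 2 μ 𝕜).toLinearMap ∘ₗ matrixCoeff hρ φ) (A := A)
    (fun φ h v => hA h v φ) (fun φ g v => toLp_matrixCoeff_rep hρ φ (ι g) v)
    (fun φ g v => by
      have h1 := toLp_matrixCoeff_comp hρ (μ := μ) φ (ι g) v
      rw [← map_inv] at h1
      exact h1) E (fun g => hEU (ι g)) (fun g => hER (ι g))
    (fun e he hfix => hEfix _ hι e he (by rintro _ ⟨g, rfl⟩; exact hfix g)) (f := f')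
    (fun g h => by
      change inner 𝕜 f' (leftRegular 𝕜 μ (ι g) h) = inner 𝕜 f' (rightRegular 𝕜 μ (ι g⁻¹) h)
      rw [inner_leftRegular, inner_rightRegular, hcl, map_inv ι])
    hb hL hsub
  refine ⟨u, fun g hg => ?_⟩
  have hu' : A (E.starProjection f') (b g) = u - ρ (ι g) u := hu g
  rw [← hu', norm_sub_rev]
  set v := b g
  have hcoef : ∀ φ : StrongDual 𝕜 W, ‖φ (A f' v - v)‖ ≤ ε / 3 * ‖φ‖ := by
    intro φ
    have h1 : φ (A f' v - v) = ∫ y, (F y : 𝕜) * (matrixCoeff hρ φ v y - φ v) ∂μ := by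
      have hci : Integrable (fun y => (F y : 𝕜) * matrixCoeff hρ φ v y) μ :=
        (Continuous.integrable_of_hasCompactSupport (by fun_prop)
          (HasCompactSupport.of_compactSpace _))
      have hci' : Integrable (fun y => matrixCoeff hρ φ v y) μ :=
        (Continuous.integrable_of_hasCompactSupport (by fun_prop)
          (HasCompactSupport.of_compactSpace _))
      rw [map_sub, hA, ContinuousMap.inner_toLp]
      simp only [hconj, mul_sub]
      simp only [hf, mul_sub, mul_one]
      rw [integral_sub (by simpa only [mul_comm] using hci) hci', integral_sub hci (hFi.mul_const _),
        integral_mul_const, integral_ofReal, hFint, integral_matrixCoeff_eq_zero hρ hfix]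
      simp [mul_comm]
    rw [h1]
    have h2 : ∀ y, ‖(F y : 𝕜) * (matrixCoeff hρ φ v y - φ v)‖ ≤ F y * (ε / 3 * ‖φ‖) := by
      intro y
      rw [norm_mul, RCLike.norm_ofReal, abs_of_nonneg (hF0 y)]
      by_cases hy : F y = 0
      · rw [hy, zero_mul, zero_mul]
      · refine mul_le_mul_of_nonneg_left ?_ (hF0 y)
        rw [matrixCoeff_apply, ← map_sub, mul_comm]
        exact φ.le_opNorm_of_le (hFQ y hy v hg)
    refine (norm_integral_le_of_norm_le ?_ (Eventually.of_forall h2)).trans ?_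
    · exact (Continuous.integrable_of_hasCompactSupport (by fun_prop)
        (HasCompactSupport.of_compactSpace _))
    · rw [integral_mul_const, hFint, one_mul]
  have hcoef' : ∀ φ : StrongDual 𝕜 W,
      ‖φ (A (E.starProjection f') v - A f' v)‖ ≤ ε / 3 * ‖φ‖ := by
    intro φ
    rw [map_sub, hA, hA, ← inner_sub_left]
    refine (norm_inner_le_norm _ _).trans ?_
    have h1 := (norm_toLp_le_norm (μ := μ) 2 (matrixCoeff hρ φ v)).trans
      (norm_matrixCoeff_le hρ hC φ v)
    have h2 : ‖φ‖ * (C * ‖v‖) ≤ ‖φ‖ * (C * |M| + 1) := by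
      refine mul_le_mul_of_nonneg_left ?_ (norm_nonneg _)
      have := mul_le_mul_of_nonneg_left (hM' v hg) hC0
      linarith
    rw [norm_sub_rev]
    calc _ ≤ ε / (3 * (C * |M| + 1)) * (‖φ‖ * (C * |M| + 1)) :=
          mul_le_mul hnear.le (h1.trans h2) (norm_nonneg _) (by positivity)
      _ = ε / 3 * ‖φ‖ := by field_simp
  have h3 : ‖A (E.starProjection f') v - v‖ ≤ ε / 3 + ε / 3 := by
    rw [← sub_add_sub_cancel _ (A f' v)]
    exact (norm_add_le _ _).trans (add_le_add
      (NormedSpace.norm_le_dual_bound 𝕜 _ (by positivity) hcoef')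
      (NormedSpace.norm_le_dual_bound 𝕜 _ (by positivity) hcoef))
  linarith

end CompactGroup

/-! ### Interpolation and the translation action -/

section CompactGroup

set_option linter.unusedSectionVars false

variable {𝕜 : Type*} [RCLike 𝕜]

theorem norm_toLp_two_sq_le {K : Type*} [TopologicalSpace K] [CompactSpace K]
    [SecondCountableTopology K] [MeasurableSpace K] [BorelSpace K] {μ : Measure K}
    [IsFiniteMeasure μ] (f : C(K, 𝕜)) :
    ‖ContinuousMap.toLp 2 μ 𝕜 f‖ ^ 2 ≤ ‖f‖ * ‖ContinuousMap.toLp 1 μ 𝕜 f‖ := by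
  have h1 : ‖ContinuousMap.toLp 1 μ 𝕜 f‖ = ∫ x, ‖f x‖ ∂μ := by
    rw [L1.norm_eq_integral_norm]
    refine integral_congr_ae ?_
    filter_upwards [ContinuousMap.coeFn_toLp (p := 1) (𝕜 := 𝕜) μ f] with x hx
    rw [hx]
  have h2 : ‖ContinuousMap.toLp 2 μ 𝕜 f‖ ^ 2 = ‖∫ x, f x * starRingEnd 𝕜 (f x) ∂μ‖ := by
    rw [← ContinuousMap.inner_toLp, inner_self_eq_norm_sq_to_K]
    simp
  rw [h1, h2, ← integral_const_mul]
  refine norm_integral_le_of_norm_le ?_ (Eventually.of_forall fun x => ?_)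
  · exact Continuous.integrable_of_hasCompactSupport (by fun_prop) (HasCompactSupport.of_compactSpace _)
  · rw [norm_mul, RCLike.norm_conj]
    exact mul_le_mul_of_nonneg_right (f.norm_coe_le_norm x) (norm_nonneg _)

/-- With y at rate η²/(|D|+1), the bound on x² is completed to the square of η L + |D||B|/(2η). -/
theorem forall_le_of_sq_le {α : Type*} {L : α → ℕ} {x y : α → ℝ} {D : ℝ}
    (hy0 : ∀ a, 0 ≤ y a) (h : ∀ a, x a ^ 2 ≤ D * L a * y a)
    (hy : ∀ η > 0, ∃ B : ℝ, ∀ a, y a ≤ η * L a + B) :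
    ∀ η > 0, ∃ B : ℝ, ∀ a, x a ≤ η * L a + B := by
  intro η hη
  obtain ⟨B, hB⟩ := hy (η ^ 2 / (|D| + 1)) (by positivity)
  refine ⟨|D| * |B| / (2 * η), fun a => abs_le_of_sq_le_sq' ?_ (by positivity) |>.2⟩
  have hL : (0 : ℝ) ≤ L a := Nat.cast_nonneg _
  have h1 : y a ≤ η ^ 2 / (|D| + 1) * L a + |B| := (hB a).trans (by gcongr; exact le_abs_self B)
  have h3 : D * L a * y a ≤ |D| * L a * (η ^ 2 / (|D| + 1) * L a + |B|) :=
    mul_le_mul (mul_le_mul_of_nonneg_right (le_abs_self D) hL) h1 (hy0 a) (by positivity)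
  have h4 : |D| * (η ^ 2 / (|D| + 1)) ≤ η ^ 2 := by
    rw [← mul_div_assoc, div_le_iff₀ (by positivity)]
    nlinarith [sq_nonneg η]
  calc x a ^ 2 ≤ |D| * L a * (η ^ 2 / (|D| + 1) * L a + |B|) := (h a).trans h3
    _ = |D| * (η ^ 2 / (|D| + 1)) * L a ^ 2 + |D| * |B| * L a := by ring
    _ ≤ η ^ 2 * L a ^ 2 + |D| * |B| * L a := by gcongr
    _ ≤ η ^ 2 * L a ^ 2 + |D| * |B| * L a + (|D| * |B| / (2 * η)) ^ 2 := by
      linarith [sq_nonneg (|D| * |B| / (2 * η))]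
    _ = (η * L a + |D| * |B| / (2 * η)) ^ 2 := by field_simp; ring

variable {G : Type*} [Group G] [TopologicalSpace G] [IsTopologicalGroup G]
  [LocallyCompactSpace G] {K : Type*} [Group K] [TopologicalSpace K] [IsTopologicalGroup K]
  [SecondCountableTopology K] [MeasurableSpace K] [BorelSpace K]

/-- A group acts by left translations on the targets of its homomorphisms. -/
def translationAction {ι : G →* K} (hι : Continuous ι) (μ : Measure K) [μ.IsMulLeftInvariant] :
    MPAction G μ where
  act g k := ι g * k
  measurable_act := by
    have h1 : @Measurable G K (lebesgueSigmaAlgebra G) _ ι := by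
      let _ : MeasurableSpace G := borel G
      have _ : BorelSpace G := ⟨rfl⟩
      intro s hs
      exact (hι.measurable hs).nullMeasurableSet
    let _ : MeasurableSpace G := lebesgueSigmaAlgebra G
    exact (h1.comp measurable_fst).mul measurable_snd
  act_mul g h := Eventually.of_forall fun k => by rw [map_mul, mul_assoc]
  measurePreserving g := measurePreserving_mul_left μ (ι g)

theorem koopman_translationAction [CompactSpace K] {ι : G →* K} (hι : Continuous ι) (μ : Measure K)
    [IsFiniteMeasure μ] [μ.IsMulLeftInvariant] (g : G) (f : C(K, 𝕜)) :
    (translationAction hι μ).koopman 𝕜 g (ContinuousMap.toLp 1 μ 𝕜 f) =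
      ContinuousMap.toLp 1 μ 𝕜 (f.comp ⟨fun x => ι g⁻¹ * x, continuous_const_mul _⟩) :=
  rfl

theorem isErgodic_translationAction [CompactSpace K] [T2Space K] {ι : G →* K} (hι : Continuous ι)
    (hd : DenseRange ι) (μ : Measure K) [IsFiniteMeasure μ] [μ.IsMulLeftInvariant]
    [μ.InnerRegular] : (translationAction hι μ).IsErgodic := by
  intro E hE hinv
  have h1 : Dense {k : K | (k • ·) ⁻¹' E =ᵐ[μ] E} :=
    hd.mono (by rintro _ ⟨g, rfl⟩; exact hinv g)
  have h2 := aeconst_of_dense_setOfPred_preimage_smul_ae hE.nullMeasurableSet h1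
  rw [eventuallyConst_set'] at h2
  rcases h2 with h2 | h2
  · exact Or.inl (ae_eq_empty.1 h2)
  · exact Or.inr (ae_eq_univ.1 h2)

end CompactGroup

/-! ### The mean ergodic theorem applied to coefficients -/

section MeanErgodic

variable {𝕜 : Type} [RCLike 𝕜] {G : Type u} [Group G] [TopologicalSpace G] [IsTopologicalGroup G]
  [LocallyCompactSpace G] {K : Type v} [Group K] [TopologicalSpace K] [IsTopologicalGroup K]
  [CompactSpace K] [T2Space K] [SecondCountableTopology K]
  {W : Type*} [NormedAddCommGroup W] [NormedSpace 𝕜 W] [CompleteSpace W]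

/-- The mean ergodic theorem for translations on a compact group, in terms of matrix coefficients
of a Banach space valued cocycle. -/
theorem MeanErgodicL1.matrixCoeff_sublinear [MeasurableSpace K] [BorelSpace K] {μ : Measure K}
    [IsProbabilityMeasure μ] [μ.IsMulLeftInvariant] [μ.IsMulRightInvariant] [μ.InnerRegular]
    {S : Set G} (h : MeanErgodicL1.{u, v} 𝕜 G S)
    {ρ : K →* (W →L[𝕜] W)} (hρ : ∀ v, Continuous fun k => ρ k v) {C : ℝ} (hC : ∀ k, ‖ρ k‖ ≤ C)
    (hfix : ∀ v, (∀ k, ρ k v = v) → v = 0) {ι : G →* K} (hι : Continuous ι) (hd : DenseRange ι)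
    {b : G → W} (hbc : Continuous b) (hb : ∀ g h, b (g * h) = ρ (ι g) (b h) + b g)
    {D : ℝ} (hD : ∀ g, ‖b g‖ ≤ D * wordLength S g) (φ : StrongDual 𝕜 W) :
    ∀ η > 0, ∃ B : ℝ, ∀ g,
      ‖ContinuousMap.toLp 2 μ 𝕜 (matrixCoeff hρ φ (b g))‖ ≤ η * wordLength S g + B := by
  have hC0 : 0 ≤ C := (norm_nonneg _).trans (hC 1)
  have hsup : ∀ g, ‖matrixCoeff hρ φ (b g)‖ ≤ ‖φ‖ * C * D * wordLength S g := fun g =>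
    (norm_matrixCoeff_le hρ hC φ (b g)).trans (by
      calc ‖φ‖ * (C * ‖b g‖) ≤ ‖φ‖ * (C * (D * wordLength S g)) := by gcongr; exact hD g
        _ = _ := by ring)
  let A := translationAction hι μ
  have hcont : Continuous fun g => ContinuousMap.toLp 1 μ 𝕜 (matrixCoeff hρ φ (b g)) := by
    have h1 : Continuous fun v => matrixCoeff hρ φ v :=
      AddMonoidHomClass.continuous_of_bound (matrixCoeff hρ φ) (‖φ‖ * C) fun v => by
        rw [mul_assoc]
        exact norm_matrixCoeff_le hρ hC φ v
    exact (ContinuousMap.toLp 1 μ 𝕜).continuous.comp (h1.comp hbc)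
  let c : C(G, Lp 𝕜 1 μ) := ⟨_, hcont⟩
  have hc : c ∈ cocycles (A.koopman 𝕜) := by
    intro g h
    change ContinuousMap.toLp 1 μ 𝕜 (matrixCoeff hρ φ (b (g * h))) =
      A.koopman 𝕜 g (ContinuousMap.toLp 1 μ 𝕜 (matrixCoeff hρ φ (b h))) +
        ContinuousMap.toLp 1 μ 𝕜 (matrixCoeff hρ φ (b g))
    rw [koopman_translationAction, hb, map_add, map_add]
    congr 2
    ext y
    change φ (ρ y⁻¹ (ρ (ι g) (b h))) = φ (ρ (ι g⁻¹ * y)⁻¹ (b h))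
    rw [mul_inv_rev, ← map_inv ι, inv_inv, map_mul]
    rfl
  have hmean : ∀ g, ∫ x, c g x ∂μ = 0 := by
    intro g
    rw [← integral_matrixCoeff_eq_zero hρ hfix φ (b g) (μ := μ)]
    exact integral_congr_ae (ContinuousMap.coeFn_toLp (p := 1) (𝕜 := 𝕜) μ _)
  have htend := h K μ A (isErgodic_translationAction hι hd μ) c hc
  simp only [hmean, map_zero, sub_zero] at htend
  have hsub := forall_norm_le_of_tendsto_inv_smul (D := ‖φ‖ * C * D)
    (fun g => (norm_toLp_le_norm (μ := μ) 1 (matrixCoeff hρ φ (b g))).trans (hsup g)) htend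
  refine forall_le_of_sq_le (D := ‖φ‖ * C * D) (fun g => norm_nonneg _) (fun g => ?_) hsub
  exact (norm_toLp_two_sq_le _).trans (mul_le_mul_of_nonneg_right (hsup g) (norm_nonneg _))

end MeanErgodic

/-! ### Reduction to a separable module -/

section Restrict

variable {𝕜 : Type*} [RCLike 𝕜] {G : Type*} [Group G] [TopologicalSpace G]
  {V : Type*} [NormedAddCommGroup V] [NormedSpace 𝕜 V]

theorem GModule.mem_apVectors_restrict_iff {M : GModule 𝕜 G V} {p : Submodule 𝕜 V}
    {hp : ∀ g, ∀ v ∈ p, M.ρ g v ∈ p} (hcl : IsClosed (p : Set V)) {v : p} :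
    v ∈ (M.restrict p hp).apVectors ↔ (v : V) ∈ M.apVectors := by
  constructor
  · intro h
    refine GModule.isCompact_of_subset_isCompact (h.image continuous_subtype_val) ?_
    rintro _ ⟨g, rfl⟩
    exact ⟨_, subset_closure ⟨g, rfl⟩, rfl⟩
  · intro h
    refine GModule.isCompact_of_subset_isCompact
      (hcl.isClosedEmbedding_subtypeVal.isCompact_preimage h) ?_
    rintro _ ⟨g, rfl⟩
    exact subset_closure ⟨g, rfl⟩

theorem cocycle_span_invariant (M : GModule 𝕜 G V) {b : G → V}
    (hb : ∀ g h, b (g * h) = M.ρ g (b h) + b g) (g : G) :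
    ∀ v ∈ (Submodule.span 𝕜 (Set.range b)).topologicalClosure,
      M.ρ g v ∈ (Submodule.span 𝕜 (Set.range b)).topologicalClosure := by
  intro v hv
  have hle : Submodule.span 𝕜 (Set.range b) ≤
      (Submodule.span 𝕜 (Set.range b)).comap (M.ρ g).toLinearMap := by
    refine Submodule.span_le.2 ?_
    rintro _ ⟨h, rfl⟩
    change M.ρ g (b h) ∈ Submodule.span 𝕜 (Set.range b)
    rw [← add_sub_cancel_right (M.ρ g (b h)) (b g), ← hb]
    exact Submodule.sub_mem _ (Submodule.subset_span ⟨_, rfl⟩) (Submodule.subset_span ⟨_, rfl⟩)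
  exact map_mem_closure (t := (Submodule.span 𝕜 (Set.range b) : Set V)) (M.ρ g).continuous hv
    fun w hw => (show M.ρ g w ∈ Submodule.span 𝕜 (Set.range b) from hle hw)

-- G is the union of the compact powers of S ∪ S⁻¹.
open scoped Pointwise in
theorem isSeparable_range_of_compactlyGenerated [IsTopologicalGroup G] {S : Set G}
    (hS : IsCompact S) (hgen : Subgroup.closure S = ⊤) {b : G → V} (hb : Continuous b) :
    TopologicalSpace.IsSeparable (Set.range b) := by
  have hc : ∀ n : ℕ, IsCompact ((S ∪ S⁻¹) ^ n) := by
    intro n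
    induction n with
    | zero => rw [pow_zero]; exact isCompact_singleton
    | succ n ih => rw [pow_succ]; exact ih.mul (hS.union hS.inv)
  have hprod : ∀ l : List G, (∀ s ∈ l, s ∈ S ∨ s⁻¹ ∈ S) → l.prod ∈ (S ∪ S⁻¹) ^ l.length := by
    intro l hl
    induction l with
    | nil => simp
    | cons a l ih =>
      rw [List.prod_cons, List.length_cons, pow_succ']
      exact Set.mul_mem_mul (hl a List.mem_cons_self) (ih fun s hs => hl s (List.mem_cons_of_mem a hs))
  refine (TopologicalSpace.IsSeparable.iUnion fun n : ℕ =>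
    ((hc n).image hb).isSeparable).mono ?_
  rintro _ ⟨g, rfl⟩
  obtain ⟨l, -, hl, rfl⟩ := exists_list_wordLength hgen g
  exact Set.mem_iUnion.2 ⟨_, _, hprod l hl, rfl⟩

end Restrict

/-! ### The mean ergodic theorem implies property WAP_t -/

section Final

variable {𝕜 : Type} [RCLike 𝕜] {G : Type u} [Group G] [TopologicalSpace G] [IsTopologicalGroup G]
  [LocallyCompactSpace G] {S : Set G}

theorem MeanErgodicL1.almost_coboundary_of_almostPeriodic (h : MeanErgodicL1.{u, v} 𝕜 G S)
    (hS : IsCompact S) (hgen : Subgroup.closure S = ⊤) {W : Type v} [NormedAddCommGroup W]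
    [NormedSpace 𝕜 W] [CompleteSpace W] [TopologicalSpace.SeparableSpace W] (M : GModule 𝕜 G W)
    {C : ℝ} (hC : ∀ g, ‖M.ρ g‖ ≤ C) (hap : ∀ v, v ∈ M.apVectors)
    (hfix : ∀ v, (∀ g, M.ρ g v = v) → v = 0) (b : C(G, W))
    (hb : ∀ g h, b (g * h) = M.ρ g (b h) + b g) {Q : Set G} (hQ : IsCompact Q) {ε : ℝ}
    (hε : 0 < ε) : ∃ v, ∀ g ∈ Q, ‖b g - (v - M.ρ g v)‖ < ε := by
  -- Consisting of pairs of self-maps of W, K lives in the universe of W, as the mean ergodic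
  -- hypothesis requires.
  let K := BohrGroup M.ρ hC
  have _ : CompactSpace K := BohrGroup.compactSpace hap
  have _ : SecondCountableTopology K := BohrGroup.secondCountableTopology
  let _ : MeasurableSpace K := borel K
  have _ : BorelSpace K := ⟨rfl⟩
  let μ : Measure K := Measure.haarMeasure ⊤
  have _ : IsProbabilityMeasure μ := ⟨Measure.haarMeasure_self⟩
  have _ : μ.IsMulRightInvariant := isMulRightInvariant_of_compactSpace μ
  have hρ : ∀ v, Continuous fun k : K => BohrGroup.rep M.ρ hC k v :=
    BohrGroup.continuous_toFun_apply
  have hρC : ∀ k : K, ‖BohrGroup.rep M.ρ hC k‖ ≤ C := fun k =>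
    ContinuousLinearMap.opNorm_le_bound _ ((norm_nonneg _).trans (hC 1)) (BohrGroup.norm_toFun_le k)
  have hKfix : ∀ v, (∀ k : K, BohrGroup.rep M.ρ hC k v = v) → v = 0 := fun v hv =>
    hfix v fun g => hv (BohrGroup.ofHom M.ρ hC g)
  obtain ⟨N, -, hN⟩ := exists_norm_le_on_generators hS b.continuous
  obtain ⟨u, hu⟩ := exists_near_coboundary_of_sublinear hρ (μ := μ) hρC hKfix
    (ι := BohrGroup.ofHom M.ρ hC) BohrGroup.denseRange_of (b := b) hb (wordLength_mul_le hgen)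
    (h.matrixCoeff_sublinear hρ hρC hKfix (BohrGroup.continuous_ofHom M.continuous_orbit)
      BohrGroup.denseRange_of b.continuous hb (norm_cocycle_le hgen hC hb hN))
    (hQ.image b.continuous) hε
  exact ⟨u, fun g hg => hu g ⟨g, hg, rfl⟩⟩

theorem propertyWAPt_of_meanErgodicL1 (hap : PropertyWAPap.{u, v} 𝕜 G)
    (h : MeanErgodicL1.{u, v} 𝕜 G S) (hS : IsCompact S) (hgen : Subgroup.closure S = ⊤) :
    PropertyWAPt.{u, v} 𝕜 G := by
  intro V _ _ _ M hM hfixed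
  rw [subsingleton_reducedH1_iff]
  intro b hb Q hQ ε hε
  -- The Baire arguments behind the projection need separability.
  let V₁ := (Submodule.span 𝕜 (Set.range b)).topologicalClosure
  have hV₁ : IsClosed (V₁ : Set V) := Submodule.isClosed_topologicalClosure _
  have _ : CompleteSpace V₁ := hV₁.completeSpace_coe
  have _ : TopologicalSpace.SeparableSpace V₁ :=
    (isSeparable_range_of_compactlyGenerated hS hgen b.continuous).span.closure.separableSpace
  have _ : SecondCountableTopology V₁ := UniformSpace.secondCountable_of_separable V₁
  let M₁ := M.restrict V₁ (cocycle_span_invariant M hb)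
  have hM₁ : M₁.IsWAP := hM.restrict _ hV₁
  let b₁ : C(G, V₁) := ⟨fun g => ⟨b g, subset_closure (Submodule.subset_span ⟨g, rfl⟩)⟩,
    b.continuous.subtype_mk _⟩
  have hb₁ : ∀ g h, b₁ (g * h) = M₁.ρ g (b₁ h) + b₁ g := fun g h => Subtype.ext (hb g h)
  obtain ⟨p, hpρ, hpap, hpid⟩ := hM₁.exists_projection
  have hpp : ∀ v, p (p v) = p v := fun v => hpid _ (hpap v)
  -- the complement of the almost periodic part
  let V₀ := LinearMap.ker p.toLinearMap
  have hV₀ : ∀ v, v ∈ V₀ ↔ p v = 0 := fun v => Iff.rfl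
  have hV₀cl : IsClosed (V₀ : Set V₁) := p.isClosed_ker
  have _ : CompleteSpace V₀ := hV₀cl.completeSpace_coe
  let M₀ := M₁.restrict V₀ fun g v hv => by rw [hV₀] at hv ⊢; rw [hpρ, hv, map_zero]
  have hap₀ : M₀.apVectors = {0} := by
    refine Set.eq_singleton_iff_unique_mem.2 ⟨?_, fun v hv => Subtype.ext ?_⟩
    · rw [GModule.mem_apVectors_restrict_iff hV₀cl]
      have h0 := hpap 0
      rwa [map_zero] at h0
    · rw [GModule.mem_apVectors_restrict_iff hV₀cl] at hv
      rw [← hpid _ hv]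
      exact v.2
  have hb₀mem : ∀ g, b₁ g - p (b₁ g) ∈ V₀ := fun g => by rw [hV₀, map_sub, hpp, sub_self]
  let b₀ : C(G, V₀) := ⟨fun g => ⟨b₁ g - p (b₁ g), hb₀mem g⟩,
    (b₁.continuous.sub (p.continuous.comp b₁.continuous)).subtype_mk hb₀mem⟩
  have hb₀ : ∀ g h, b₀ (g * h) = M₀.ρ g (b₀ h) + b₀ g := fun g h => Subtype.ext (by
    change b₁ (g * h) - p (b₁ (g * h)) = M₁.ρ g (b₁ h - p (b₁ h)) + (b₁ g - p (b₁ g))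
    rw [hb₁, map_add, hpρ, map_sub]
    abel)
  obtain ⟨v₀, hv₀⟩ := (subsingleton_reducedH1_iff M₀).1 (hap V₀ M₀ (hM₁.restrict _ hV₀cl) hap₀)
    b₀ hb₀ Q hQ (ε / 2) (by positivity)
  -- the almost periodic part
  let W := LinearMap.ker (ContinuousLinearMap.id 𝕜 V₁ - p).toLinearMap
  have hW : ∀ v, v ∈ W ↔ p v = v := fun v =>
    (show v ∈ W ↔ v - p v = 0 from Iff.rfl).trans (sub_eq_zero.trans eq_comm)
  have hWcl : IsClosed (W : Set V₁) := (ContinuousLinearMap.id 𝕜 V₁ - p).isClosed_ker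
  have _ : CompleteSpace W := hWcl.completeSpace_coe
  let MW := M₁.restrict W fun g v hv => by rw [hW] at hv ⊢; rw [hpρ, hv]
  obtain ⟨C, hC⟩ := (hM₁.restrict (p := W) _ hWcl : MW.IsWAP).exists_norm_le
  have hapW : ∀ v, v ∈ MW.apVectors := fun v => by
    rw [GModule.mem_apVectors_restrict_iff hWcl, ← (hW v).1 v.2]
    exact hpap _
  have hfixW : ∀ v, (∀ g, MW.ρ g v = v) → v = 0 := fun v hv => by
    have hv' : ((v : V₁) : V) ∈ M.fixedVectors := fun g =>
      congrArg (fun w : W => ((w : V₁) : V)) (hv g)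
    rw [hfixed] at hv'
    exact Subtype.ext (Subtype.ext hv')
  have hbWmem : ∀ g, p (b₁ g) ∈ W := fun g => by rw [hW, hpp]
  let bW : C(G, W) := ⟨fun g => ⟨p (b₁ g), hbWmem g⟩,
    (p.continuous.comp b₁.continuous).subtype_mk hbWmem⟩
  have hbW : ∀ g h, bW (g * h) = MW.ρ g (bW h) + bW g := fun g h => Subtype.ext (by
    change p (b₁ (g * h)) = M₁.ρ g (p (b₁ h)) + p (b₁ g)
    rw [hb₁, map_add, hpρ])
  obtain ⟨w, hw⟩ := h.almost_coboundary_of_almostPeriodic hS hgen MW hC hapW hfixW bW hbW hQ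
    (ε := ε / 2) (by positivity)
  refine ⟨(v₀ : V₁) + (w : V₁), fun g hg => ?_⟩
  have h₀ : ‖(b₁ g - p (b₁ g)) - ((v₀ : V₁) - M₁.ρ g v₀)‖ < ε / 2 := hv₀ g hg
  have hw' : ‖p (b₁ g) - ((w : V₁) - M₁.ρ g w)‖ < ε / 2 := hw g hg
  have heq : b₁ g - ((v₀ + w : V₁) - M₁.ρ g (v₀ + w)) =
      ((b₁ g - p (b₁ g)) - ((v₀ : V₁) - M₁.ρ g v₀)) + (p (b₁ g) - ((w : V₁) - M₁.ρ g w)) := by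
    rw [map_add]
    abel
  have hlt : ‖b₁ g - ((v₀ + w : V₁) - M₁.ρ g (v₀ + w))‖ < ε := by
    rw [heq]
    exact (norm_add_le _ _).trans_lt (by linarith)
  exact hlt

end Final

end WAPErgodic

end

theorem mainTheorem11 {𝕜 : Type} [RCLike 𝕜] {G : Type u} [Group G] [TopologicalSpace G]
    [IsTopologicalGroup G] [T2Space G] [LocallyCompactSpace G]
    (S : Set G) (hS : IsCompact S) (hgen : Subgroup.closure S = ⊤)
    (hap : WAPErgodic.PropertyWAPap.{u, v} 𝕜 G) :
    WAPErgodic.MeanErgodicL1.{u, v} 𝕜 G S ↔ WAPErgodic.PropertyWAPt.{u, v} 𝕜 G :=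
  ⟨fun h => WAPErgodic.propertyWAPt_of_meanErgodicL1 hap h hS hgen,
    fun h => WAPErgodic.meanErgodicL1_of_propertyWAPt hS hgen h⟩
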